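/- Let $M$ be a smooth manifold of dimension $n>2$ and let $[g]=\{e^{2\Upsilon}g\}$ be the conformal class of a smooth pseudo-Riemannian metric $g$ on $M$ (of any signature). With $\nabla$ the Levi-Civita connection of $g$, write $(\nabla_a\nabla_b-\nabla_b\nabla_a)X^c=R_{ab}{}^c{}_dX^d$, $R_{ab}=R_{ca}{}^c{}_b$, $R=R_a{}^a$ and $P_{ab}=\frac{1}{n-2}\bigl(R_{ab}-\frac{R}{2(n-1)}g_{ab}\bigr)$. A metric is called a pp-wave if it admits a nowhere vanishing null vector field $K^a$ with $\nabla_aK^b=0$ and $R_{abcd}X^aY^b=0$ for all $X^a,Y^b$ orthogonal to $K^a$. The standard tractor bundle of $[g]$ is, in the splitting given by $g$, the bundle $\mathcal T=\mathbb R\oplus TM\oplus\mathbb R$ with the metric $h\bigl((\rho,X,\sigma),(\alpha,Y,\beta)\bigr)=\sigma\alpha+\rho\beta+g(X,Y)$ and the normal conformal tractor connection $$\bar\nabla_a(\rho,X^b,\sigma)=\bigl(\nabla_a\rho-P_{ab}X^b,\ \nabla_aX^b+\rho\,\delta_a{}^b+\sigma P_a{}^b,\ \nabla_a\sigma-g_{ab}X^b\bigr),$$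 whose curvature is $\bar R_{ab}=\bar\nabla_a\bar\nabla_b-\bar\nabla_b\bar\nabla_a$, with components $\bar R_{abCD}$ when regarded as a 2-form with values in the bilinear forms on $\mathcal T$ by means of $h$. For an open set $U\subseteq M$ consider the conditions (a) over $U$ the conformal class $[g]$ contains a pp-wave, i.e. there is a smooth function $\Upsilon$ on $U$ such that $e^{2\Upsilon}g|_U$ is a pp-wave; (b) over $U$ there is a smooth subbundle $\mathcal H\subset\mathcal T|_U$ of rank two that is totally null for $h$, parallel for $\bar\nabla$, and such that $\bar R_{abCD}X^CY^D=0$ for all $X,Y\in\mathcal H^\perp$. Then, up to passing to open dense subsets, (a) and (b) are equivalent: (a) holds for some open dense subset $U$ of $M$ if and only if (b) holds for some open dense subset $U$ of $M$. More precisely, for every open $U\subseteq M$: if (a) holds for $U$, then (b) holds for the same $U$; and if (b) holds for $U$ (for instance for $U=M$), then (a) holds for some open dense subset $V$ of $U$. -/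

import Mathlib

open scoped Manifold ContDiff Bundle

noncomputable section

/-! ### Semi-Riemannian calculus in local coordinates

`G : EuclideanSpace ℝ (Fin n) → Matrix (Fin n) (Fin n) ℝ` is the matrix of components `g_{ij}` of
a metric in a coordinate system; all indices refer to the coordinate frame. -/

namespace Coord

variable {n : ℕ}

/-- The partial derivative `∂_i f` at `y`. -/
def pd (i : Fin n) (f : EuclideanSpace ℝ (Fin n) → ℝ) (y : EuclideanSpace ℝ (Fin n)) : ℝ :=
  fderiv ℝ f y (EuclideanSpace.single i 1)

variable (G : EuclideanSpace ℝ (Fin n) → Matrix (Fin n) (Fin n) ℝ)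

/-- Christoffel symbols of the Levi-Civita connection: `christoffel G c a b = Γ^c_{ab}`. -/
def christoffel (c a b : Fin n) (y : EuclideanSpace ℝ (Fin n)) : ℝ :=
  (1 / 2) * ∑ l, (G y)⁻¹ c l *
    (pd a (fun z => G z b l) y + pd b (fun z => G z a l) y - pd l (fun z => G z a b) y)

/-- Levi-Civita covariant derivative of a vector field: `covVec G X a b = (∇_a X)^b`. -/
def covVec (X : EuclideanSpace ℝ (Fin n) → Fin n → ℝ) (a b : Fin n)
    (y : EuclideanSpace ℝ (Fin n)) : ℝ :=
  pd a (fun z => X z b) y + ∑ c, christoffel G b a c y * X y c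

/-- Curvature `riemannUp G a b c d = R_{ab}{}^c{}_d`, determined by
`(∇_a ∇_b - ∇_b ∇_a) X^c = R_{ab}{}^c{}_d X^d`. -/
def riemannUp (a b c d : Fin n) (y : EuclideanSpace ℝ (Fin n)) : ℝ :=
  pd a (christoffel G c b d) y - pd b (christoffel G c a d) y
    + ∑ e, (christoffel G c a e y * christoffel G e b d y
      - christoffel G c b e y * christoffel G e a d y)

/-- Curvature with all indices lowered: `riemann G a b c d = R_{abcd} = g_{ce} R_{ab}{}^e{}_d`. -/
def riemann (a b c d : Fin n) (y : EuclideanSpace ℝ (Fin n)) : ℝ :=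
  ∑ e, G y c e * riemannUp G a b e d y

/-- Ricci tensor `R_{ab} = R_{ca}{}^c{}_b`. -/
def ricci (a b : Fin n) (y : EuclideanSpace ℝ (Fin n)) : ℝ :=
  ∑ c, riemannUp G c a c b y

/-- Scalar curvature `R = g^{ab} R_{ab}`. -/
def scal (y : EuclideanSpace ℝ (Fin n)) : ℝ :=
  ∑ a, ∑ b, (G y)⁻¹ a b * ricci G a b y

/-- Schouten tensor `P_{ab} = (R_{ab} - R / (2 (n - 1)) g_{ab}) / (n - 2)`. -/
def schouten (a b : Fin n) (y : EuclideanSpace ℝ (Fin n)) : ℝ :=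
  (1 / ((n : ℝ) - 2)) * (ricci G a b y - scal G y / (2 * ((n : ℝ) - 1)) * G y a b)

/-- Standard tractors in coordinates: triples `(ρ, X^a, σ)`. -/
abbrev Tr (n : ℕ) : Type := ℝ × (Fin n → ℝ) × ℝ

/-- The normal conformal tractor connection in the splitting given by the metric:
`∇_a (ρ, X^b, σ) =
  (∇_a ρ - P_{ab} X^b, ∇_a X^b + ρ δ_a^b + σ P_a{}^b, ∇_a σ - g_{ab} X^b)`. -/
def tractorConn (a : Fin n) (V : EuclideanSpace ℝ (Fin n) → Tr n)
    (y : EuclideanSpace ℝ (Fin n)) : Tr n :=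
  (pd a (fun z => (V z).1) y - ∑ b, schouten G a b y * (V y).2.1 b,
    fun b => covVec G (fun z => (V z).2.1) a b y + (V y).1 * (if a = b then 1 else 0)
      + (V y).2.2 * ∑ c, (G y)⁻¹ b c * schouten G a c y,
    pd a (fun z => (V z).2.2) y - ∑ b, G y a b * (V y).2.1 b)

/-- The tractor curvature `R̄_{ab} v = (∇_a ∇_b - ∇_b ∇_a) v` at `y`. It is tensorial, so it is
evaluated on the section with constant components `v`. -/
def tractorCurv (a b : Fin n) (v : Tr n) (y : EuclideanSpace ℝ (Fin n)) : Tr n :=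
  tractorConn G a (tractorConn G b (fun _ => v)) y
    - tractorConn G b (tractorConn G a (fun _ => v)) y

end Coord

/-! ### Fields on a manifold and their coordinate expressions -/

section Manifold

variable {n : ℕ} {M : Type*} [TopologicalSpace M] [ChartedSpace (EuclideanSpace ℝ (Fin n)) M]

/-- A field of bilinear forms on the tangent spaces. -/
abbrev BilinField (n : ℕ) (M : Type*) [TopologicalSpace M]
    [ChartedSpace (EuclideanSpace ℝ (Fin n)) M] : Type _ :=
  ∀ x : M, TangentSpace (𝓡 n) x →L[ℝ] TangentSpace (𝓡 n) x →L[ℝ] ℝ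

/-- A smooth pseudo-Riemannian metric on `M`: a smooth symmetric nondegenerate field of bilinear
forms (any signature). -/
structure IsPseudoRiemannian [IsManifold (𝓡 n) ∞ M] (g : BilinField n M) : Prop where
  smooth : ContMDiff (𝓡 n)
    ((𝓡 n).prod 𝓘(ℝ, EuclideanSpace ℝ (Fin n) →L[ℝ] EuclideanSpace ℝ (Fin n) →L[ℝ] ℝ)) ∞
    (fun x => Bundle.TotalSpace.mk'
      (EuclideanSpace ℝ (Fin n) →L[ℝ] EuclideanSpace ℝ (Fin n) →L[ℝ] ℝ)
      (E := fun x : M => TangentSpace (𝓡 n) x →L[ℝ] TangentSpace (𝓡 n) x →L[ℝ] ℝ) x (g x))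
  symm : ∀ x v w, g x v w = g x w v
  nondeg : ∀ x v, (∀ w, g x v w = 0) → v = 0

/-- The vector field `X` is smooth on the set `U`. -/
def SmoothVecOn [IsManifold (𝓡 n) ∞ M] (X : ∀ x : M, TangentSpace (𝓡 n) x) (U : Set M) : Prop :=
  ContMDiffOn (𝓡 n) (𝓡 n).tangent ∞ (fun x => (⟨x, X x⟩ : TangentBundle (𝓡 n) M)) U

/-- The coordinate vector field `∂_i` of the chart `φ`, at the point with coordinates `y`. -/
def coordBasis (φ : OpenPartialHomeomorph M (EuclideanSpace ℝ (Fin n)))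
    (y : EuclideanSpace ℝ (Fin n)) (i : Fin n) : TangentSpace (𝓡 n) (φ.symm y) :=
  mfderiv 𝓘(ℝ, EuclideanSpace ℝ (Fin n)) (𝓡 n) φ.symm y
    (EuclideanSpace.single i (1 : ℝ) : EuclideanSpace ℝ (Fin n))

/-- The components `g_{ij} = g(∂_i, ∂_j)` in the chart `φ`, as functions of the coordinates. -/
def coordMetric (g : BilinField n M) (φ : OpenPartialHomeomorph M (EuclideanSpace ℝ (Fin n)))
    (y : EuclideanSpace ℝ (Fin n)) : Matrix (Fin n) (Fin n) ℝ :=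
  Matrix.of fun i j => g (φ.symm y) (coordBasis φ y i) (coordBasis φ y j)

/-- The components `X^i = dφ^i(X)` of a vector field, as functions of the coordinates. -/
def coordVec (X : ∀ x : M, TangentSpace (𝓡 n) x)
    (φ : OpenPartialHomeomorph M (EuclideanSpace ℝ (Fin n)))
    (y : EuclideanSpace ℝ (Fin n)) : Fin n → ℝ :=
  fun i => (show EuclideanSpace ℝ (Fin n) from
    mfderiv (𝓡 n) 𝓘(ℝ, EuclideanSpace ℝ (Fin n)) φ (φ.symm y) (X (φ.symm y))) i

/-- `P` holds at every point of `U`, in coordinates: `U` is covered by smooth charts `φ` such that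
`P φ y` holds at every coordinate point `y` of `φ` that represents a point of `U`. This is only
applied to `P` expressing tensorial conditions, whose validity does not depend on the chart. -/
def InCharts [IsManifold (𝓡 n) ∞ M] (U : Set M)
    (P : OpenPartialHomeomorph M (EuclideanSpace ℝ (Fin n)) → EuclideanSpace ℝ (Fin n) → Prop) :
    Prop :=
  ∀ x ∈ U, ∃ φ ∈ IsManifold.maximalAtlas (𝓡 n) ∞ M, x ∈ φ.source ∧
    ∀ y ∈ φ.target, φ.symm y ∈ U → P φ y

/-! ### pp-waves -/

/-- On the open set `U`, `g` is a pp-wave: there is a null vector field `K` on `U`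
(smooth, nowhere zero) with `∇_a K^b = 0` and `R_{abcd} X^a Y^b = 0` for all `X, Y ⊥ K`. -/
def IsPPWaveOn [IsManifold (𝓡 n) ∞ M] (g : BilinField n M) (U : Set M) : Prop :=
  ∃ K : ∀ x : M, TangentSpace (𝓡 n) x,
    SmoothVecOn K U ∧ (∀ x ∈ U, K x ≠ 0) ∧ (∀ x ∈ U, g x (K x) (K x) = 0) ∧
    InCharts U (fun φ y =>
      (∀ a b, Coord.covVec (coordMetric g φ) (coordVec K φ) a b y = 0) ∧
      (∀ X Y : Fin n → ℝ,
        g (φ.symm y) (∑ i, X i • coordBasis φ y i) (K (φ.symm y)) = 0 →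
        g (φ.symm y) (∑ i, Y i • coordBasis φ y i) (K (φ.symm y)) = 0 →
        ∀ c d, ∑ a, ∑ b, Coord.riemann (coordMetric g φ) a b c d y * X a * Y b = 0))

/-- Over the open set `U`, the conformal class `[g]` contains a pp-wave metric: some
`ĝ = e^{2Υ} g`, with `Υ` a smooth function on `U`, is a pp-wave on `U`. -/
def ClassContainsPPWaveOn [IsManifold (𝓡 n) ∞ M] (g : BilinField n M) (U : Set M) : Prop :=
  ∃ Υ : M → ℝ, ContMDiffOn (𝓡 n) 𝓘(ℝ, ℝ) ∞ Υ U ∧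
    IsPPWaveOn (fun x => Real.exp (2 * Υ x) • g x) U

/-! ### Standard tractors -/

/-- The fibre at `x` of the standard tractor bundle, in the splitting `ℝ ⊕ TM ⊕ ℝ` given by a
metric of the conformal class; its elements are triples `(ρ, X, σ)`. -/
abbrev Tractor (n : ℕ) {M : Type*} [TopologicalSpace M]
    [ChartedSpace (EuclideanSpace ℝ (Fin n)) M] (x : M) : Type :=
  ℝ × TangentSpace (𝓡 n) x × ℝ

/-- The tractor metric `h((ρ, X, σ), (α, Y, β)) = σ α + ρ β + g(X, Y)`. -/
def tractorMetric (g : BilinField n M) (x : M) (v w : Tractor n x) : ℝ :=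
  v.2.2 * w.1 + v.1 * w.2.2 + g x v.2.1 w.2.1

/-- A section `(ρ, X, σ)` of the tractor bundle is smooth on `U`. -/
def SmoothTractorOn [IsManifold (𝓡 n) ∞ M] (s : ∀ x : M, Tractor n x) (U : Set M) : Prop :=
  ContMDiffOn (𝓡 n) 𝓘(ℝ, ℝ) ∞ (fun x => (s x).1) U ∧
    SmoothVecOn (fun x => (s x).2.1) U ∧
    ContMDiffOn (𝓡 n) 𝓘(ℝ, ℝ) ∞ (fun x => (s x).2.2) U

/-- The coordinate expression of a section of the tractor bundle in the chart `φ`. -/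
def coordTractor (s : ∀ x : M, Tractor n x)
    (φ : OpenPartialHomeomorph M (EuclideanSpace ℝ (Fin n)))
    (y : EuclideanSpace ℝ (Fin n)) : Coord.Tr n :=
  ((s (φ.symm y)).1, coordVec (fun x => (s x).2.1) φ y, (s (φ.symm y)).2.2)

/-- The tractor with components `v` in the chart `φ`, at the point with coordinates `y`. -/
def tractorOfCoord (φ : OpenPartialHomeomorph M (EuclideanSpace ℝ (Fin n)))
    (y : EuclideanSpace ℝ (Fin n)) (v : Coord.Tr n) : Tractor n (φ.symm y) :=
  (v.1, ∑ i, v.2.1 i • coordBasis φ y i, v.2.2)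

/-- `H` is a smooth totally null plane subbundle (rank two) of the standard tractor bundle over the
open set `U`. -/
structure IsNullPlaneBundleOn [IsManifold (𝓡 n) ∞ M] (g : BilinField n M) (U : Set M)
    (H : ∀ x : M, Submodule ℝ (Tractor n x)) : Prop where
  rank_two : ∀ x ∈ U, Module.finrank ℝ (H x) = 2
  smooth : ∀ x ∈ U, ∃ W : Set M, IsOpen W ∧ x ∈ W ∧ W ⊆ U ∧
    ∃ s t : ∀ x : M, Tractor n x, SmoothTractorOn s W ∧ SmoothTractorOn t W ∧
      ∀ z ∈ W, H z = Submodule.span ℝ {s z, t z}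
  totally_null : ∀ x ∈ U, ∀ v ∈ H x, ∀ w ∈ H x, tractorMetric g x v w = 0

/-- `H` is parallel for the normal conformal tractor connection at the point of `U` with coordinates
`y` in `φ`: covariant derivatives of local smooth sections of `H` take their values in `H`. -/
def IsParallelAt [IsManifold (𝓡 n) ∞ M] (g : BilinField n M) (U : Set M)
    (H : ∀ x : M, Submodule ℝ (Tractor n x))
    (φ : OpenPartialHomeomorph M (EuclideanSpace ℝ (Fin n)))
    (y : EuclideanSpace ℝ (Fin n)) : Prop :=
  ∀ W : Set M, IsOpen W → W ⊆ U → φ.symm y ∈ W →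
    ∀ s : ∀ x : M, Tractor n x, SmoothTractorOn s W → (∀ z ∈ W, s z ∈ H z) →
      ∀ a, tractorOfCoord φ y (Coord.tractorConn (coordMetric g φ) a (coordTractor s φ) y)
        ∈ H (φ.symm y)

/-- `R̄_{abCD} X^C Y^D = 0` for all `X, Y ⊥ H`, at the point with coordinates `y` in `φ`. -/
def TractorCurvatureVanishesAt (g : BilinField n M)
    (H : ∀ x : M, Submodule ℝ (Tractor n x))
    (φ : OpenPartialHomeomorph M (EuclideanSpace ℝ (Fin n)))
    (y : EuclideanSpace ℝ (Fin n)) : Prop :=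
  ∀ X Y : Coord.Tr n,
    (∀ v ∈ H (φ.symm y), tractorMetric g (φ.symm y) (tractorOfCoord φ y X) v = 0) →
    (∀ v ∈ H (φ.symm y), tractorMetric g (φ.symm y) (tractorOfCoord φ y Y) v = 0) →
    ∀ a b, tractorMetric g (φ.symm y)
      (tractorOfCoord φ y (Coord.tractorCurv (coordMetric g φ) a b X y))
      (tractorOfCoord φ y Y) = 0

/-- Over `U`, the tractor bundle has a totally null plane subbundle `H` that is parallel for the
normal conformal tractor connection and such that `R̄_{abCD} X^C Y^D = 0` for all `X, Y ⊥ H`. -/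
def AdmitsPPTractorPlaneOn [IsManifold (𝓡 n) ∞ M] (g : BilinField n M) (U : Set M) : Prop :=
  ∃ H : ∀ x : M, Submodule ℝ (Tractor n x), IsNullPlaneBundleOn g U H ∧
    InCharts U (fun φ y => IsParallelAt g U H φ y ∧ TractorCurvatureVanishesAt g H φ y)

end Manifold

end

/-!
Everything happens in coordinates. A tractor is a triple `(ρ, X, σ)`, and the tractor connection
is studied as the operator `tconn G P` for an arbitrary matrix field `P` in the place of
the Schouten tensor. The endomorphism part `weylEnd G P` of its curvature is unchanged when `G` is
replaced by `e^{2U} G` and `P` by `confP G P U` (`weylEnd_conformal`), and it is trace-free exactly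
for the Schouten tensor (`trace_weylEnd_sch`, `eq_sch_of_trace`). Hence `confP` carries Schouten
tensors to Schouten tensors (`confP_sch`), without computing how the Ricci tensor transforms, and
the change of splitting `gauge G U` intertwines the normal tractor connections and curvatures of
the two metrics (`tractorConn_gauge`, `tractorCurv_gauge`).

From a pp-wave to a plane bundle: curvature vanishing on the complement of the parallel null field
`K` makes the Schouten tensor of the pp-wave a multiple of `κ ⊗ κ`, where `κ` is dual to `K`
(`IsPPOn.exists_schouten_eq`). So, in the splitting given by the pp-wave, the plane spanned by
`(0, K, 0)` and `(0, 0, 1)` is totally null and parallel, and the tractor curvature vanishes on its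
complement. The change of splitting moves this plane to the splitting of `g`.

From a plane bundle to a pp-wave: the bottom components of the plane cannot vanish identically on
an open set, since then so would the middle components (`exists_bottom_ne_zero`). Where one of them
is nonzero there is a frame `V = (ρ, K, 0)`, `W = (α, Y, 1)` (`IsPlaneFrame`). Write `κ`, `η` for
the one-forms dual to `K`, `Y`; the bottom component forces `D_a V = c_a V - κ_a W`, and the middle
component gives `dκ = (c + η) ∧ κ`. By the Ricci identity for `V`, the field `K` is an eigenvector
of all Weyl endomorphisms with eigenvalue `d(c - η)`. The curvature hypothesis together with
trace-freeness makes that eigenvalue zero (`weyl_eigenvalue_eq_zero`), so `c - η` is closed. Locally,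
then, `c - η = dψ` by the Poincaré lemma, `κ = φ du` with `φ` nowhere zero by the theorem of
Frobenius, and comparing derivatives `c + η = d log |φ| + m κ` for a function `m`. The function
`U = (ψ - log |φ|) / 2` has `dU = -η + (m / 2) κ`, and `e^{2U} g` is a pp-wave with parallel null
field `e^{-ψ} K` (`IsPlaneFrame.exists_isPPOn`). Finally a maximal disjoint family of open sets
carrying such conformal factors has dense union, and the factors glue because the sets are disjoint.

The theorem of Frobenius for hyperplane fields is proved directly. The points near `x₀` are joined
to a line `x₀ + ℝ N` transversal to the hyperplanes by curves tangent to them, whose projections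
along `N` are radial, and `u` records the starting point on the line. Smooth dependence of these
curves on their parameters comes from the inverse function theorem in the Banach space of continuous paths,
because the superposition operator of a smooth function is smooth on that space
(`contDiff_superposition`, `exists_smooth_radial_solution`, `exists_eq_smul_fderiv_of_integrable`).
-/

open scoped Topology

noncomputable section

/-! ### Superposition operators and the inverse function theorem -/

section Superposition

universe v

set_option synthInstance.maxHeartbeats 400000

variable {X : Type v} [NormedAddCommGroup X] [NormedSpace ℝ X]

/-- The superposition (Nemytskii) operator `p ↦ F ∘ p` between spaces of continuous paths. -/
def superposition {Y : Type*} [TopologicalSpace Y] (F : C(X, Y))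
    (p : C(unitInterval, X)) : C(unitInterval, Y) := F.comp p

/-- The pointwise pairing of paths induced by a continuous bilinear map, as a bilinear map of
path spaces. -/
def pathPairing {A B C : Type*} [NormedAddCommGroup A] [NormedSpace ℝ A]
    [NormedAddCommGroup B] [NormedSpace ℝ B] [NormedAddCommGroup C] [NormedSpace ℝ C]
    (β : A →L[ℝ] B →L[ℝ] C) : C(unitInterval, A) →ₗ[ℝ] C(unitInterval, B) →ₗ[ℝ] C(unitInterval, C) :=
  LinearMap.mk₂ ℝ (fun f h => (⟨fun t => β (f t) (h t), by fun_prop⟩ : C(unitInterval, C)))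
      (fun f g h => by ext t; simp) (fun c f h => by ext t; simp)
      (fun f h k => by ext t; simp) (fun c f h => by ext t; simp)

/-- `pathPairing` as a continuous bilinear map. -/
def pathPairingL {A B C : Type*} [NormedAddCommGroup A] [NormedSpace ℝ A]
    [NormedAddCommGroup B] [NormedSpace ℝ B] [NormedAddCommGroup C] [NormedSpace ℝ C]
    (β : A →L[ℝ] B →L[ℝ] C) :
    C(unitInterval, A) →L[ℝ] C(unitInterval, B) →L[ℝ] C(unitInterval, C) :=
  LinearMap.mkContinuous₂ (pathPairing β) ‖β‖
    (fun f h => by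
      refine (ContinuousMap.norm_le _ (by positivity)).2 fun t => ?_
      refine (β.le_opNorm₂ (f t) (h t)).trans ?_
      gcongr
      exacts [f.norm_coe_le_norm t, h.norm_coe_le_norm t])

/-- Pointwise application of a path of continuous linear maps to a path of vectors. -/
def pathApply (X Y : Type v) [NormedAddCommGroup X] [NormedSpace ℝ X]
    [NormedAddCommGroup Y] [NormedSpace ℝ Y] :
    C(unitInterval, X →L[ℝ] Y) →L[ℝ] C(unitInterval, X) →L[ℝ] C(unitInterval, Y) :=
  pathPairingL (ContinuousLinearMap.id ℝ (X →L[ℝ] Y))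

@[simp] lemma pathApply_apply {Y : Type v} [NormedAddCommGroup Y] [NormedSpace ℝ Y]
    (A : C(unitInterval, X →L[ℝ] Y)) (h : C(unitInterval, X)) (t : unitInterval) :
    pathApply X Y A h t = A t (h t) := rfl

lemma hasFDerivAt_superposition {Y : Type v} [NormedAddCommGroup Y] [NormedSpace ℝ Y]
    {F : X → Y} (hF : ContDiff ℝ 1 F) (p : C(unitInterval, X)) :
    HasFDerivAt (superposition ⟨F, hF.continuous⟩)
      (pathApply X Y (superposition ⟨fderiv ℝ F, hF.continuous_fderiv one_ne_zero⟩ p)) p := by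
  have hc : Continuous (superposition (X := X) ⟨fderiv ℝ F, hF.continuous_fderiv one_ne_zero⟩) :=
    ContinuousMap.continuous_postcomp _
  rw [hasFDerivAt_iff_isLittleO_nhds_zero, Asymptotics.isLittleO_iff]
  intro ε hε
  obtain ⟨δ, hδ, hb⟩ := (Metric.continuousAt_iff (α := C(unitInterval, X))
    (β := C(unitInterval, X →L[ℝ] Y))).1 hc.continuousAt ε hε
  filter_upwards [Metric.ball_mem_nhds (0 : C(unitInterval, X)) hδ] with h hh
  rw [mem_ball_zero_iff] at hh
  refine (ContinuousMap.norm_le _ (by positivity)).2 fun t => ?_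
  have key : ∀ q ∈ Metric.ball (p t) δ, ‖fderiv ℝ F q - fderiv ℝ F (p t)‖ ≤ ε := by
    intro q hq
    -- shift the whole path by the constant vector `q - p t`
    have h1 := hb (x := p + ContinuousMap.const _ (q - p t)) (by
      rw [dist_eq_norm, add_sub_cancel_left]
      refine lt_of_le_of_lt ((ContinuousMap.norm_le _ (norm_nonneg (q - p t))).2 fun s => le_rfl) ?_
      rwa [← dist_eq_norm])
    have h2 := (ContinuousMap.dist_apply_le_dist (f := superposition
      ⟨fderiv ℝ F, hF.continuous_fderiv one_ne_zero⟩ (p + ContinuousMap.const _ (q - p t)))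
      (g := superposition ⟨fderiv ℝ F, hF.continuous_fderiv one_ne_zero⟩ p) t).trans h1.le
    simpa [superposition, dist_eq_norm] using h2
  have hin : p t + h t ∈ Metric.ball (p t) δ := by
    rw [mem_ball_iff_norm, add_sub_cancel_left]
    exact (h.norm_coe_le_norm t).trans_lt hh
  have := (convex_ball (p t) δ).norm_image_sub_le_of_norm_hasFDerivWithin_le'
    (f := F) (f' := fderiv ℝ F) (φ := fderiv ℝ F (p t)) (C := ε)
    (fun q _ => (hF.differentiable one_ne_zero q).hasFDerivAt.hasFDerivWithinAt) key
    (Metric.mem_ball_self hδ) hin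
  rw [add_sub_cancel_left] at this
  exact this.trans (by gcongr; exact h.norm_coe_le_norm t)

lemma contDiff_superposition_nat (k : ℕ) : ∀ {Y : Type v} [NormedAddCommGroup Y] [NormedSpace ℝ Y]
    {F : X → Y} (hF : ContDiff ℝ ∞ F), ContDiff ℝ k (superposition ⟨F, hF.continuous⟩) := by
  induction k with
  | zero =>
    intro Y _ _ F hF
    exact contDiff_zero.2 (ContinuousMap.continuous_postcomp _)
  | succ k ih =>
    intro Y _ _ F hF
    have h1 : ContDiff ℝ 1 F := hF.of_le (by exact_mod_cast le_top)
    rw [Nat.cast_add, Nat.cast_one, contDiff_succ_iff_hasFDerivAt]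
    refine ⟨_, ?_, fun p => hasFDerivAt_superposition h1 p⟩
    exact (ContinuousLinearMap.contDiff (𝕜 := ℝ) (E := C(unitInterval, X →L[ℝ] Y))
      (F := C(unitInterval, X) →L[ℝ] C(unitInterval, Y)) (pathApply X Y)).comp (ih (hF.fderiv_right (m := ∞) (by simp)))

/-- The superposition operator of a smooth map is smooth. -/
lemma contDiff_superposition {Y : Type v} [NormedAddCommGroup Y] [NormedSpace ℝ Y]
    {F : X → Y} (hF : ContDiff ℝ ∞ F) : ContDiff ℝ ∞ (superposition ⟨F, hF.continuous⟩) :=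
  contDiff_infty.2 fun k => contDiff_superposition_nat k hF

end Superposition

/-- The inverse function theorem, with smoothness of the inverse on a whole neighbourhood. -/
lemma exists_smooth_local_inverse {E F : Type*} [NormedAddCommGroup E] [NormedSpace ℝ E]
    [CompleteSpace E] [NormedAddCommGroup F] [NormedSpace ℝ F]
    {f : E → F} {s : Set E} (hs : IsOpen s) (hf : ContDiffOn ℝ ∞ f s) {a : E} (ha : a ∈ s)
    (f' : E ≃L[ℝ] F) (hf' : HasFDerivAt f (f' : E →L[ℝ] F) a) :
    ∃ e : OpenPartialHomeomorph E F, a ∈ e.source ∧ e.source ⊆ s ∧ (∀ x, e x = f x) ∧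
      ContDiffOn ℝ ∞ e.symm e.target := by
  have hfa : ContDiffAt ℝ ∞ f a := hf.contDiffAt (hs.mem_nhds ha)
  let e₀ := hfa.toOpenPartialHomeomorph f hf' (by simp)
  have he₀ : ∀ x, e₀ x = f x := fun x => rfl
  have ha₀ : a ∈ e₀.source := hfa.mem_toOpenPartialHomeomorph_source hf' (by simp)
  have hcont : ContinuousOn (fderiv ℝ f) s := hf.continuousOn_fderiv_of_isOpen hs (by simp)
  have hU : IsOpen (s ∩ fderiv ℝ f ⁻¹' Set.range ((↑) : (E ≃L[ℝ] F) → E →L[ℝ] F)) :=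
    hcont.isOpen_inter_preimage hs ContinuousLinearEquiv.isOpen
  refine ⟨e₀.restrOpen _ hU, ?_, ?_, fun x => he₀ x, ?_⟩
  · rw [OpenPartialHomeomorph.restrOpen_source]
    exact ⟨ha₀, ha, f', hf'.fderiv.symm⟩
  · rw [OpenPartialHomeomorph.restrOpen_source]
    exact fun x hx => hx.2.1
  · intro y hy
    have hx := (e₀.restrOpen _ hU).map_target hy
    rw [OpenPartialHomeomorph.restrOpen_source] at hx
    obtain ⟨g', hg'⟩ := hx.2.2
    have hxs := hs.mem_nhds hx.2.1
    refine ((e₀.restrOpen _ hU).contDiffAt_symm (f₀' := g') hy ?_ ?_).contDiffWithinAt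
    · rw [hg']
      exact ((hf.contDiffAt hxs).differentiableAt (by simp)).hasFDerivAt
    · exact hf.contDiffAt hxs

/-- A smooth function on an open set agrees near any given point with a globally smooth one. -/
lemma exists_contDiff_eqOn_nhd {X : Type*} [NormedAddCommGroup X] [NormedSpace ℝ X]
    [FiniteDimensional ℝ X] {s : Set X} (hs : IsOpen s) {f : X → ℝ} (hf : ContDiffOn ℝ ∞ f s)
    {x : X} (hx : x ∈ s) :
    ∃ F : X → ℝ, ContDiff ℝ ∞ F ∧ ∃ R : Set X, IsOpen R ∧ x ∈ R ∧ R ⊆ s ∧ Set.EqOn F f R := by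
  obtain ⟨ε, hε, hb⟩ := Metric.isOpen_iff.1 hs x hx
  let χ : ContDiffBump x := ⟨ε / 4, ε / 2, by positivity, by linarith⟩
  have hsub : tsupport χ ⊆ s := by
    rw [χ.tsupport_eq]
    exact (Metric.closedBall_subset_ball (by change ε / 2 < ε; linarith)).trans hb
  refine ⟨fun y => χ y * f y, ?_, Metric.ball x (ε / 4), Metric.isOpen_ball,
    Metric.mem_ball_self (by positivity),
    (Metric.ball_subset_ball (by linarith)).trans hb, fun y hy => ?_⟩
  · refine contDiff_iff_contDiffAt.2 fun y => ?_
    by_cases hy : y ∈ tsupport χ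
    · exact χ.contDiff.contDiffAt.mul (hf.contDiffAt (hs.mem_nhds (hsub hy)))
    · have h0 : (fun y => χ y * f y) =ᶠ[𝓝 y] fun _ => (0 : ℝ) := by
        filter_upwards [(isClosed_tsupport χ).isOpen_compl.mem_nhds hy] with z hz
        rw [image_eq_zero_of_notMem_tsupport hz, zero_mul]
      exact contDiffAt_const.congr_of_eventuallyEq h0
  · simp only
    rw [χ.one_of_mem_closedBall (Metric.ball_subset_closedBall hy), one_mul]

/-! ### Integrable one-forms -/

/-- The primitive `t ↦ ∫₀ᵗ f` of a path, as a continuous linear operator. -/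
def pathPrimitive : C(unitInterval, ℝ) →L[ℝ] C(unitInterval, ℝ) :=
  LinearMap.mkContinuous
    { toFun := fun f => ⟨fun t => ∫ s in (0 : ℝ)..t, Set.IccExtend zero_le_one f s,
        (intervalIntegral.continuous_primitive
          (fun a b => (f.continuous.Icc_extend').intervalIntegrable a b) 0).comp
          continuous_subtype_val⟩
      map_add' := fun f g => by
        ext t
        exact intervalIntegral.integral_add
          ((f.continuous.Icc_extend').intervalIntegrable _ _)
          ((g.continuous.Icc_extend').intervalIntegrable _ _)
      map_smul' := fun c f => by
        ext t
        exact intervalIntegral.integral_const_mul c _ } 1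
    (fun f => by
      rw [one_mul]
      refine (ContinuousMap.norm_le _ (norm_nonneg _)).2 fun t => ?_
      have := intervalIntegral.norm_integral_le_of_norm_le_const (a := 0) (b := (t : ℝ))
        (f := Set.IccExtend zero_le_one f) (C := ‖f‖) (fun s _ => f.norm_coe_le_norm _)
      refine this.trans ?_
      rw [sub_zero, abs_of_nonneg t.2.1]
      exact mul_le_of_le_one_right (norm_nonneg _) t.2.2)

lemma pathPrimitive_apply (f : C(unitInterval, ℝ)) (t : unitInterval) :
    pathPrimitive f t = ∫ s in (0 : ℝ)..t, Set.IccExtend zero_le_one f s := rfl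

lemma hasDerivAt_primitive_IccExtend (f : C(unitInterval, ℝ)) (t : ℝ) :
    HasDerivAt (fun t => ∫ s in (0 : ℝ)..t, Set.IccExtend zero_le_one f s)
      (Set.IccExtend zero_le_one f t) t :=
  intervalIntegral.integral_hasDerivAt_right
    ((f.continuous.Icc_extend').intervalIntegrable _ _)
    (f.continuous.Icc_extend').stronglyMeasurable.stronglyMeasurableAtFilter
    (f.continuous.Icc_extend').continuousAt

section Frobenius

variable {E : Type} [NormedAddCommGroup E] [NormedSpace ℝ E] [FiniteDimensional ℝ E]

/-- The linear part of the family of curves `t ↦ x₀ + z(h) N + t pr(h) + w(t) N`, together with the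
constant path `pr(h)`, as a function of `(h, w)`. -/
def radialPath (N : E) (z : E →L[ℝ] ℝ) (pr : E →L[ℝ] E) :
    E × C(unitInterval, ℝ) →L[ℝ] C(unitInterval, E × E) :=
  (LinearMap.toContinuousLinearMap
    { toFun := fun h => (⟨fun t => (z h • N + (t : ℝ) • pr h, pr h), by fun_prop⟩ :
        C(unitInterval, E × E))
      map_add' := fun h k => by
        ext t
        · simp [add_smul]; abel
        · simp
      map_smul' := fun c h => by
        ext t <;> simp [smul_smul, mul_comm] }).coprod
  ((ContinuousLinearMap.toSpanSingleton ℝ ((N, 0) : E × E)).compLeftContinuous ℝ unitInterval)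

lemma radialPath_apply (N : E) (z : E →L[ℝ] ℝ) (pr : E →L[ℝ] E) (h : E)
    (w : C(unitInterval, ℝ)) (t : unitInterval) :
    radialPath N z pr (h, w) t = (z h • N + (t : ℝ) • pr h + w t • N, pr h) := by
  simp [radialPath]

/-- Smooth dependence on parameters for the scalar equation
`w' = F(x₀ + z(h) N + t pr(h) + w N, pr(h))`, `w(0) = 0`, with parameter `h` near `0`: the solution
is a smooth function of `h` with values in the space of continuous paths. -/
lemma exists_smooth_radial_solution {F : E × E → ℝ} (hF : ContDiff ℝ ∞ F) (x₀ N : E)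
    (z : E →L[ℝ] ℝ) (pr : E →L[ℝ] E) (hF0 : F (x₀, 0) = 0)
    (hFd : ∀ q h, fderiv ℝ F (x₀, 0) (q, pr h) = 0) :
    ∃ B : Set E, IsOpen B ∧ 0 ∈ B ∧ ∃ W : E → C(unitInterval, ℝ), ContDiffOn ℝ ∞ W B ∧ W 0 = 0 ∧
      ∀ h ∈ B, W h = pathPrimitive (superposition ⟨F, hF.continuous⟩
        (ContinuousMap.const _ (x₀, 0) + radialPath N z pr (h, W h))) := by
  let Φ : E × C(unitInterval, ℝ) → E × C(unitInterval, ℝ) := fun p =>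
    (p.1, p.2 - pathPrimitive (superposition ⟨F, hF.continuous⟩
        (ContinuousMap.const _ (x₀, 0) + radialPath N z pr p)))
  have hpath : ContDiff ℝ ∞ fun p : E × C(unitInterval, ℝ) =>
      (ContinuousMap.const unitInterval ((x₀, 0) : E × E) + radialPath N z pr p) :=
    contDiff_const.add (radialPath N z pr).contDiff
  have hΦ : ContDiff ℝ ∞ Φ :=
    contDiff_fst.prodMk (contDiff_snd.sub (pathPrimitive.contDiff.comp
      ((contDiff_superposition hF).comp hpath)))
  have hΦ0 : Φ 0 = 0 := by
    simp only [Φ, Prod.mk_eq_zero, Prod.fst_zero, Prod.snd_zero, map_zero, add_zero, true_and,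
      zero_sub, neg_eq_zero]
    convert! map_zero pathPrimitive
    ext t
    exact hF0
  have h1 : ContDiff ℝ 1 F := hF.of_le (by exact_mod_cast le_top)
  have hd : HasFDerivAt Φ ((ContinuousLinearEquiv.refl ℝ (E × C(unitInterval, ℝ)) :
      E × C(unitInterval, ℝ) →L[ℝ] E × C(unitInterval, ℝ))) 0 := by
    have hin : HasFDerivAt (fun p : E × C(unitInterval, ℝ) =>
      (ContinuousMap.const unitInterval ((x₀, 0) : E × E) + radialPath N z pr p))
        (radialPath N z pr) 0 := (radialPath N z pr).hasFDerivAt.const_add _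
    have hs := pathPrimitive.hasFDerivAt.comp (0 : E × C(unitInterval, ℝ))
      ((hasFDerivAt_superposition h1 _).comp (0 : E × C(unitInterval, ℝ)) hin)
    have := (hasFDerivAt_fst (𝕜 := ℝ) (p := (0 : E × C(unitInterval, ℝ)))).prodMk
      ((hasFDerivAt_snd (𝕜 := ℝ) (p := (0 : E × C(unitInterval, ℝ)))).sub hs)
    refine this.congr_fderiv ?_
    refine ContinuousLinearMap.ext fun p => ?_
    refine Prod.ext rfl ?_
    change p.2 - pathPrimitive _ = p.2
    rw [sub_eq_self]
    convert! map_zero pathPrimitive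
    ext t
    have hp : radialPath N z pr p t = (z p.1 • N + (t : ℝ) • pr p.1 + p.2 t • N, pr p.1) :=
      radialPath_apply N z pr p.1 p.2 t
    change fderiv ℝ F (((x₀, 0) : E × E) + radialPath N z pr 0 t) (radialPath N z pr p t) = 0
    rw [map_zero, ContinuousMap.zero_apply, add_zero, hp]
    exact hFd _ _
  obtain ⟨e, he0, -, heq, hesm⟩ := exists_smooth_local_inverse isOpen_univ hΦ.contDiffOn
    (Set.mem_univ _) _ hd
  have h0t : (0 : E × C(unitInterval, ℝ)) ∈ e.target := by
    have := e.map_source he0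
    rwa [heq, hΦ0] at this
  have hcont : Continuous fun h : E => ((h, 0) : E × C(unitInterval, ℝ)) := by fun_prop
  refine ⟨_, e.open_target.preimage hcont, h0t, fun h => (e.symm (h, 0)).2, ?_, ?_, ?_⟩
  · refine contDiff_snd.comp_contDiffOn (hesm.comp (t := e.target) ?_ fun h hh => hh)
    exact (contDiff_id.prodMk contDiff_const).contDiffOn
  · have : e.symm (e 0) = 0 := e.left_inv he0
    rw [heq, hΦ0] at this
    change (e.symm 0).2 = 0
    rw [this]; rfl
  · intro h hh
    have h2 : Φ (e.symm (h, 0)) = (h, 0) := by rw [← heq]; exact e.right_inv hh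
    have h3 : (e.symm (h, 0)).1 = h := congrArg Prod.fst h2
    have h4 := congrArg Prod.snd h2
    have h5 : e.symm (h, 0) = (h, (e.symm (h, 0)).2) := Prod.ext h3 rfl
    simp only [Φ] at h4
    rw [sub_eq_zero] at h4
    beta_reduce
    rw [← h5]
    exact h4

end Frobenius

section Frobenius

variable {E : Type} [NormedAddCommGroup E] [NormedSpace ℝ E] [FiniteDimensional ℝ E]

omit [FiniteDimensional ℝ E] in
/-- Along a curve annihilated by an integrable one-form `α`, the value of `α` on a variation field
solves a linear homogeneous equation, hence vanishes if it vanishes initially. -/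
lemma integrable_form_variation_eq_zero {O : Set E} (hO : IsOpen O) {α θ : E → E →L[ℝ] ℝ}
    (hα : ContDiffOn ℝ ∞ α O) (hθ : ContinuousOn θ O)
    (hint : ∀ x ∈ O, ∀ a b, fderiv ℝ α x a b - fderiv ℝ α x b a = θ x a * α x b - θ x b * α x a)
    {γ γ' δ δ' : ℝ → E} (hγ : ∀ t, HasDerivAt γ (γ' t) t) (hδ : ∀ t, HasDerivAt δ (δ' t) t)
    (hγ' : Continuous γ') (hmem : ∀ t ∈ Set.Icc (0 : ℝ) 1, γ t ∈ O)
    (hann : ∀ t ∈ Set.Icc (0 : ℝ) 1, α (γ t) (γ' t) = 0)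
    (hvar : ∀ t ∈ Set.Icc (0 : ℝ) 1, fderiv ℝ α (γ t) (δ t) (γ' t) + α (γ t) (δ' t) = 0)
    (h0 : α (γ 0) (δ 0) = 0) : α (γ 1) (δ 1) = 0 := by
  have hγc : Continuous γ := continuous_iff_continuousAt.2 fun t => (hγ t).continuousAt
  have hder : ∀ t ∈ Set.Icc (0 : ℝ) 1, HasDerivAt (fun t => α (γ t) (δ t))
      (θ (γ t) (γ' t) * α (γ t) (δ t)) t := by
    intro t ht
    have h1 : HasDerivAt (fun t => α (γ t)) (fderiv ℝ α (γ t) (γ' t)) t :=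
      ((hα.contDiffAt (hO.mem_nhds (hmem t ht))).differentiableAt
        (by simp)).hasFDerivAt.comp_hasDerivAt t (hγ t)
    refine (h1.clm_apply (hδ t)).congr_deriv ?_
    have h2 := hint _ (hmem t ht) (γ' t) (δ t)
    rw [hann t ht] at h2
    linarith [hvar t ht]
  have hcont : ContinuousOn (fun t => θ (γ t) (γ' t)) (Set.Icc 0 1) :=
    (hθ.comp hγc.continuousOn hmem).clm_apply hγ'.continuousOn
  obtain ⟨K, hK⟩ := isCompact_Icc.exists_bound_of_continuousOn hcont
  refine eq_zero_of_abs_deriv_le_mul_abs_self_of_eq_zero_right (K := K)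
    (f := fun t => α (γ t) (δ t)) (a := 0) (b := 1)
    (fun t ht => (hder t ht).continuousAt.continuousWithinAt)
    (fun t ht => (hder t ⟨ht.1, ht.2.le⟩).hasDerivWithinAt) h0 (fun t ht => ?_) 1 (by simp)
  rw [norm_mul]
  exact mul_le_mul_of_nonneg_right (hK t ⟨ht.1, ht.2.le⟩) (norm_nonneg _)

/-- The Frobenius theorem for hyperplane fields: a nonvanishing one-form `α` with `dα = θ ∧ α` is,
near any point, a nonvanishing multiple of the differential of a smooth function. -/
theorem exists_eq_smul_fderiv_of_integrable {O : Set E} (hO : IsOpen O) {α θ : E → E →L[ℝ] ℝ}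
    (hα : ContDiffOn ℝ ∞ α O) (hθ : ContinuousOn θ O)
    (hint : ∀ x ∈ O, ∀ a b, fderiv ℝ α x a b - fderiv ℝ α x b a = θ x a * α x b - θ x b * α x a)
    {x₀ : E} (hx₀ : x₀ ∈ O) (hne : α x₀ ≠ 0) :
    ∃ V : Set E, IsOpen V ∧ x₀ ∈ V ∧ V ⊆ O ∧ ∃ u φ : E → ℝ, ContDiffOn ℝ ∞ u V ∧
      ContDiffOn ℝ ∞ φ V ∧ ∀ x ∈ V, φ x ≠ 0 ∧ α x = φ x • fderiv ℝ u x := by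
  obtain ⟨N, hN⟩ : ∃ N, α x₀ N = 1 := by
    obtain ⟨v, hv⟩ : ∃ v, α x₀ v ≠ 0 := by
      by_contra! h
      exact hne (ContinuousLinearMap.ext h)
    exact ⟨(α x₀ v)⁻¹ • v, by simp [hv]⟩
  set z : E →L[ℝ] ℝ := α x₀ with hz
  let pr : E →L[ℝ] E := ContinuousLinearMap.id ℝ E - z.smulRight N
  have hpr : ∀ h, pr h = h - z h • N := fun h => rfl
  have hzpr : ∀ h, z (pr h) = 0 := fun h => by rw [hpr, map_sub, map_smul, hN]; simp
  -- the slope function, defined where `α` does not annihilate `N`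
  let Ω : Set (E × E) := {p | p.1 ∈ O ∧ α p.1 N ≠ 0}
  have hαN : ContDiffOn ℝ ∞ (fun x => α x N) O := hα.clm_apply contDiffOn_const
  have hO' : IsOpen {x | x ∈ O ∧ α x N ≠ 0} :=
    hαN.continuousOn.isOpen_inter_preimage hO isOpen_ne
  have hΩ : IsOpen Ω := hO'.preimage continuous_fst
  have hα1 : ContDiffOn ℝ ∞ (fun p : E × E => α p.1) Ω :=
    hα.comp contDiffOn_fst fun p hp => hp.1
  have hf : ContDiffOn ℝ ∞ (fun p : E × E => -(α p.1 p.2) / α p.1 N) Ω :=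
    ((hα1.clm_apply contDiffOn_snd).neg).div (hα1.clm_apply contDiffOn_const) fun p hp => hp.2
  have hxΩ : ((x₀, 0) : E × E) ∈ Ω := ⟨hx₀, by change z N ≠ 0; rw [hN]; exact one_ne_zero⟩
  obtain ⟨F, hF, R, hR, hxR, hRΩ, hFR⟩ := exists_contDiff_eqOn_nhd hΩ hf hxΩ
  have hFα : ∀ p ∈ R, α p.1 (p.2 + F p • N) = 0 := by
    intro p hp
    have h1 : α p.1 N ≠ 0 := (hRΩ hp).2
    rw [hFR hp, map_add, map_smul, smul_eq_mul, div_mul_cancel₀ _ h1, add_neg_cancel]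
  have hF0 : F (x₀, 0) = 0 := by
    rw [hFR hxR]; simp
  -- the derivative of the identity `α(v + F N) = 0`
  have hident : ∀ p ∈ R, ∀ d v, fderiv ℝ α p.1 d (p.2 + F p • N) +
      α p.1 (v + fderiv ℝ F p (d, v) • N) = 0 := by
    intro p hp d v
    have hα1 : HasFDerivAt (fun p : E × E => α p.1)
        ((fderiv ℝ α p.1).comp (ContinuousLinearMap.fst ℝ E E)) p :=
      (((hα.contDiffAt (hO.mem_nhds (hRΩ hp).1)).differentiableAt
        (by simp)).hasFDerivAt).comp p hasFDerivAt_fst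
    have hF1 : HasFDerivAt F (fderiv ℝ F p) p :=
      (hF.differentiable (by simp) p).hasFDerivAt
    have h2 := hα1.clm_apply ((hasFDerivAt_snd (p := p)).add (hF1.smul_const N))
    have h3 : (fun p : E × E => α p.1 (p.2 + F p • N)) =ᶠ[𝓝 p] fun _ => (0 : ℝ) := by
      filter_upwards [hR.mem_nhds hp] with y hy using hFα y hy
    have h4 := (h2.congr_of_eventuallyEq h3.symm).unique (hasFDerivAt_const (0 : ℝ) p)
    have h5 := congrArg (fun L => L (d, v)) h4
    simpa [add_comm] using h5
  have hFd : ∀ q h, fderiv ℝ F (x₀, 0) (q, pr h) = 0 := by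
    intro q h
    have := hident _ hxR q (pr h)
    simp only [hF0, zero_smul, add_zero, map_zero, zero_add, map_add, map_smul] at this
    rw [← hz, hzpr, hN] at this
    simpa using this
  obtain ⟨B₀, hB₀, h0B₀, W, hW, hW0, hWeq⟩ :=
    exists_smooth_radial_solution hF x₀ N z pr hF0 hFd
  let path : E → C(unitInterval, E × E) := fun h =>
    ContinuousMap.const _ (x₀, 0) + radialPath N z pr (h, W h)
  have hpathc : ContinuousOn path B₀ :=
    continuousOn_const.add ((radialPath N z pr).continuous.comp_continuousOn
      (continuousOn_id.prodMk hW.continuousOn))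
  -- parameters for which the curve stays where the slope function is `-α(v)/α(N)`
  let B : Set E := B₀ ∩ path ⁻¹' {p | Set.MapsTo p Set.univ R}
  have hB : IsOpen B := hpathc.isOpen_inter_preimage hB₀
    (ContinuousMap.isOpen_setOfPred_mapsTo isCompact_univ hR)
  have h0B : (0 : E) ∈ B := by
    refine ⟨h0B₀, fun t _ => ?_⟩
    have : path 0 = ContinuousMap.const _ (x₀, 0) := by
      simp only [path, hW0]
      rw [Prod.mk_zero_zero, map_zero, add_zero]
    rw [this]; exact hxR
  have hpath : ∀ h t, path h t = (x₀ + (z h • N + (t : ℝ) • pr h + W h t • N), pr h) := by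
    intro h t
    change ((x₀, 0) : E × E) + radialPath N z pr (h, W h) t = _
    rw [radialPath_apply]; simp
  let ev : C(unitInterval, ℝ) →L[ℝ] ℝ := ContinuousMap.evalCLM ℝ 1
  let Ψ : E → E := fun h => x₀ + (z h • N + pr h + W h 1 • N)
  have hev : ContDiffOn ℝ ∞ (fun h => W h 1) B₀ :=
    ev.contDiff.comp_contDiffOn hW
  have hΨ : ContDiffOn ℝ ∞ Ψ B :=
    contDiffOn_const.add ((((z.contDiff.contDiffOn).smul contDiffOn_const).add
      pr.contDiff.contDiffOn).add ((hev.mono Set.inter_subset_left).smul contDiffOn_const))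
  have h1 : ContDiff ℝ 1 F := hF.of_le (by exact_mod_cast le_top)
  have hWd : ∀ h ∈ B, HasFDerivAt W (fderiv ℝ W h) h := fun h hh =>
    ((hW.contDiffAt (hB₀.mem_nhds hh.1)).differentiableAt (by simp)).hasFDerivAt
  -- the variation of `W` solves the linearised equation
  have hWd' : ∀ h ∈ B, ∀ b, fderiv ℝ W h b = pathPrimitive (pathApply (E × E) ℝ
      (superposition ⟨fderiv ℝ F, h1.continuous_fderiv one_ne_zero⟩ (path h))
        (radialPath N z pr (b, fderiv ℝ W h b))) := by
    intro h hh b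
    have hin : HasFDerivAt path ((radialPath N z pr).comp
        ((ContinuousLinearMap.id ℝ E).prod (fderiv ℝ W h))) h :=
      ((radialPath N z pr).hasFDerivAt.comp h ((hasFDerivAt_id h).prodMk (hWd h hh))).const_add _
    have hs := pathPrimitive.hasFDerivAt.comp h ((hasFDerivAt_superposition h1 _).comp h hin)
    have heq : W =ᶠ[𝓝 h] fun h => pathPrimitive (superposition ⟨F, hF.continuous⟩ (path h)) := by
      filter_upwards [hB₀.mem_nhds hh.1] with k hk using hWeq k hk
    have := (hs.congr_of_eventuallyEq heq).unique (hWd h hh)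
    exact (congrArg (fun L => L b) this).symm
  have hΨd : ∀ h ∈ B, HasFDerivAt Ψ (z.smulRight N + pr +
      (ev.comp (fderiv ℝ W h)).smulRight N) h := by
    intro h hh
    exact (((z.hasFDerivAt.smul_const N).add pr.hasFDerivAt).add
      ((ev.hasFDerivAt.comp h
        (hWd h hh)).smul_const N)).const_add x₀
  have hker : ∀ h ∈ B, ∀ b, z b = 0 → α (Ψ h) (fderiv ℝ Ψ h b) = 0 := by
    intro h hh b hb
    set g : C(unitInterval, ℝ) := superposition ⟨F, hF.continuous⟩ (path h) with hg
    set k : C(unitInterval, ℝ) := pathApply (E × E) ℝ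
      (superposition ⟨fderiv ℝ F, h1.continuous_fderiv one_ne_zero⟩ (path h))
        (radialPath N z pr (b, fderiv ℝ W h b)) with hk
    let γ : ℝ → E := fun t => x₀ + (z h • N + t • pr h +
      (∫ s in (0 : ℝ)..t, Set.IccExtend zero_le_one g s) • N)
    let d : ℝ → E := fun t => z b • N + t • pr b +
      (∫ s in (0 : ℝ)..t, Set.IccExtend zero_le_one k s) • N
    have hγ : ∀ t, HasDerivAt γ (pr h + Set.IccExtend zero_le_one g t • N) t := by
      intro t
      have h2 := ((((hasDerivAt_id t).smul_const (pr h)).const_add (z h • N)).add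
        ((hasDerivAt_primitive_IccExtend g t).smul_const N)).const_add x₀
      rw [one_smul] at h2
      exact h2
    have hd : ∀ t, HasDerivAt d (pr b + Set.IccExtend zero_le_one k t • N) t := by
      intro t
      have h2 := (((hasDerivAt_id t).smul_const (pr b)).const_add (z b • N)).add
        ((hasDerivAt_primitive_IccExtend k t).smul_const N)
      rw [one_smul] at h2
      exact h2
    have hW1 : ∀ t : unitInterval, W h t = ∫ s in (0 : ℝ)..t, Set.IccExtend zero_le_one g s := by
      intro t
      rw [← pathPrimitive_apply]
      exact congrArg (fun w : C(unitInterval, ℝ) => w t) (hWeq h hh.1)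
    have hW2 : ∀ t : unitInterval, fderiv ℝ W h b t =
        ∫ s in (0 : ℝ)..t, Set.IccExtend zero_le_one k s := by
      intro t
      rw [← pathPrimitive_apply]
      exact congrArg (fun w : C(unitInterval, ℝ) => w t) (hWd' h hh b)
    have hγp : ∀ t : unitInterval, path h t = (γ t, pr h) := by
      intro t
      rw [hpath, hW1]
    have hdp : ∀ t : unitInterval, radialPath N z pr (b, fderiv ℝ W h b) t = (d t, pr b) := by
      intro t
      rw [radialPath_apply, hW2]
    have hgt : ∀ t : unitInterval, Set.IccExtend zero_le_one g t = F (γ t, pr h) := by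
      intro t
      rw [Set.IccExtend_val, ← hγp]
      rfl
    have hkt : ∀ t : unitInterval, Set.IccExtend zero_le_one k t =
        fderiv ℝ F (γ t, pr h) (d t, pr b) := by
      intro t
      rw [Set.IccExtend_val, ← hγp, ← hdp]
      rfl
    have hmem : ∀ t : unitInterval, (γ t, pr h) ∈ R := by
      intro t
      rw [← hγp]; exact hh.2 (Set.mem_univ t)
    have hcont : Continuous fun t => pr h + Set.IccExtend zero_le_one g t • N :=
      continuous_const.add (g.continuous.Icc_extend'.smul continuous_const)
    have := integrable_form_variation_eq_zero hO hα hθ hint hγ hd hcont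
      (fun t ht => (hRΩ (hmem ⟨t, ht⟩)).1)
      (fun t ht => by
        have := hgt ⟨t, ht⟩
        simp only at this
        rw [this]; exact hFα _ (hmem ⟨t, ht⟩))
      (fun t ht => by
        have h2 := hgt ⟨t, ht⟩
        have h3 := hkt ⟨t, ht⟩
        simp only at h2 h3
        rw [h2, h3]; exact hident _ (hmem ⟨t, ht⟩) _ _)
      (by simp [d, hb])
    have hγ1 : γ 1 = Ψ h := by
      have := hW1 1
      simp only [γ, Ψ, one_smul]
      rw [this]; rfl
    have hd1 : d 1 = fderiv ℝ Ψ h b := by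
      rw [(hΨd h hh).fderiv]
      have := hW2 1
      simp only [d, one_smul]
      change _ = z b • N + pr b + (fderiv ℝ W h b 1) • N
      rw [this]; rfl
    rwa [hγ1, hd1] at this
  have hΨid : HasFDerivAt Ψ ((ContinuousLinearEquiv.refl ℝ E : E ≃L[ℝ] E) : E →L[ℝ] E) 0 := by
    refine (hΨd 0 h0B).congr_fderiv (ContinuousLinearMap.ext fun b => ?_)
    have h2 : fderiv ℝ W 0 b = 0 := by
      rw [hWd' 0 h0B b]
      convert! map_zero pathPrimitive
      ext t
      rw [pathApply_apply, radialPath_apply]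
      have : path 0 t = (x₀, 0) := by
        rw [hpath]; simp [hW0]
      change fderiv ℝ F (path 0 t) _ = 0
      rw [this]; exact hFd _ _
    change z b • N + pr b + (fderiv ℝ W 0 b 1) • N = b
    rw [h2, hpr]; simp
  obtain ⟨e, h0e, heB, heΨ, hesm⟩ := exists_smooth_local_inverse hB hΨ h0B _ hΨid
  have hΨ0 : e 0 = x₀ := by rw [heΨ]; simp [Ψ, hW0]
  have hΨO : ∀ h ∈ B, Ψ h ∈ O := by
    intro h hh
    have := (hRΩ (hh.2 (Set.mem_univ (1 : unitInterval)))).1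
    rw [hpath] at this
    simpa [Ψ] using this
  have hle : e.target ⊆ O := fun y hy => by
    rw [← e.right_inv hy, heΨ]
    exact hΨO _ (heB (e.map_target hy))
  let u : E → ℝ := fun y => z (e.symm y)
  have hu : ContDiffOn ℝ ∞ u e.target := z.contDiff.comp_contDiffOn hesm
  have hdu : ContDiffOn ℝ ∞ (fun y => fderiv ℝ u y N) e.target :=
    (hu.fderiv_of_isOpen e.open_target (by simp)).clm_apply contDiffOn_const
  let V : Set E := e.target ∩ {y | y ∈ O ∧ α y N ≠ 0}
  have hmain : ∀ y ∈ V, ∃ c : ℝ, α y = c • fderiv ℝ u y := by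
    intro y hy
    have hh := e.map_target hy.1
    set h := e.symm y with hhdef
    have hsd : HasFDerivAt e.symm (fderiv ℝ e.symm y) y :=
      ((hesm.contDiffAt (e.open_target.mem_nhds hy.1)).differentiableAt (by simp)).hasFDerivAt
    have hΨh : HasFDerivAt Ψ (fderiv ℝ Ψ h) h := (hΨd h (heB hh)).differentiableAt.hasFDerivAt
    have hid : (fderiv ℝ Ψ h).comp (fderiv ℝ e.symm y) = ContinuousLinearMap.id ℝ E := by
      have h2 : (fun y => Ψ (e.symm y)) =ᶠ[𝓝 y] id := by
        filter_upwards [e.open_target.mem_nhds hy.1] with x hx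
        rw [← heΨ]; exact e.right_inv hx
      exact ((hΨh.comp y hsd).congr_of_eventuallyEq h2.symm).unique (hasFDerivAt_id y)
    have hud : fderiv ℝ u y = z.comp (fderiv ℝ e.symm y) := (z.hasFDerivAt.comp y hsd).fderiv
    have hyΨ : Ψ h = y := by rw [← heΨ]; exact e.right_inv hy.1
    refine ⟨α y (fderiv ℝ Ψ h N), ContinuousLinearMap.ext fun b => ?_⟩
    set b' := fderiv ℝ e.symm y b with hb'
    have hb : b = fderiv ℝ Ψ h b' := (congrArg (fun L => L b) hid).symm
    have hsplit : b' = z b' • N + pr b' := by rw [hpr]; abel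
    have hk := hker h (heB hh) (pr b') (hzpr b')
    rw [hyΨ] at hk
    have h5 : α y b = z b' * α y (fderiv ℝ Ψ h N) := by
      rw [hb, hsplit, map_add, map_add, hk, map_smul, map_smul, ← hsplit, add_zero, smul_eq_mul]
    rw [h5, hud, mul_comm]
    rfl
  have hV0 : x₀ ∈ e.target := hΨ0 ▸ e.map_source h0e
  have hduN : ∀ y ∈ V, ∀ c : ℝ, α y = c • fderiv ℝ u y → c ≠ 0 ∧ fderiv ℝ u y N ≠ 0 := by
    intro y hy c hc
    have h2 : α y N = c * fderiv ℝ u y N := by rw [hc]; rfl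
    exact mul_ne_zero_iff.1 (h2 ▸ hy.2.2)
  refine ⟨V, e.open_target.inter hO', ⟨hV0, hx₀, ?_⟩, fun y hy => hle hy.1, u,
    fun y => α y N / fderiv ℝ u y N, hu.mono Set.inter_subset_left, ?_, fun y hy => ?_⟩
  · change z N ≠ 0
    rw [hN]; exact one_ne_zero
  · refine (hαN.mono fun y hy => hy.2.1).div (hdu.mono Set.inter_subset_left) fun y hy => ?_
    obtain ⟨c, hc⟩ := hmain y hy
    exact (hduN y hy c hc).2
  · obtain ⟨c, hc⟩ := hmain y hy
    have h2 := hduN y hy c hc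
    have h3 : α y N / fderiv ℝ u y N = c := by
      rw [hc]; exact mul_div_cancel_right₀ _ h2.2
    beta_reduce
    rw [h3]
    exact ⟨h2.1, hc⟩

end Frobenius

namespace Coord

variable {n : ℕ}

/-! ### Partial derivatives -/

lemma pd_congr {f h : EuclideanSpace ℝ (Fin n) → ℝ} {y : EuclideanSpace ℝ (Fin n)}
    (H : f =ᶠ[𝓝 y] h) (i : Fin n) : pd i f y = pd i h y := by
  rw [pd, pd, H.fderiv_eq]

lemma pd_const (i : Fin n) (c : ℝ) (y : EuclideanSpace ℝ (Fin n)) : pd i (fun _ => c) y = 0 := by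
  simp [pd]

section
variable {f h : EuclideanSpace ℝ (Fin n) → ℝ} {y : EuclideanSpace ℝ (Fin n)}

lemma pd_add (i : Fin n) (hf : DifferentiableAt ℝ f y) (hh : DifferentiableAt ℝ h y) :
    pd i (fun z => f z + h z) y = pd i f y + pd i h y := by
  simp only [pd]; rw [fderiv_fun_add hf hh]; rfl

lemma pd_sub (i : Fin n) (hf : DifferentiableAt ℝ f y) (hh : DifferentiableAt ℝ h y) :
    pd i (fun z => f z - h z) y = pd i f y - pd i h y := by
  simp only [pd]; rw [fderiv_fun_sub hf hh]; rfl

lemma pd_neg (i : Fin n) : pd i (fun z => -f z) y = -pd i f y := by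
  simp only [pd]; rw [fderiv_fun_neg]; rfl

lemma pd_mul (i : Fin n) (hf : DifferentiableAt ℝ f y) (hh : DifferentiableAt ℝ h y) :
    pd i (fun z => f z * h z) y = pd i f y * h y + f y * pd i h y := by
  simp only [pd]; rw [fderiv_fun_mul hf hh]; simp; ring

lemma pd_const_mul (i : Fin n) (c : ℝ) (hf : DifferentiableAt ℝ f y) :
    pd i (fun z => c * f z) y = c * pd i f y := by
  rw [pd_mul i (differentiableAt_const c) hf, pd_const]; ring

lemma pd_sum {ι : Type*} (s : Finset ι) {F : ι → EuclideanSpace ℝ (Fin n) → ℝ} (i : Fin n)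
    (hF : ∀ j ∈ s, DifferentiableAt ℝ (F j) y) :
    pd i (fun z => ∑ j ∈ s, F j z) y = ∑ j ∈ s, pd i (F j) y := by
  simp only [pd]; rw [fderiv_fun_sum hF]; simp

lemma pd_exp (i : Fin n) (hf : DifferentiableAt ℝ f y) :
    pd i (fun z => Real.exp (f z)) y = Real.exp (f y) * pd i f y := by
  simp only [pd]; rw [fderiv_exp hf]; rfl

lemma pd_comm (i j : Fin n) (hf : ContDiffAt ℝ ∞ f y) : pd i (pd j f) y = pd j (pd i f) y := by
  have hs : IsSymmSndFDerivAt ℝ f y :=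
    hf.isSymmSndFDerivAt (by
      rw [minSmoothness_of_isRCLikeNormedField]; exact WithTop.coe_le_coe.2 le_top)
  have hd : DifferentiableAt ℝ (fderiv ℝ f) y :=
    (hf.fderiv_right (m := ∞) (by simp)).differentiableAt (by simp)
  have key : ∀ i j : Fin n, pd i (pd j f) y =
      fderiv ℝ (fderiv ℝ f) y (EuclideanSpace.single i 1) (EuclideanSpace.single j 1) := by
    intro i j
    have : HasFDerivAt (pd j f) ((ContinuousLinearMap.apply ℝ ℝ
        (EuclideanSpace.single j (1 : ℝ))).comp (fderiv ℝ (fderiv ℝ f) y)) y :=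
      (ContinuousLinearMap.apply ℝ ℝ (EuclideanSpace.single j (1 : ℝ))).hasFDerivAt.comp y
        hd.hasFDerivAt
    rw [pd, this.fderiv]; rfl
  rw [key, key]; exact hs _ _

end

lemma contDiffOn_pd {f : EuclideanSpace ℝ (Fin n) → ℝ} {O : Set (EuclideanSpace ℝ (Fin n))}
    (hO : IsOpen O) (hf : ContDiffOn ℝ ∞ f O) (i : Fin n) : ContDiffOn ℝ ∞ (pd i f) O :=
  (hf.fderiv_of_isOpen hO (by simp)).clm_apply contDiffOn_const

lemma differentiableAt_of_contDiffOn {F : Type*} [NormedAddCommGroup F] [NormedSpace ℝ F]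
    {f : EuclideanSpace ℝ (Fin n) → F} {O : Set (EuclideanSpace ℝ (Fin n))} (hO : IsOpen O)
    (hf : ContDiffOn ℝ ∞ f O) {y : EuclideanSpace ℝ (Fin n)} (hy : y ∈ O) :
    DifferentiableAt ℝ f y :=
  (hf.contDiffAt (hO.mem_nhds hy)).differentiableAt (by simp)

/-! ### Metrics in coordinates and their Levi-Civita connection -/

/-- `G` is the matrix of components of a smooth pseudo-Riemannian metric on the open set `O`. -/
structure IsMetricOn (G : EuclideanSpace ℝ (Fin n) → Matrix (Fin n) (Fin n) ℝ)
    (O : Set (EuclideanSpace ℝ (Fin n))) : Prop where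
  isOpen : IsOpen O
  smooth : ∀ i j, ContDiffOn ℝ ∞ (fun z => G z i j) O
  symm : ∀ y ∈ O, ∀ i j, G y i j = G y j i
  det_ne : ∀ y ∈ O, (G y).det ≠ 0

namespace IsMetricOn

variable {G : EuclideanSpace ℝ (Fin n) → Matrix (Fin n) (Fin n) ℝ}
  {O : Set (EuclideanSpace ℝ (Fin n))} (hG : IsMetricOn G O) {y : EuclideanSpace ℝ (Fin n)}

include hG

lemma mono {O' : Set (EuclideanSpace ℝ (Fin n))} (h : O' ⊆ O) (hO' : IsOpen O') :
    IsMetricOn G O' :=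
  ⟨hO', fun i j => (hG.smooth i j).mono h, fun y hy => hG.symm y (h hy),
    fun y hy => hG.det_ne y (h hy)⟩

lemma smooth_inv (i j : Fin n) : ContDiffOn ℝ ∞ (fun z => (G z)⁻¹ i j) O := by
  have hdet : ∀ A : EuclideanSpace ℝ (Fin n) → Matrix (Fin n) (Fin n) ℝ,
      (∀ i j, ContDiffOn ℝ ∞ (fun z => A z i j) O) → ContDiffOn ℝ ∞ (fun z => (A z).det) O := by
    intro A hA
    simp only [Matrix.det_apply']
    exact ContDiffOn.sum fun σ _ => contDiffOn_const.mul (contDiffOn_prod fun i _ => hA _ _)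
  have hadj : ContDiffOn ℝ ∞ (fun z => (G z).adjugate i j) O := by
    simp only [Matrix.adjugate_apply]
    refine hdet _ fun k l => ?_
    by_cases hk : k = j
    · subst hk; simp only [Matrix.updateRow_self]; exact contDiffOn_const
    · simp only [Matrix.updateRow_ne hk]; exact hG.smooth k l
  have : (fun z => (G z)⁻¹ i j) = fun z => (G z).det⁻¹ * (G z).adjugate i j := by
    funext z
    simp [Matrix.inv_def, Ring.inverse_eq_inv']
  rw [this]
  exact ((hdet G hG.smooth).inv hG.det_ne).mul hadj

lemma smooth_christoffel (c a b : Fin n) : ContDiffOn ℝ ∞ (christoffel G c a b) O := by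
  unfold christoffel
  exact contDiffOn_const.mul (ContDiffOn.sum fun l _ => (hG.smooth_inv c l).mul
    (((contDiffOn_pd hG.isOpen (hG.smooth _ _) _).add
      (contDiffOn_pd hG.isOpen (hG.smooth _ _) _)).sub (contDiffOn_pd hG.isOpen (hG.smooth _ _) _)))

lemma smooth_riemannUp (a b c d : Fin n) : ContDiffOn ℝ ∞ (riemannUp G a b c d) O := by
  unfold riemannUp
  exact ((contDiffOn_pd hG.isOpen (hG.smooth_christoffel _ _ _) _).sub
    (contDiffOn_pd hG.isOpen (hG.smooth_christoffel _ _ _) _)).add (ContDiffOn.sum fun e _ =>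
      ((hG.smooth_christoffel _ _ _).mul (hG.smooth_christoffel _ _ _)).sub
      ((hG.smooth_christoffel _ _ _).mul (hG.smooth_christoffel _ _ _)))

lemma smooth_ricci (a b : Fin n) : ContDiffOn ℝ ∞ (ricci G a b) O := by
  unfold ricci
  exact ContDiffOn.sum fun c _ => hG.smooth_riemannUp _ _ _ _

lemma smooth_schouten (a b : Fin n) : ContDiffOn ℝ ∞ (schouten G a b) O := by
  unfold schouten scal
  exact contDiffOn_const.mul ((hG.smooth_ricci a b).sub (((ContDiffOn.sum fun c _ =>
    ContDiffOn.sum fun d _ => (hG.smooth_inv _ _).mul (hG.smooth_ricci _ _)).div_const _).mul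
      (hG.smooth a b)))

lemma diff (hy : y ∈ O) (i j : Fin n) : DifferentiableAt ℝ (fun z => G z i j) y :=
  differentiableAt_of_contDiffOn hG.isOpen (hG.smooth i j) hy

lemma diff_christoffel (hy : y ∈ O) (c a b : Fin n) : DifferentiableAt ℝ (christoffel G c a b) y :=
  differentiableAt_of_contDiffOn hG.isOpen (hG.smooth_christoffel c a b) hy

lemma mul_inv (hy : y ∈ O) : G y * (G y)⁻¹ = 1 :=
  Matrix.mul_nonsing_inv _ (hG.det_ne y hy).isUnit

lemma inv_mul (hy : y ∈ O) : (G y)⁻¹ * G y = 1 :=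
  Matrix.nonsing_inv_mul _ (hG.det_ne y hy).isUnit

lemma sum_inv_mul (hy : y ∈ O) (a b : Fin n) :
    ∑ c, (G y)⁻¹ a c * G y c b = if a = b then 1 else 0 := by
  rw [← Matrix.mul_apply, hG.inv_mul hy, Matrix.one_apply]

lemma inv_symm (hy : y ∈ O) (a b : Fin n) : (G y)⁻¹ a b = (G y)⁻¹ b a := by
  have h : (G y).transpose = G y := by ext i j; exact hG.symm y hy j i
  have h2 := Matrix.transpose_nonsing_inv (G y)
  rw [h] at h2
  exact congrFun (congrFun h2 b) a

lemma pd_symm (hy : y ∈ O) (c a b : Fin n) :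
    pd c (fun z => G z a b) y = pd c (fun z => G z b a) y :=
  pd_congr (by filter_upwards [hG.isOpen.mem_nhds hy] with z hz using hG.symm z hz a b) c

lemma christoffel_symm (hy : y ∈ O) (c a b : Fin n) :
    christoffel G c a b y = christoffel G c b a y := by
  unfold christoffel
  congr 1
  refine Finset.sum_congr rfl fun l _ => ?_
  rw [hG.pd_symm hy l a b]; ring

lemma lower_christoffel (hy : y ∈ O) (c a b : Fin n) :
    ∑ d, G y c d * christoffel G d a b y =
      (1 / 2) * (pd a (fun z => G z b c) y + pd b (fun z => G z a c) y
        - pd c (fun z => G z a b) y) := by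
  have h := congrFun (Matrix.mulVec_mulVec (fun l => pd a (fun z => G z b l) y +
    pd b (fun z => G z a l) y - pd l (fun z => G z a b) y) (G y) (G y)⁻¹) c
  rw [hG.mul_inv hy, Matrix.one_mulVec] at h
  rw [← h]
  simp only [Matrix.mulVec, dotProduct, christoffel]
  rw [Finset.mul_sum]
  exact Finset.sum_congr rfl fun d _ => by ring

/-- The Levi-Civita connection is metric. -/
lemma pd_metric (hy : y ∈ O) (a b c : Fin n) :
    pd a (fun z => G z b c) y =
      ∑ d, (G y b d * christoffel G d a c y + G y c d * christoffel G d a b y) := by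
  rw [Finset.sum_add_distrib, hG.lower_christoffel hy, hG.lower_christoffel hy,
    hG.pd_symm hy a c b, hG.pd_symm hy c a b, hG.pd_symm hy b a c]
  ring

end IsMetricOn

/-- The connection matrix of the Levi-Civita connection in the direction `∂_a`. -/
def gam (G : EuclideanSpace ℝ (Fin n) → Matrix (Fin n) (Fin n) ℝ) (a : Fin n)
    (y : EuclideanSpace ℝ (Fin n)) : Matrix (Fin n) (Fin n) ℝ :=
  Matrix.of fun b c => christoffel G b a c y

/-- The curvature endomorphism in the directions `∂_a`, `∂_b`. -/
def curvEnd (G : EuclideanSpace ℝ (Fin n) → Matrix (Fin n) (Fin n) ℝ) (a b : Fin n)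
    (y : EuclideanSpace ℝ (Fin n)) : Matrix (Fin n) (Fin n) ℝ :=
  Matrix.of fun c d => riemannUp G a b c d y

/-- Entrywise partial derivative of a matrix-valued function. -/
def pdM (a : Fin n) (A : EuclideanSpace ℝ (Fin n) → Matrix (Fin n) (Fin n) ℝ)
    (y : EuclideanSpace ℝ (Fin n)) : Matrix (Fin n) (Fin n) ℝ :=
  Matrix.of fun i j => pd a (fun z => A z i j) y

lemma pdM_congr {A B : EuclideanSpace ℝ (Fin n) → Matrix (Fin n) (Fin n) ℝ}
    {y : EuclideanSpace ℝ (Fin n)} (H : A =ᶠ[𝓝 y] B) (a : Fin n) : pdM a A y = pdM a B y := by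
  ext i j
  exact pd_congr (by filter_upwards [H] with z hz; rw [hz]) a

lemma pdM_mul {A B : EuclideanSpace ℝ (Fin n) → Matrix (Fin n) (Fin n) ℝ}
    {y : EuclideanSpace ℝ (Fin n)} (hA : ∀ i j, DifferentiableAt ℝ (fun z => A z i j) y)
    (hB : ∀ i j, DifferentiableAt ℝ (fun z => B z i j) y) (a : Fin n) :
    pdM a (fun z => A z * B z) y = pdM a A y * B y + A y * pdM a B y := by
  ext i j
  simp only [pdM, Matrix.of_apply, Matrix.mul_apply, Matrix.add_apply]
  rw [pd_sum _ _ fun k _ => (hA i k).fun_mul (hB k j), ← Finset.sum_add_distrib]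
  exact Finset.sum_congr rfl fun k _ => pd_mul a (hA i k) (hB k j)

lemma pdM_add {A B : EuclideanSpace ℝ (Fin n) → Matrix (Fin n) (Fin n) ℝ}
    {y : EuclideanSpace ℝ (Fin n)} (hA : ∀ i j, DifferentiableAt ℝ (fun z => A z i j) y)
    (hB : ∀ i j, DifferentiableAt ℝ (fun z => B z i j) y) (a : Fin n) :
    pdM a (fun z => A z + B z) y = pdM a A y + pdM a B y := by
  ext i j
  exact pd_add a (hA i j) (hB i j)

lemma curvEnd_eq (G : EuclideanSpace ℝ (Fin n) → Matrix (Fin n) (Fin n) ℝ) (a b : Fin n)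
    (y : EuclideanSpace ℝ (Fin n)) :
    curvEnd G a b y = pdM a (gam G b) y - pdM b (gam G a) y +
      (gam G a y * gam G b y - gam G b y * gam G a y) := by
  ext c d
  simp only [curvEnd, riemannUp, gam, pdM, Matrix.of_apply, Matrix.mul_apply, Matrix.add_apply,
    Matrix.sub_apply, Finset.sum_sub_distrib]

lemma riemann_eq (G : EuclideanSpace ℝ (Fin n) → Matrix (Fin n) (Fin n) ℝ) (a b c d : Fin n)
    (y : EuclideanSpace ℝ (Fin n)) : riemann G a b c d y = (G y * curvEnd G a b y) c d := rfl

namespace IsMetricOn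

variable {G : EuclideanSpace ℝ (Fin n) → Matrix (Fin n) (Fin n) ℝ}
  {O : Set (EuclideanSpace ℝ (Fin n))} (hG : IsMetricOn G O) {y : EuclideanSpace ℝ (Fin n)}

include hG

lemma pdM_metric (hy : y ∈ O) (a : Fin n) :
    pdM a G y = G y * gam G a y + (gam G a y).transpose * G y := by
  ext b c
  simp only [pdM, Matrix.of_apply, Matrix.add_apply, Matrix.mul_apply, gam, Matrix.transpose_apply]
  rw [hG.pd_metric hy, Finset.sum_add_distrib]
  congr 1
  refine Finset.sum_congr rfl fun d _ => ?_
  rw [hG.symm y hy c d, mul_comm]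

omit hG in
lemma _root_.Coord.riemann_skew_left (a b c d : Fin n) :
    riemann G a b c d y = -riemann G b a c d y := by
  unfold riemann riemannUp
  rw [← Finset.sum_neg_distrib]
  refine Finset.sum_congr rfl fun e _ => ?_
  rw [← mul_neg, Finset.sum_sub_distrib, Finset.sum_sub_distrib]
  ring

lemma riemann_skew_right (hy : y ∈ O) (a b c d : Fin n) :
    riemann G a b c d y = -riemann G a b d c y := by
  have hGd := fun i j => hG.diff hy i j
  have hΓd : ∀ a i j, DifferentiableAt ℝ (fun z => gam G a z i j) y :=
    fun a i j => hG.diff_christoffel hy i a j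
  have hΓtd : ∀ a i j, DifferentiableAt ℝ (fun z => (gam G a z).transpose i j) y :=
    fun a i j => hG.diff_christoffel hy j a i
  have hmd : ∀ A B : EuclideanSpace ℝ (Fin n) → Matrix (Fin n) (Fin n) ℝ,
      (∀ i j, DifferentiableAt ℝ (fun z => A z i j) y) →
      (∀ i j, DifferentiableAt ℝ (fun z => B z i j) y) →
      ∀ i j, DifferentiableAt ℝ (fun z => (A z * B z) i j) y := by
    intro A B hA hB i j
    simp only [Matrix.mul_apply]
    exact DifferentiableAt.fun_sum fun k _ => (hA i k).fun_mul (hB k j)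
  have second : ∀ a b, pdM a (pdM b G) y =
      (pdM a G y * gam G b y + G y * pdM a (gam G b) y) +
      (pdM a (fun z => (gam G b z).transpose) y * G y + (gam G b y).transpose * pdM a G y) := by
    intro a b
    have h : pdM b G =ᶠ[𝓝 y] fun z => G z * gam G b z + (gam G b z).transpose * G z := by
      filter_upwards [hG.isOpen.mem_nhds hy] with z hz using hG.pdM_metric hz b
    rw [pdM_congr h, pdM_add (hmd _ _ hGd (hΓd b)) (hmd _ _ (hΓtd b) hGd),
      pdM_mul hGd (hΓd b), pdM_mul (hΓtd b) hGd]
  have hcomm : pdM a (pdM b G) y = pdM b (pdM a G) y := by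
    ext i j
    exact pd_comm a b ((hG.smooth i j).contDiffAt (hG.isOpen.mem_nhds hy))
  rw [second, second, hG.pdM_metric hy, hG.pdM_metric hy] at hcomm
  have htr : ∀ a b, pdM a (fun z => (gam G b z).transpose) y = (pdM a (gam G b) y).transpose :=
    fun a b => rfl
  rw [htr, htr] at hcomm
  have hsymm : (G y).transpose = G y := by ext i j; exact hG.symm y hy j i
  have key : G y * curvEnd G a b y = -(G y * curvEnd G a b y).transpose := by
    rw [Matrix.transpose_mul, hsymm, curvEnd_eq]
    simp only [Matrix.transpose_add, Matrix.transpose_sub, Matrix.transpose_mul]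
    rw [← sub_eq_zero] at hcomm ⊢
    rw [← hcomm]
    noncomm_ring
  rw [riemann_eq, riemann_eq]
  exact congrFun (congrFun key c) d

lemma riemannUp_bianchi (hy : y ∈ O) (a b c d : Fin n) :
    riemannUp G a b c d y + riemannUp G b d c a y + riemannUp G d a c b y = 0 := by
  have hs : ∀ e c a b, pd e (christoffel G c a b) y = pd e (christoffel G c b a) y := fun e c a b =>
    pd_congr (by filter_upwards [hG.isOpen.mem_nhds hy] with z hz using
      hG.christoffel_symm hz c a b) e
  unfold riemannUp
  rw [hs a c d b, hs b c d a, hs d c b a]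
  have : ∑ e, (christoffel G c a e y * christoffel G e b d y
      - christoffel G c b e y * christoffel G e a d y) +
    ∑ e, (christoffel G c b e y * christoffel G e d a y
      - christoffel G c d e y * christoffel G e b a y) +
    ∑ e, (christoffel G c d e y * christoffel G e a b y
      - christoffel G c a e y * christoffel G e d b y) = 0 := by
    rw [← Finset.sum_add_distrib, ← Finset.sum_add_distrib]
    refine Finset.sum_eq_zero fun e _ => ?_
    rw [hG.christoffel_symm hy e d a, hG.christoffel_symm hy e b a, hG.christoffel_symm hy e d b]
    ring
  linarith

lemma riemann_bianchi (hy : y ∈ O) (a b c d : Fin n) :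
    riemann G a b c d y + riemann G b d c a y + riemann G d a c b y = 0 := by
  unfold riemann
  rw [← Finset.sum_add_distrib, ← Finset.sum_add_distrib]
  refine Finset.sum_eq_zero fun e _ => ?_
  rw [← mul_add, ← mul_add, hG.riemannUp_bianchi hy, mul_zero]

lemma riemann_pair_symm (hy : y ∈ O) (a b c d : Fin n) :
    riemann G a b c d y = riemann G c d a b y := by
  have B := fun a b c d => hG.riemann_bianchi hy a b c d
  have S := fun a b c d => riemann_skew_left (G := G) (y := y) a b c d
  have T := fun a b c d => hG.riemann_skew_right hy a b c d
  linarith [B a b c d, B b c d a, B c d a b, B d a b c, S a b c d, S b d c a, S d a c b,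
    S b c d a, S c a d b, S a b d c, S c d a b, S d b a c, S b c a d, S d a b c, S a c b d,
    S c d b a, T a b c d, T b d c a, T d a c b,
    T b c d a, T c a d b, T a b d c, T c d a b, T d b a c, T b c a d, T d a b c, T a c b d,
    T c d b a]

lemma ricci_eq (hy : y ∈ O) (b d : Fin n) :
    ricci G b d y = ∑ a, ∑ c, (G y)⁻¹ a c * riemann G a b c d y := by
  unfold ricci
  refine Finset.sum_congr rfl fun a _ => ?_
  simp only [riemann_eq]
  rw [← Matrix.mul_apply, ← Matrix.mul_assoc, hG.inv_mul hy, Matrix.one_mul]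
  rfl

lemma ricci_symm (hy : y ∈ O) (b d : Fin n) : ricci G b d y = ricci G d b y := by
  rw [hG.ricci_eq hy, hG.ricci_eq hy, Finset.sum_comm]
  refine Finset.sum_congr rfl fun a _ => Finset.sum_congr rfl fun c _ => ?_
  rw [hG.inv_symm hy c a, hG.riemann_pair_symm hy]

lemma schouten_symm (hy : y ∈ O) (b d : Fin n) : schouten G b d y = schouten G d b y := by
  unfold schouten
  rw [hG.ricci_symm hy, hG.symm y hy]

end IsMetricOn

end Coord

namespace Coord

open Matrix

variable {n : ℕ}

/-! ### Covariant derivatives of vector fields and one-forms -/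

/-- The covariant derivative `∇_a X` of a vector field, as a vector. -/
def cov (G : EuclideanSpace ℝ (Fin n) → Matrix (Fin n) (Fin n) ℝ) (a : Fin n)
    (X : EuclideanSpace ℝ (Fin n) → Fin n → ℝ) (y : EuclideanSpace ℝ (Fin n)) : Fin n → ℝ :=
  fun b => covVec G X a b y

/-- The covariant derivative `∇_a α` of a one-form, as a covector. -/
def covForm (G : EuclideanSpace ℝ (Fin n) → Matrix (Fin n) (Fin n) ℝ) (a : Fin n)
    (α : EuclideanSpace ℝ (Fin n) → Fin n → ℝ) (y : EuclideanSpace ℝ (Fin n)) : Fin n → ℝ :=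
  fun b => pd a (fun z => α z b) y - ∑ c, christoffel G c a b y * α y c

/-- The differential `dU`, as a covector. -/
def diffl (U : EuclideanSpace ℝ (Fin n) → ℝ) (y : EuclideanSpace ℝ (Fin n)) : Fin n → ℝ :=
  fun b => pd b U y

/-- The gradient of `U` with respect to `G`. -/
def gradient (G : EuclideanSpace ℝ (Fin n) → Matrix (Fin n) (Fin n) ℝ)
    (U : EuclideanSpace ℝ (Fin n) → ℝ) (y : EuclideanSpace ℝ (Fin n)) : Fin n → ℝ :=
  (G y)⁻¹ *ᵥ diffl U y

section
variable {G : EuclideanSpace ℝ (Fin n) → Matrix (Fin n) (Fin n) ℝ}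
  {O : Set (EuclideanSpace ℝ (Fin n))} {y : EuclideanSpace ℝ (Fin n)}

lemma cov_congr {X X' : EuclideanSpace ℝ (Fin n) → Fin n → ℝ} (h : X =ᶠ[𝓝 y] X') (a : Fin n) :
    cov G a X y = cov G a X' y := by
  funext b
  simp only [cov, covVec]
  rw [h.eq_of_nhds, pd_congr (by filter_upwards [h] with z hz; rw [hz]) a]

lemma cov_add {X X' : EuclideanSpace ℝ (Fin n) → Fin n → ℝ} (hX : DifferentiableAt ℝ X y)
    (hX' : DifferentiableAt ℝ X' y) (a : Fin n) :
    cov G a (fun z => X z + X' z) y = cov G a X y + cov G a X' y := by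
  funext b
  simp only [cov, covVec, Pi.add_apply, mul_add, Finset.sum_add_distrib]
  rw [pd_add a (differentiableAt_pi.1 hX b) (differentiableAt_pi.1 hX' b)]
  ring

lemma cov_smul {f : EuclideanSpace ℝ (Fin n) → ℝ} {X : EuclideanSpace ℝ (Fin n) → Fin n → ℝ}
    (hf : DifferentiableAt ℝ f y) (hX : DifferentiableAt ℝ X y) (a : Fin n) :
    cov G a (fun z => f z • X z) y = pd a f y • X y + f y • cov G a X y := by
  funext b
  simp only [cov, covVec, Pi.add_apply, Pi.smul_apply, smul_eq_mul]
  rw [pd_mul a hf (differentiableAt_pi.1 hX b), mul_add, Finset.mul_sum, add_assoc]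
  congr 2
  exact Finset.sum_congr rfl fun c _ => by ring

lemma cov_const (a : Fin n) (v : Fin n → ℝ) : cov G a (fun _ => v) y = gam G a y *ᵥ v := by
  funext b
  simp only [cov, covVec, pd_const, zero_add]
  rfl

lemma cov_eq (a : Fin n) (X : EuclideanSpace ℝ (Fin n) → Fin n → ℝ) :
    cov G a X y = (fun b => pd a (fun z => X z b) y) + gam G a y *ᵥ X y := rfl

lemma gradient_eq_of_mulVec (hG : IsMetricOn G O) (hy : y ∈ O) {X α : Fin n → ℝ}
    (h : G y *ᵥ X = α) : (G y)⁻¹ *ᵥ α = X := by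
  rw [← h, mulVec_mulVec, hG.inv_mul hy, one_mulVec]

end

namespace IsMetricOn

variable {G : EuclideanSpace ℝ (Fin n) → Matrix (Fin n) (Fin n) ℝ}
  {O : Set (EuclideanSpace ℝ (Fin n))} (hG : IsMetricOn G O) {y : EuclideanSpace ℝ (Fin n)}

include hG

lemma mulVec_gradient (hy : y ∈ O) (U : EuclideanSpace ℝ (Fin n) → ℝ) :
    G y *ᵥ gradient G U y = diffl U y := by
  rw [gradient, mulVec_mulVec, hG.mul_inv hy, one_mulVec]

/-- The metric pairing is symmetric. -/
lemma dot_symm (hy : y ∈ O) (X Z : Fin n → ℝ) : X ⬝ᵥ G y *ᵥ Z = Z ⬝ᵥ G y *ᵥ X := by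
  have h : (G y).transpose = G y := by ext i j; exact hG.symm y hy j i
  rw [dotProduct_mulVec, ← mulVec_transpose, h, dotProduct_comm]

omit hG in
lemma _root_.Coord.pd_dot {α X : EuclideanSpace ℝ (Fin n) → Fin n → ℝ}
    (hα : DifferentiableAt ℝ α y)
    (hX : DifferentiableAt ℝ X y) (a : Fin n) :
    pd a (fun z => α z ⬝ᵥ X z) y = covForm G a α y ⬝ᵥ X y + α y ⬝ᵥ cov G a X y := by
  simp only [dotProduct, covForm, cov, covVec]
  rw [pd_sum _ _ fun b _ => (differentiableAt_pi.1 hα b).fun_mul (differentiableAt_pi.1 hX b)]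
  simp only [sub_mul, mul_add, Finset.sum_add_distrib, Finset.sum_sub_distrib]
  have : ∑ b, (∑ c, christoffel G c a b y * α y c) * X y b =
      ∑ b, α y b * ∑ c, christoffel G b a c y * X y c := by
    simp only [Finset.sum_mul, Finset.mul_sum]
    rw [Finset.sum_comm]
    exact Finset.sum_congr rfl fun b _ => Finset.sum_congr rfl fun c _ => by ring
  rw [this]
  have h2 : ∀ b, pd a (fun z => α z b * X z b) y =
      pd a (fun z => α z b) y * X y b + α y b * pd a (fun z => X z b) y := fun b =>
    pd_mul a (differentiableAt_pi.1 hα b) (differentiableAt_pi.1 hX b)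
  simp only [h2, Finset.sum_add_distrib]
  ring

lemma diff_mulVec (hy : y ∈ O) {X : EuclideanSpace ℝ (Fin n) → Fin n → ℝ}
    (hX : DifferentiableAt ℝ X y) : DifferentiableAt ℝ (fun z => G z *ᵥ X z) y := by
  refine differentiableAt_pi.2 fun b => ?_
  simp only [mulVec, dotProduct]
  exact DifferentiableAt.fun_sum fun c _ => (hG.diff hy b c).fun_mul (differentiableAt_pi.1 hX c)

lemma covForm_mulVec (hy : y ∈ O) {X : EuclideanSpace ℝ (Fin n) → Fin n → ℝ}
    (hX : DifferentiableAt ℝ X y) (a : Fin n) :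
    covForm G a (fun z => G z *ᵥ X z) y = G y *ᵥ cov G a X y := by
  funext b
  simp only [covForm, mulVec, dotProduct, cov, covVec]
  rw [pd_sum _ _ fun c _ => (hG.diff hy b c).fun_mul (differentiableAt_pi.1 hX c)]
  have h2 : ∀ c, pd a (fun z => G z b c * X z c) y =
      pd a (fun z => G z b c) y * X y c + G y b c * pd a (fun z => X z c) y := fun c =>
    pd_mul a (hG.diff hy b c) (differentiableAt_pi.1 hX c)
  simp only [h2, hG.pd_metric hy, Finset.sum_add_distrib, mul_add, add_mul]
  have h3 : ∑ c, (∑ d, G y b d * christoffel G d a c y) * X y c =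
      ∑ c, G y b c * ∑ d, christoffel G c a d y * X y d := by
    simp only [Finset.sum_mul, Finset.mul_sum]
    rw [Finset.sum_comm]
    exact Finset.sum_congr rfl fun b _ => Finset.sum_congr rfl fun c _ => by ring
  have h4 : ∑ c, (∑ d, G y c d * christoffel G d a b y) * X y c =
      ∑ c, christoffel G c a b y * ∑ d, G y c d * X y d := by
    simp only [Finset.sum_mul, Finset.mul_sum]
    rw [Finset.sum_comm]
    refine Finset.sum_congr rfl fun c _ => Finset.sum_congr rfl fun d _ => ?_
    rw [hG.symm y hy d c]; ring
  rw [h3, h4]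
  ring

lemma smooth_diffl {U : EuclideanSpace ℝ (Fin n) → ℝ} (hU : ContDiffOn ℝ ∞ U O) :
    ContDiffOn ℝ ∞ (diffl U) O :=
  contDiffOn_pi.2 fun b => contDiffOn_pd hG.isOpen hU b

lemma smooth_gradient {U : EuclideanSpace ℝ (Fin n) → ℝ} (hU : ContDiffOn ℝ ∞ U O) :
    ContDiffOn ℝ ∞ (gradient G U) O := by
  refine contDiffOn_pi.2 fun b => ?_
  simp only [gradient, mulVec, dotProduct]
  exact ContDiffOn.sum fun c _ => (hG.smooth_inv b c).mul (contDiffOn_pd hG.isOpen hU c)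

/-! ### Conformal change of the metric -/

lemma conformal {U : EuclideanSpace ℝ (Fin n) → ℝ} (hU : ContDiffOn ℝ ∞ U O) :
    IsMetricOn (fun z => Real.exp (2 * U z) • G z) O where
  isOpen := hG.isOpen
  smooth i j := ((contDiffOn_const.mul hU).exp).mul (hG.smooth i j)
  symm y hy i j := by simp [hG.symm y hy i j]
  det_ne y hy := by
    rw [det_smul]
    exact mul_ne_zero (pow_ne_zero _ (Real.exp_ne_zero _)) (hG.det_ne y hy)

omit hG in
lemma _root_.Coord.conformal_inv (U : EuclideanSpace ℝ (Fin n) → ℝ) :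
    (Real.exp (2 * U y) • G y)⁻¹ = Real.exp (-(2 * U y)) • (G y)⁻¹ := by
  by_cases h : IsUnit (G y).det
  · rw [← Units.smul_mk0 (Real.exp_ne_zero _), Matrix.inv_smul' _ _ h, Real.exp_neg]
    rfl
  · have h1 : (G y).det = 0 := by simpa using h
    have h2 : ¬ IsUnit (Real.exp (2 * U y) • G y).det := by rw [det_smul, h1]; simp
    rw [nonsing_inv_apply_not_isUnit _ h, nonsing_inv_apply_not_isUnit _ h2, smul_zero]

/-- Conformal change of the Christoffel symbols. -/
lemma conformal_christoffel (hy : y ∈ O) {U : EuclideanSpace ℝ (Fin n) → ℝ}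
    (hU : ContDiffOn ℝ ∞ U O) (c a b : Fin n) :
    christoffel (fun z => Real.exp (2 * U z) • G z) c a b y = christoffel G c a b y +
      (if c = b then 1 else 0) * pd a U y + (if c = a then 1 else 0) * pd b U y
        - G y a b * gradient G U y c := by
  have hUd := differentiableAt_of_contDiffOn hG.isOpen hU hy
  have hpd : ∀ i j k, pd i (fun z => Real.exp (2 * U z) * G z j k) y =
      Real.exp (2 * U y) * (pd i (fun z => G z j k) y + 2 * pd i U y * G y j k) := by
    intro i j k
    rw [pd_mul i ((hUd.const_mul 2).exp) (hG.diff hy j k), pd_exp i (hUd.const_mul 2),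
      pd_const_mul i 2 hUd]
    ring
  simp only [christoffel, conformal_inv, Matrix.smul_apply, smul_eq_mul, hpd]
  have hE : Real.exp (-(2 * U y)) * Real.exp (2 * U y) = 1 := by
    rw [← Real.exp_add]; simp
  have hgr : gradient G U y c = ∑ l, (G y)⁻¹ c l * pd l U y := rfl
  rw [← hG.sum_inv_mul hy c b, ← hG.sum_inv_mul hy c a, hgr]
  simp only [Finset.mul_sum, Finset.sum_mul, ← Finset.sum_add_distrib, ← Finset.sum_sub_distrib]
  refine Finset.sum_congr rfl fun l _ => ?_
  rw [hG.symm y hy l b, hG.symm y hy l a]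
  linear_combination (1 / 2 * (G y)⁻¹ c l * ((pd a (fun z => G z b l) y + 2 * pd a U y * G y b l) +
    (pd b (fun z => G z a l) y + 2 * pd b U y * G y a l)
      - (pd l (fun z => G z a b) y + 2 * pd l U y * G y a b))) * hE

/-- Conformal change of the Levi-Civita connection. -/
lemma conformal_cov (hy : y ∈ O) {U : EuclideanSpace ℝ (Fin n) → ℝ}
    (hU : ContDiffOn ℝ ∞ U O) (a : Fin n) (X : EuclideanSpace ℝ (Fin n) → Fin n → ℝ) :
    cov (fun z => Real.exp (2 * U z) • G z) a X y = cov G a X y + pd a U y • X y +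
      (diffl U y ⬝ᵥ X y) • Pi.single a 1 - (G y *ᵥ X y) a • gradient G U y := by
  funext b
  simp only [cov, covVec, hG.conformal_christoffel hy hU, sub_mul, add_mul,
    Finset.sum_add_distrib, Finset.sum_sub_distrib, Pi.add_apply, Pi.sub_apply, Pi.smul_apply,
    smul_eq_mul, dotProduct, mulVec, diffl, Pi.single_apply]
  simp only [ite_mul, one_mul, zero_mul, Finset.sum_ite_eq, Finset.mem_univ, if_true,
    Finset.sum_mul, mul_ite, mul_one, mul_zero]
  have h1 : ∑ c, G y a c * gradient G U y b * X y c = ∑ c, G y a c * X y c * gradient G U y b :=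
    Finset.sum_congr rfl fun c _ => by ring
  rw [h1]
  by_cases hab : b = a
  · subst hab; simp; ring
  · simp [hab]; ring

end IsMetricOn

end Coord

namespace Coord

open Matrix

variable {n : ℕ}

/-! ### Tractor connections -/

/-- The connection on triples `(ρ, X, σ)` given by the formula of the tractor connection, with an
arbitrary bilinear form `P` in the place of the Schouten tensor. -/
def tconn (G P : EuclideanSpace ℝ (Fin n) → Matrix (Fin n) (Fin n) ℝ) (a : Fin n)
    (V : EuclideanSpace ℝ (Fin n) → Tr n) (y : EuclideanSpace ℝ (Fin n)) : Tr n :=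
  (pd a (fun z => (V z).1) y - P y a ⬝ᵥ (V y).2.1,
    cov G a (fun z => (V z).2.1) y + (V y).1 • Pi.single a 1 + (V y).2.2 • ((G y)⁻¹ *ᵥ P y a),
    pd a (fun z => (V z).2.2) y - (G y *ᵥ (V y).2.1) a)

/-- The curvature of `tconn`, evaluated on constant triples. -/
def tcurv (G P : EuclideanSpace ℝ (Fin n) → Matrix (Fin n) (Fin n) ℝ) (a b : Fin n)
    (v : Tr n) (y : EuclideanSpace ℝ (Fin n)) : Tr n :=
  tconn G P a (tconn G P b fun _ => v) y - tconn G P b (tconn G P a fun _ => v) y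

/-- The Schouten tensor as a matrix. -/
def sch (G : EuclideanSpace ℝ (Fin n) → Matrix (Fin n) (Fin n) ℝ)
    (y : EuclideanSpace ℝ (Fin n)) : Matrix (Fin n) (Fin n) ℝ :=
  Matrix.of fun a b => schouten G a b y

variable {G P : EuclideanSpace ℝ (Fin n) → Matrix (Fin n) (Fin n) ℝ}
  {O : Set (EuclideanSpace ℝ (Fin n))} {y : EuclideanSpace ℝ (Fin n)}

lemma tractorConn_eq_tconn : tractorConn G = tconn G (sch G) := by
  funext a V y
  refine Prod.ext rfl (Prod.ext ?_ rfl)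
  funext b
  simp only [tractorConn, tconn, cov, Pi.add_apply, Pi.smul_apply, smul_eq_mul, Pi.single_apply,
    eq_comm (a := a) (b := b)]
  rfl

lemma tractorCurv_eq_tcurv : tractorCurv G = tcurv G (sch G) := by
  funext a b v y
  simp only [tractorCurv, tcurv, tractorConn_eq_tconn]

lemma tconn_congr {V V' : EuclideanSpace ℝ (Fin n) → Tr n} (h : V =ᶠ[𝓝 y] V') (a : Fin n) :
    tconn G P a V y = tconn G P a V' y := by
  simp only [tconn]
  rw [h.eq_of_nhds, pd_congr (by filter_upwards [h] with z hz; rw [hz]) a,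
    cov_congr (X := fun z => (V z).2.1) (X' := fun z => (V' z).2.1)
      (by filter_upwards [h] with z hz; rw [hz]) a,
    pd_congr (f := fun z => (V z).2.2) (h := fun z => (V' z).2.2)
      (by filter_upwards [h] with z hz; rw [hz]) a]

lemma tconn_add {V V' : EuclideanSpace ℝ (Fin n) → Tr n} (hV : DifferentiableAt ℝ V y)
    (hV' : DifferentiableAt ℝ V' y) (a : Fin n) :
    tconn G P a (fun z => V z + V' z) y = tconn G P a V y + tconn G P a V' y := by
  have h1 := pd_add a hV.fst hV'.fst
  have h2 := cov_add (G := G) hV.snd.fst hV'.snd.fst a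
  have h3 := pd_add a hV.snd.snd hV'.snd.snd
  refine Prod.ext ?_ (Prod.ext ?_ ?_)
  · simp only [tconn, Prod.fst_add, Prod.snd_add, h1, dotProduct_add]; ring
  · simp only [tconn, Prod.fst_add, Prod.snd_add, h2, add_smul]; abel
  · simp only [tconn, Prod.fst_add, Prod.snd_add, h3, mulVec_add, Pi.add_apply]; ring

lemma tconn_smul {f : EuclideanSpace ℝ (Fin n) → ℝ} {V : EuclideanSpace ℝ (Fin n) → Tr n}
    (hf : DifferentiableAt ℝ f y) (hV : DifferentiableAt ℝ V y) (a : Fin n) :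
    tconn G P a (fun z => f z • V z) y = pd a f y • V y + f y • tconn G P a V y := by
  have h1 := pd_mul a hf hV.fst
  have h2 := cov_smul (G := G) hf hV.snd.fst a
  have h3 := pd_mul a hf hV.snd.snd
  refine Prod.ext ?_ (Prod.ext ?_ ?_)
  · simp only [tconn, Prod.fst_add, Prod.smul_fst, Prod.smul_snd, smul_eq_mul, h1,
      dotProduct_smul]
    ring
  · simp only [tconn, Prod.fst_add, Prod.snd_add, Prod.smul_fst, Prod.smul_snd, smul_eq_mul, h2,
      smul_add, mul_smul]
    abel
  · simp only [tconn, Prod.snd_add, Prod.smul_fst, Prod.smul_snd, smul_eq_mul, h3,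
      mulVec_smul, Pi.smul_apply]
    ring

/-- The zeroth-order part of `tconn`, as a linear map. -/
def tform (G P : EuclideanSpace ℝ (Fin n) → Matrix (Fin n) (Fin n) ℝ) (a : Fin n)
    (y : EuclideanSpace ℝ (Fin n)) : Tr n →L[ℝ] Tr n :=
  LinearMap.toContinuousLinearMap
    { toFun := fun v => tconn G P a (fun _ => v) y
      map_add' := fun v w =>
        tconn_add (V := fun _ => v) (V' := fun _ => w) (differentiableAt_const v)
          (differentiableAt_const w) a
      map_smul' := fun c v => by
        have := tconn_smul (G := G) (P := P) (y := y) (f := fun _ => c) (V := fun _ => v)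
          (differentiableAt_const c) (differentiableAt_const v) a
        rw [this, pd_const, zero_smul, zero_add]; rfl }

lemma tform_apply (a : Fin n) (v : Tr n) : tform G P a y v = tconn G P a (fun _ => v) y := rfl

lemma tconn_eq {V : EuclideanSpace ℝ (Fin n) → Tr n} (hV : DifferentiableAt ℝ V y) (a : Fin n) :
    tconn G P a V y = fderiv ℝ V y (EuclideanSpace.single a 1) + tform G P a y (V y) := by
  have h1 : pd a (fun z => (V z).1) y = (fderiv ℝ V y (EuclideanSpace.single a 1)).1 := by
    rw [pd, (hV.hasFDerivAt.fst).fderiv]; rfl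
  have h2 : ∀ b, pd a (fun z => (V z).2.1 b) y =
      (fderiv ℝ V y (EuclideanSpace.single a 1)).2.1 b := by
    intro b
    rw [pd, ((hasFDerivAt_pi'.1 hV.hasFDerivAt.snd.fst) b).fderiv]; rfl
  have h3 : pd a (fun z => (V z).2.2) y = (fderiv ℝ V y (EuclideanSpace.single a 1)).2.2 := by
    rw [pd, (hV.hasFDerivAt.snd.snd).fderiv]; rfl
  rw [tform_apply]
  refine Prod.ext ?_ (Prod.ext ?_ ?_)
  · simp only [tconn, h1, pd_const, Prod.fst_add]; ring
  · funext b
    simp only [tconn, cov_eq, h2, pd_const, Prod.fst_add, Prod.snd_add, Pi.add_apply]; ring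
  · simp only [tconn, h3, pd_const, Prod.snd_add]; ring

/-- Smoothness of the entries of a matrix-valued function. -/
def SmoothMat (P : EuclideanSpace ℝ (Fin n) → Matrix (Fin n) (Fin n) ℝ)
    (O : Set (EuclideanSpace ℝ (Fin n))) : Prop :=
  ∀ i j, ContDiffOn ℝ ∞ (fun z => P z i j) O

lemma smooth_tconn (hG : IsMetricOn G O) (hP : SmoothMat P O)
    {V : EuclideanSpace ℝ (Fin n) → Tr n} (hV : ContDiffOn ℝ ∞ V O) (a : Fin n) :
    ContDiffOn ℝ ∞ (tconn G P a V) O := by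
  have hX : ∀ b, ContDiffOn ℝ ∞ (fun z => (V z).2.1 b) O := contDiffOn_pi.1 hV.snd.fst
  refine ContDiffOn.prodMk ?_ (ContDiffOn.prodMk (contDiffOn_pi.2 fun b => ?_) ?_)
  · simp only [dotProduct]
    exact (contDiffOn_pd hG.isOpen hV.fst a).sub (ContDiffOn.sum fun c _ => (hP a c).mul (hX c))
  · simp only [cov, covVec, Pi.add_apply, Pi.smul_apply, smul_eq_mul, mulVec, dotProduct]
    exact (((contDiffOn_pd hG.isOpen (hX b) a).add (ContDiffOn.sum fun c _ =>
      (hG.smooth_christoffel _ _ _).mul (hX c))).add (hV.fst.mul contDiffOn_const)).add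
      (hV.snd.snd.mul (ContDiffOn.sum fun c _ => (hG.smooth_inv b c).mul (hP a c)))
  · simp only [mulVec, dotProduct]
    exact (contDiffOn_pd hG.isOpen hV.snd.snd a).sub
      (ContDiffOn.sum fun c _ => (hG.smooth a c).mul (hX c))

/-- The commutator of covariant derivatives is tensorial: on an arbitrary smooth section it is the
curvature applied to the value of the section. -/
lemma tconn_comm (hG : IsMetricOn G O) (hP : SmoothMat P O) (hy : y ∈ O)
    {V : EuclideanSpace ℝ (Fin n) → Tr n} (hV : ContDiffOn ℝ ∞ V O) (a b : Fin n) :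
    tconn G P a (tconn G P b V) y - tconn G P b (tconn G P a V) y = tcurv G P a b (V y) y := by
  have hVy := differentiableAt_of_contDiffOn hG.isOpen hV hy
  have hA : ∀ a, ContDiffOn ℝ ∞ (tform G P a) O := fun a =>
    contDiffOn_clm_apply.2 fun v => smooth_tconn hG hP contDiffOn_const a
  have hAd : ∀ a, DifferentiableAt ℝ (tform G P a) y := fun a =>
    differentiableAt_of_contDiffOn hG.isOpen (hA a) hy
  have hdV : DifferentiableAt ℝ (fderiv ℝ V) y :=
    differentiableAt_of_contDiffOn hG.isOpen (hV.fderiv_of_isOpen hG.isOpen (by simp)) hy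
  have hsymm : IsSymmSndFDerivAt ℝ V y :=
    (hV.contDiffAt (hG.isOpen.mem_nhds hy)).isSymmSndFDerivAt (by
      rw [minSmoothness_of_isRCLikeNormedField]; exact WithTop.coe_le_coe.2 le_top)
  have hconst : ∀ a b v, tconn G P a (tconn G P b fun _ => v) y =
      fderiv ℝ (tform G P b) y (EuclideanSpace.single a 1) v
        + tform G P a y (tform G P b y v) := by
    intro a b v
    have h1 : HasFDerivAt (tconn G P b fun _ => v) _ y :=
      ((hAd b).hasFDerivAt).clm_apply (hasFDerivAt_const v y)
    rw [tconn_eq h1.differentiableAt, h1.fderiv]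
    simp [tform_apply]
  have hgen : ∀ a b, tconn G P a (tconn G P b V) y =
      fderiv ℝ (fderiv ℝ V) y (EuclideanSpace.single a 1) (EuclideanSpace.single b 1) +
      fderiv ℝ (tform G P b) y (EuclideanSpace.single a 1) (V y) +
      tform G P b y (fderiv ℝ V y (EuclideanSpace.single a 1)) +
      tform G P a y (fderiv ℝ V y (EuclideanSpace.single b 1)) +
      tform G P a y (tform G P b y (V y)) := by
    intro a b
    have h0 : tconn G P b V =ᶠ[𝓝 y] fun z =>
        fderiv ℝ V z (EuclideanSpace.single b 1) + tform G P b z (V z) := by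
      filter_upwards [hG.isOpen.mem_nhds hy] with z hz
      exact tconn_eq (differentiableAt_of_contDiffOn hG.isOpen hV hz) b
    have h1 := (hdV.hasFDerivAt.clm_apply (hasFDerivAt_const (EuclideanSpace.single b (1 : ℝ)) y)).add
      ((hAd b).hasFDerivAt.clm_apply hVy.hasFDerivAt)
    have h2 : HasFDerivAt (fun z => fderiv ℝ V z (EuclideanSpace.single b 1)
      + tform G P b z (V z)) _ y := h1
    rw [tconn_congr h0, tconn_eq h2.differentiableAt, h2.fderiv]
    simp
    abel
  rw [tcurv, hgen, hgen, hconst, hconst, hsymm (EuclideanSpace.single a 1)]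
  abel

end Coord

namespace Coord

open Matrix

variable {n : ℕ} {G P : EuclideanSpace ℝ (Fin n) → Matrix (Fin n) (Fin n) ℝ}
  {O : Set (EuclideanSpace ℝ (Fin n))} {y : EuclideanSpace ℝ (Fin n)}

/-! ### The curvature of the tractor connection -/

/-- The endomorphism part of the curvature of `tconn`. -/
def weylEnd (G P : EuclideanSpace ℝ (Fin n) → Matrix (Fin n) (Fin n) ℝ) (a b : Fin n)
    (y : EuclideanSpace ℝ (Fin n)) : Matrix (Fin n) (Fin n) ℝ :=
  curvEnd G a b y - vecMulVec (Pi.single a 1) (P y b) + vecMulVec (Pi.single b 1) (P y a)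
    - vecMulVec ((G y)⁻¹ *ᵥ P y a) (G y b) + vecMulVec ((G y)⁻¹ *ᵥ P y b) (G y a)

/-- `weylEnd` with the index lowered; the Weyl tensor if `P` is the Schouten tensor. -/
def weyl (G P : EuclideanSpace ℝ (Fin n) → Matrix (Fin n) (Fin n) ℝ) (a b c d : Fin n)
    (y : EuclideanSpace ℝ (Fin n)) : ℝ :=
  riemann G a b c d y - G y a c * P y b d + G y b c * P y a d - G y b d * P y a c
    + G y a d * P y b c

lemma weyl_eq (hG : IsMetricOn G O) (hy : y ∈ O) (a b c d : Fin n) :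
    weyl G P a b c d y = (G y * weylEnd G P a b y) c d := by
  have h1 : ∀ a, G y *ᵥ ((G y)⁻¹ *ᵥ P y a) = P y a := fun a => by
    rw [mulVec_mulVec, hG.mul_inv hy, one_mulVec]
  have h2 : ∀ (v w : Fin n → ℝ), G y * vecMulVec v w = vecMulVec (G y *ᵥ v) w := fun v w => by
    rw [mul_vecMulVec]
  simp only [weylEnd, Matrix.mul_add, Matrix.mul_sub, h2, h1, Matrix.add_apply, Matrix.sub_apply,
    vecMulVec_apply, mulVec_single_one, Matrix.col_apply, weyl, riemann_eq, hG.symm y hy c a,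
    hG.symm y hy c b]
  ring

lemma gam_symm (hG : IsMetricOn G O) (hy : y ∈ O) (a b : Fin n) :
    gam G a y *ᵥ Pi.single b 1 = gam G b y *ᵥ Pi.single a 1 := by
  funext c
  simp only [mulVec_single_one, Matrix.col_apply]
  exact hG.christoffel_symm hy c a b

lemma gam_transpose_symm (hG : IsMetricOn G O) (hy : y ∈ O) (a b : Fin n) (v : Fin n → ℝ) :
    ((gam G a y).transpose *ᵥ v) b = ((gam G b y).transpose *ᵥ v) a := by
  simp only [mulVec, dotProduct, transpose_apply]
  exact Finset.sum_congr rfl fun c _ => by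
    rw [show gam G a y c b = gam G b y c a from hG.christoffel_symm hy c a b]

lemma tconn_const (b : Fin n) (ρ : ℝ) (X : Fin n → ℝ) :
    (tconn G P b fun _ => (ρ, X, 0)) =
      fun z => (-(P z b ⬝ᵥ X), gam G b z *ᵥ X + ρ • Pi.single b 1, -(G z *ᵥ X) b) := by
  funext z
  simp [tconn, pd_const, cov_const]

lemma pd_mulVec {A : EuclideanSpace ℝ (Fin n) → Matrix (Fin n) (Fin n) ℝ}
    (hA : ∀ i j, DifferentiableAt ℝ (fun z => A z i j) y) (X : Fin n → ℝ) (a b : Fin n) :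
    pd a (fun z => (A z *ᵥ X) b) y = (pdM a A y *ᵥ X) b := by
  simp only [mulVec, dotProduct, pdM, of_apply]
  rw [pd_sum _ _ fun c _ => (hA b c).mul_const _]
  refine Finset.sum_congr rfl fun c _ => ?_
  rw [pd_mul a (hA b c) (differentiableAt_const _), pd_const]; ring

lemma tcurv_mid (hG : IsMetricOn G O) (hy : y ∈ O) (a b : Fin n) (ρ : ℝ) (X : Fin n → ℝ) :
    (tcurv G P a b (ρ, X, 0) y).2.1 = weylEnd G P a b y *ᵥ X := by
  have hcov : ∀ a b, cov G a (fun z => gam G b z *ᵥ X + ρ • Pi.single b 1) y =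
      pdM a (gam G b) y *ᵥ X + gam G a y *ᵥ (gam G b y *ᵥ X) + ρ • gam G a y *ᵥ Pi.single b 1 := by
    intro a b
    have hd : ∀ c, DifferentiableAt ℝ (fun z => (gam G b z *ᵥ X) c) y := fun c => by
      simp only [mulVec, dotProduct]
      exact DifferentiableAt.fun_sum fun d _ => (hG.diff_christoffel hy c b d).mul_const _
    rw [cov_eq, mulVec_add, mulVec_smul, ← add_assoc]
    congr 2
    funext c
    simp only [Pi.add_apply]
    rw [pd_add a (hd c) (differentiableAt_const _), pd_const, add_zero]
    exact pd_mulVec (fun i j => hG.diff_christoffel hy i b j) X a c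
  simp only [tcurv, tconn_const, Prod.snd_sub, Prod.fst_sub]
  simp only [tconn, hcov, weylEnd, curvEnd_eq, gam_symm hG hy b a, sub_mulVec, add_mulVec,
    vecMulVec_mulVec, mulVec_mulVec]
  funext c
  simp only [Pi.add_apply, Pi.sub_apply, Pi.smul_apply, smul_eq_mul, MulOpposite.smul_eq_mul_unop,
    MulOpposite.unop_op, mulVec]
  ring

lemma tcurv_bottom (hG : IsMetricOn G O) (hy : y ∈ O) (a b : Fin n) (ρ : ℝ) (X : Fin n → ℝ) :
    (tcurv G P a b (ρ, X, 0) y).2.2 = 0 := by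
  have hd : ∀ a b, pd a (fun z => -(G z *ᵥ X) b) y =
      -((G y *ᵥ (gam G a y *ᵥ X)) b + ((gam G a y).transpose *ᵥ (G y *ᵥ X)) b) := by
    intro a b
    rw [pd_neg, pd_mulVec (hG.diff hy), hG.pdM_metric hy, add_mulVec, mulVec_mulVec, mulVec_mulVec]
    rfl
  simp only [tcurv, tconn_const, Prod.snd_sub]
  simp only [tconn, hd, mulVec_add, mulVec_smul, Pi.add_apply, Pi.smul_apply, smul_eq_mul,
    mulVec_single_one, Matrix.col_apply, gam_transpose_symm hG hy b a, hG.symm y hy b a]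
  ring

/-! ### Conformal change of the tractor connection -/

/-- The change of splitting of the tractor bundle from `G` to `e^{2U} G`. -/
def gauge (G : EuclideanSpace ℝ (Fin n) → Matrix (Fin n) (Fin n) ℝ)
    (U : EuclideanSpace ℝ (Fin n) → ℝ) (y : EuclideanSpace ℝ (Fin n)) (v : Tr n) : Tr n :=
  (Real.exp (-U y) * (v.1 - diffl U y ⬝ᵥ v.2.1 - diffl U y ⬝ᵥ gradient G U y / 2 * v.2.2),
    Real.exp (-U y) • (v.2.1 + v.2.2 • gradient G U y), Real.exp (U y) * v.2.2)

/-- The conformal change of `P` that goes with `gauge`. -/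
def confP (G P : EuclideanSpace ℝ (Fin n) → Matrix (Fin n) (Fin n) ℝ)
    (U : EuclideanSpace ℝ (Fin n) → ℝ) (y : EuclideanSpace ℝ (Fin n)) :
    Matrix (Fin n) (Fin n) ℝ :=
  Matrix.of fun a => P y a - covForm G a (diffl U) y + pd a U y • diffl U y
    - (diffl U y ⬝ᵥ gradient G U y / 2) • G y a

lemma confP_row (U : EuclideanSpace ℝ (Fin n) → ℝ) (a : Fin n) :
    confP G P U y a = P y a - covForm G a (diffl U) y + pd a U y • diffl U y
      - (diffl U y ⬝ᵥ gradient G U y / 2) • G y a := rfl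

/-- The two tractor connections are related by the change of splitting. -/
lemma tconn_gauge (hG : IsMetricOn G O) (hy : y ∈ O) {U : EuclideanSpace ℝ (Fin n) → ℝ}
    (hU : ContDiffOn ℝ ∞ U O) {V : EuclideanSpace ℝ (Fin n) → Tr n} (hV : DifferentiableAt ℝ V y)
    (a : Fin n) :
    tconn (fun z => Real.exp (2 * U z) • G z) (confP G P U) a (fun z => gauge G U z (V z)) y =
      gauge G U y (tconn G P a V y) := by
  have hUd := differentiableAt_of_contDiffOn hG.isOpen hU hy
  have hρ := hV.fst
  have hX := hV.snd.fst
  have hσ := hV.snd.snd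
  have hdi := differentiableAt_of_contDiffOn hG.isOpen (hG.smooth_diffl hU) hy
  have hgr := differentiableAt_of_contDiffOn hG.isOpen (hG.smooth_gradient hU) hy
  have hE : DifferentiableAt ℝ (fun z => Real.exp (U z)) y := hUd.exp
  have hE' : DifferentiableAt ℝ (fun z => Real.exp (-U z)) y := hUd.fun_neg.exp
  have hpdE : pd a (fun z => Real.exp (-U z)) y = -(Real.exp (-U y) * pd a U y) := by
    rw [pd_exp a hUd.fun_neg, pd_neg]; ring
  have hGgr : ∀ z ∈ O, G z *ᵥ gradient G U z = diffl U z := fun z hz => hG.mulVec_gradient hz U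
  -- the covariant derivative of the gradient
  have hcovgr : covForm G a (diffl U) y = G y *ᵥ cov G a (gradient G U) y := by
    rw [← hG.covForm_mulVec hy hgr]
    funext b
    simp only [covForm]
    congr 1
    · exact pd_congr (by filter_upwards [hG.isOpen.mem_nhds hy] with z hz; rw [hGgr z hz]) a
    · rw [hGgr y hy]
  have hinv : (G y)⁻¹ *ᵥ covForm G a (diffl U) y = cov G a (gradient G U) y :=
    gradient_eq_of_mulVec hG hy hcovgr.symm
  have hinvG : (G y)⁻¹ *ᵥ G y a = Pi.single a 1 := by
    refine gradient_eq_of_mulVec hG hy ?_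
    funext b
    rw [mulVec_single_one, Matrix.col_apply, hG.symm y hy]
  have hinvU : (G y)⁻¹ *ᵥ diffl U y = gradient G U y := rfl
  have hPgr : diffl U y ⬝ᵥ ((G y)⁻¹ *ᵥ P y a) = P y a ⬝ᵥ gradient G U y := by
    have hs : ((G y)⁻¹).transpose = (G y)⁻¹ := by ext i j; exact hG.inv_symm hy j i
    rw [dotProduct_mulVec, ← mulVec_transpose, hs, dotProduct_comm]; rfl
  have hN : pd a (fun z => diffl U z ⬝ᵥ gradient G U z) y =
      2 * (covForm G a (diffl U) y ⬝ᵥ gradient G U y) := by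
    rw [pd_dot hdi hgr, two_mul]
    congr 1
    rw [hcovgr, dotProduct_comm _ (gradient G U y), hG.dot_symm hy, hGgr y hy, dotProduct_comm]
  have hEE : Real.exp (-(2 * U y)) * Real.exp (U y) = Real.exp (-U y) := by
    rw [← Real.exp_add]; congr 1; ring
  have hEE2 : Real.exp (2 * U y) * Real.exp (-U y) = Real.exp (U y) := by
    rw [← Real.exp_add]; congr 1; ring
  have hdX : DifferentiableAt ℝ (fun z => diffl U z ⬝ᵥ (V z).2.1) y := by
    simp only [dotProduct]
    exact DifferentiableAt.fun_sum fun b _ =>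
      (differentiableAt_pi.1 hdi b).fun_mul (differentiableAt_pi.1 hX b)
  have hdN : DifferentiableAt ℝ (fun z => diffl U z ⬝ᵥ gradient G U z) y := by
    simp only [dotProduct]
    exact DifferentiableAt.fun_sum fun b _ =>
      (differentiableAt_pi.1 hdi b).fun_mul (differentiableAt_pi.1 hgr b)
  have hdN2 : DifferentiableAt ℝ (fun z => diffl U z ⬝ᵥ gradient G U z / 2) y := by
    simp only [div_eq_mul_inv]
    exact hdN.mul_const _
  have hrow : (G y *ᵥ gradient G U y) a = pd a U y := by rw [hGgr y hy]; rfl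
  have hGa : ∀ X, G y a ⬝ᵥ X = (G y *ᵥ X) a := fun X => rfl
  refine Prod.ext ?_ (Prod.ext ?_ ?_)
  · simp only [tconn, gauge, confP_row]
    rw [pd_mul a hE' ((hρ.fun_sub hdX).fun_sub ((hdN2).fun_mul hσ)), hpdE,
      pd_sub a (hρ.fun_sub hdX) ((hdN2).fun_mul hσ), pd_sub a hρ hdX,
      pd_mul a (hdN2) hσ, pd_dot hdi hX]
    have hN2 : pd a (fun z => diffl U z ⬝ᵥ gradient G U z / 2) y =
        covForm G a (diffl U) y ⬝ᵥ gradient G U y := by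
      simp only [div_eq_inv_mul]
      rw [pd_const_mul a _ hdN, hN]; ring
    rw [hN2]
    simp only [dotProduct_add, add_dotProduct, sub_dotProduct, smul_dotProduct,
      dotProduct_smul, smul_eq_mul, hPgr, hGa, hrow, dotProduct_single, mul_one]
    have : diffl U y a = pd a U y := rfl
    rw [this]
    ring
  · simp only [tconn, gauge]
    rw [hG.conformal_cov hy hU, cov_smul hE' (hX.fun_add (hσ.fun_smul hgr)),
      cov_add hX (hσ.fun_smul hgr), cov_smul hσ hgr, hpdE, conformal_inv]
    have hP : (Real.exp (-(2 * U y)) • (G y)⁻¹) *ᵥ confP G P U y a =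
        Real.exp (-(2 * U y)) • ((G y)⁻¹ *ᵥ P y a - cov G a (gradient G U) y
          + pd a U y • gradient G U y
          - (diffl U y ⬝ᵥ gradient G U y / 2) • Pi.single a 1) := by
      rw [smul_mulVec]
      simp only [confP_row, mulVec_sub, mulVec_add, mulVec_smul, hinv, hinvG, hinvU]
    rw [hP]
    funext b
    simp only [mulVec_smul, mulVec_add, dotProduct_smul, dotProduct_add, Pi.add_apply,
      Pi.sub_apply, Pi.smul_apply, smul_eq_mul, hrow]
    linear_combination ((V y).2.2 * (((G y)⁻¹ *ᵥ P y a) b - cov G a (gradient G U) y b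
          + pd a U y * gradient G U y b
          - (diffl U y ⬝ᵥ gradient G U y / 2) * (Pi.single a 1 : Fin n → ℝ) b)) * hEE
  · simp only [tconn, gauge]
    rw [pd_mul a hE hσ, pd_exp a hUd, smul_mulVec, mulVec_smul, mulVec_add, mulVec_smul]
    simp only [Pi.smul_apply, Pi.add_apply, smul_eq_mul, hrow]
    linear_combination (-((G y *ᵥ (V y).2.1) a + (V y).2.2 * pd a U y)) * hEE2

end Coord

namespace Coord

open Matrix

variable {n : ℕ} {G P : EuclideanSpace ℝ (Fin n) → Matrix (Fin n) (Fin n) ℝ}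
  {O : Set (EuclideanSpace ℝ (Fin n))} {y : EuclideanSpace ℝ (Fin n)}
  {U : EuclideanSpace ℝ (Fin n) → ℝ}

lemma tconn_congr_right {P' : EuclideanSpace ℝ (Fin n) → Matrix (Fin n) (Fin n) ℝ}
    (h : P y = P' y) (a : Fin n) (V : EuclideanSpace ℝ (Fin n) → Tr n) :
    tconn G P a V y = tconn G P' a V y := by
  simp only [tconn, h]

lemma gauge_add (v w : Tr n) : gauge G U y (v + w) = gauge G U y v + gauge G U y w := by
  refine Prod.ext ?_ (Prod.ext ?_ ?_)
  · simp only [gauge, Prod.fst_add, Prod.snd_add, dotProduct_add]; ring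
  · funext b
    simp only [gauge, Prod.fst_add, Prod.snd_add, Pi.smul_apply, Pi.add_apply, smul_eq_mul]; ring
  · simp only [gauge, Prod.snd_add]; ring

lemma gauge_smul (c : ℝ) (v : Tr n) : gauge G U y (c • v) = c • gauge G U y v := by
  refine Prod.ext ?_ (Prod.ext ?_ ?_)
  · simp only [gauge, Prod.smul_fst, Prod.smul_snd, dotProduct_smul, smul_eq_mul]; ring
  · funext b
    simp only [gauge, Prod.smul_fst, Prod.smul_snd, Pi.smul_apply, Pi.add_apply, smul_eq_mul]; ring
  · simp only [gauge, Prod.smul_snd, smul_eq_mul]; ring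

lemma gauge_sub (v w : Tr n) : gauge G U y (v - w) = gauge G U y v - gauge G U y w := by
  rw [sub_eq_add_neg, ← neg_one_smul ℝ w, gauge_add, gauge_smul, neg_one_smul, sub_eq_add_neg]

lemma smooth_dot {α X : EuclideanSpace ℝ (Fin n) → Fin n → ℝ} (hα : ContDiffOn ℝ ∞ α O)
    (hX : ContDiffOn ℝ ∞ X O) : ContDiffOn ℝ ∞ (fun z => α z ⬝ᵥ X z) O := by
  simp only [dotProduct]
  exact ContDiffOn.sum fun b _ => (contDiffOn_pi.1 hα b).mul (contDiffOn_pi.1 hX b)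

lemma smooth_gauge (hG : IsMetricOn G O) (hU : ContDiffOn ℝ ∞ U O)
    {V : EuclideanSpace ℝ (Fin n) → Tr n} (hV : ContDiffOn ℝ ∞ V O) :
    ContDiffOn ℝ ∞ (fun z => gauge G U z (V z)) O := by
  have hd := hG.smooth_diffl hU
  have hg := hG.smooth_gradient hU
  exact (hU.neg.exp.mul ((hV.fst.sub (smooth_dot hd hV.snd.fst)).sub
    (((smooth_dot hd hg).div_const 2).mul hV.snd.snd))).prodMk
      ((hU.neg.exp.smul (hV.snd.fst.add (hV.snd.snd.smul hg))).prodMk (hU.exp.mul hV.snd.snd))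

lemma smooth_confP (hG : IsMetricOn G O) (hP : SmoothMat P O) (hU : ContDiffOn ℝ ∞ U O) :
    SmoothMat (confP G P U) O := by
  intro a b
  have hd := contDiffOn_pi.1 (hG.smooth_diffl hU)
  have hN := smooth_dot (hG.smooth_diffl hU) (hG.smooth_gradient hU)
  have h1 : ContDiffOn ℝ ∞ (fun z => covForm G a (diffl U) z b) O := by
    simp only [covForm]
    exact (contDiffOn_pd hG.isOpen (hd b) a).sub
      (ContDiffOn.sum fun c _ => (hG.smooth_christoffel _ _ _).mul (hd c))
  exact (((hP a b).sub h1).add ((contDiffOn_pd hG.isOpen hU a).mul (hd b))).sub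
    ((hN.div_const 2).mul (hG.smooth a b))

/-- The curvatures of the two tractor connections are conjugate under the change of splitting. -/
lemma tcurv_gauge (hG : IsMetricOn G O) (hP : SmoothMat P O) (hU : ContDiffOn ℝ ∞ U O)
    (hy : y ∈ O) (a b : Fin n) (v : Tr n) :
    tcurv (fun z => Real.exp (2 * U z) • G z) (confP G P U) a b (gauge G U y v) y =
      gauge G U y (tcurv G P a b v y) := by
  have hc : ContDiffOn ℝ ∞ (fun _ : EuclideanSpace ℝ (Fin n) => v) O := contDiffOn_const
  have key : ∀ a b, tconn (fun z => Real.exp (2 * U z) • G z) (confP G P U) a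
      (tconn (fun z => Real.exp (2 * U z) • G z) (confP G P U) b fun z => gauge G U z v) y =
      gauge G U y (tconn G P a (tconn G P b fun _ => v) y) := by
    intro a b
    have h : tconn (fun z => Real.exp (2 * U z) • G z) (confP G P U) b (fun z => gauge G U z v)
        =ᶠ[𝓝 y] fun z => gauge G U z (tconn G P b (fun _ => v) z) := by
      filter_upwards [hG.isOpen.mem_nhds hy] with z hz
      exact tconn_gauge hG hz hU (differentiableAt_const v) b
    rw [tconn_congr h]
    exact tconn_gauge hG hy hU
      (differentiableAt_of_contDiffOn hG.isOpen (smooth_tconn hG hP hc b) hy) a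
  rw [← tconn_comm (hG.conformal hU) (smooth_confP hG hP hU) hy (smooth_gauge hG hU hc) a b,
    key, key, ← gauge_sub]
  rfl

lemma weylEnd_conformal (hG : IsMetricOn G O) (hP : SmoothMat P O) (hU : ContDiffOn ℝ ∞ U O)
    (hy : y ∈ O) (a b : Fin n) :
    weylEnd (fun z => Real.exp (2 * U z) • G z) (confP G P U) a b y = weylEnd G P a b y := by
  refine Matrix.ext_of_mulVec_single fun i => ?_
  have h : (tcurv (fun z => Real.exp (2 * U z) • G z) (confP G P U) a b
      (gauge G U y (0, Pi.single i 1, 0)) y).2.1 =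
      (gauge G U y (tcurv G P a b (0, Pi.single i 1, 0) y)).2.1 :=
    congrArg (fun v : Tr n => v.2.1) (tcurv_gauge hG hP hU hy a b (0, Pi.single i 1, 0))
  have h1 : gauge G U y (0, Pi.single i 1, 0) =
      (-(Real.exp (-U y) * diffl U y ⬝ᵥ Pi.single i 1), Real.exp (-U y) • Pi.single i 1, 0) := by
    simp [gauge]
  have h2 : (gauge G U y (tcurv G P a b (0, Pi.single i 1, 0) y)).2.1 =
      Real.exp (-U y) • ((tcurv G P a b (0, Pi.single i 1, 0) y).2.1 +
        (tcurv G P a b (0, Pi.single i 1, 0) y).2.2 • gradient G U y) := rfl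
  rw [h2, h1, tcurv_mid (hG.conformal hU) hy, tcurv_mid hG hy, tcurv_bottom hG hy, zero_smul,
    add_zero, mulVec_smul] at h
  exact smul_right_injective _ (Real.exp_ne_zero _) h

/-- The trace of a bilinear form with respect to `G`. -/
def trG (G P : EuclideanSpace ℝ (Fin n) → Matrix (Fin n) (Fin n) ℝ)
    (y : EuclideanSpace ℝ (Fin n)) : ℝ := ∑ a, ∑ c, (G y)⁻¹ a c * P y a c

lemma trace_weylEnd (hG : IsMetricOn G O) (hy : y ∈ O) (b d : Fin n) :
    ∑ a, weylEnd G P a b y a d =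
      ricci G b d y - (n - 2) * P y b d - trG G P y * G y b d := by
  have h3 : ∑ a, ((G y)⁻¹ *ᵥ P y b) a * G y a d = P y b d := by
    have h : G y *ᵥ ((G y)⁻¹ *ᵥ P y b) = P y b := by
      rw [mulVec_mulVec, hG.mul_inv hy, one_mulVec]
    have h4 := congrFun h d
    rw [← h4]
    simp only [mulVec, dotProduct]
    exact Finset.sum_congr rfl fun a _ => by rw [hG.symm y hy a d, mul_comm]
  have h4 : ∑ a, ((G y)⁻¹ *ᵥ P y a) a * G y b d = trG G P y * G y b d := by
    rw [← Finset.sum_mul]; rfl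
  simp only [weylEnd, Matrix.add_apply, Matrix.sub_apply, vecMulVec_apply, Finset.sum_add_distrib,
    Finset.sum_sub_distrib, h3, h4, Pi.single_eq_same, Pi.single_apply, one_mul, ite_mul, zero_mul,
    Finset.sum_ite_eq', Finset.mem_univ, if_true, Finset.sum_const, Finset.card_univ,
    Fintype.card_fin, nsmul_eq_mul]
  have h5 : ∑ a, curvEnd G a b y a d = ricci G b d y := rfl
  rw [h5]
  ring

lemma trG_self (hG : IsMetricOn G O) (hy : y ∈ O) : trG G G y = n := by
  have : ∀ a, ∑ c, (G y)⁻¹ a c * G y a c = 1 := fun a => by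
    have := hG.sum_inv_mul hy a a
    rw [if_pos rfl] at this
    rw [← this]
    exact Finset.sum_congr rfl fun c _ => by rw [hG.symm y hy a c]
  simp [trG, this]

lemma trG_sch (hn : 2 < n) (hG : IsMetricOn G O) (hy : y ∈ O) :
    trG G (sch G) y = scal G y / (2 * (n - 1)) := by
  have hn' : (2 : ℝ) < n := by exact_mod_cast hn
  have h1 : trG G (sch G) y = 1 / ((n : ℝ) - 2) *
      (scal G y - scal G y / (2 * (n - 1)) * trG G G y) := by
    simp only [trG, sch, schouten, of_apply, scal]
    simp only [Finset.mul_sum, mul_sub, Finset.sum_sub_distrib]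
    congr 1 <;>
    exact Finset.sum_congr rfl fun a _ => Finset.sum_congr rfl fun c _ => by ring
  rw [h1, trG_self hG hy]
  have : (n : ℝ) - 2 ≠ 0 := by linarith
  have : (n : ℝ) - 1 ≠ 0 := by linarith
  field_simp
  ring

/-- The Weyl tensor is trace-free. -/
lemma trace_weylEnd_sch (hn : 2 < n) (hG : IsMetricOn G O) (hy : y ∈ O) (b d : Fin n) :
    ∑ a, weylEnd G (sch G) a b y a d = 0 := by
  have hn' : (2 : ℝ) < n := by exact_mod_cast hn
  rw [trace_weylEnd hG hy, trG_sch hn hG hy]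
  simp only [sch, of_apply, schouten]
  have : (n : ℝ) - 2 ≠ 0 := by linarith
  field_simp
  ring

/-- The Schouten tensor is the only bilinear form for which the endomorphism part of the curvature
is trace-free. -/
lemma eq_sch_of_trace (hn : 2 < n) (hG : IsMetricOn G O) (hy : y ∈ O)
    (h : ∀ b d, ∑ a, weylEnd G P a b y a d = 0) : P y = sch G y := by
  have hn' : (2 : ℝ) < n := by exact_mod_cast hn
  have h2 : (n : ℝ) - 2 ≠ 0 := by linarith
  have h1 : (n : ℝ) - 1 ≠ 0 := by linarith
  have hr : ∀ b d, ricci G b d y = (n - 2) * P y b d + trG G P y * G y b d := fun b d => by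
    have := h b d
    rw [trace_weylEnd hG hy] at this
    linarith
  have hs : scal G y = (n - 2) * trG G P y + trG G P y * trG G G y := by
    simp only [scal, hr, mul_add, Finset.sum_add_distrib, trG, Finset.mul_sum]
    congr 1 <;>
    exact Finset.sum_congr rfl fun a _ => Finset.sum_congr rfl fun c _ => by ring
  rw [trG_self hG hy] at hs
  ext b d
  simp only [sch, of_apply, schouten, hr, hs]
  field_simp
  ring

lemma smooth_sch (hG : IsMetricOn G O) : SmoothMat (sch G) O := fun i j => hG.smooth_schouten i j

/-- Conformal change of the Schouten tensor. -/
lemma confP_sch (hn : 2 < n) (hG : IsMetricOn G O) (hU : ContDiffOn ℝ ∞ U O) (hy : y ∈ O) :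
    confP G (sch G) U y = sch (fun z => Real.exp (2 * U z) • G z) y := by
  refine eq_sch_of_trace hn (hG.conformal hU) hy fun b d => ?_
  refine (Finset.sum_congr rfl fun a _ => ?_).trans (trace_weylEnd_sch hn hG hy b d)
  rw [weylEnd_conformal hG (smooth_sch hG) hU hy]

lemma tractorConn_gauge (hn : 2 < n) (hG : IsMetricOn G O) (hU : ContDiffOn ℝ ∞ U O) (hy : y ∈ O)
    {V : EuclideanSpace ℝ (Fin n) → Tr n} (hV : DifferentiableAt ℝ V y) (a : Fin n) :
    tractorConn (fun z => Real.exp (2 * U z) • G z) a (fun z => gauge G U z (V z)) y =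
      gauge G U y (tractorConn G a V y) := by
  rw [tractorConn_eq_tconn, tractorConn_eq_tconn,
    ← tconn_congr_right (confP_sch hn hG hU hy), tconn_gauge hG hy hU hV]

lemma tractorCurv_gauge (hn : 2 < n) (hG : IsMetricOn G O) (hU : ContDiffOn ℝ ∞ U O) (hy : y ∈ O)
    (a b : Fin n) (v : Tr n) :
    tractorCurv (fun z => Real.exp (2 * U z) • G z) a b (gauge G U y v) y =
      gauge G U y (tractorCurv G a b v y) := by
  have key : ∀ (a b : Fin n) (w : Tr n), tconn (fun z => Real.exp (2 * U z) • G z)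
      (sch fun z => Real.exp (2 * U z) • G z) a
      (tconn (fun z => Real.exp (2 * U z) • G z) (sch fun z => Real.exp (2 * U z) • G z) b
        fun _ => w) y =
      tconn (fun z => Real.exp (2 * U z) • G z) (confP G (sch G) U) a
      (tconn (fun z => Real.exp (2 * U z) • G z) (confP G (sch G) U) b fun _ => w) y := by
    intro a b w
    rw [← tconn_congr_right (confP_sch hn hG hU hy)]
    refine tconn_congr ?_ a
    filter_upwards [hG.isOpen.mem_nhds hy] with z hz
    exact (tconn_congr_right (confP_sch hn hG hU hz) b _).symm
  rw [tractorCurv_eq_tcurv, tractorCurv_eq_tcurv,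
    ← tcurv_gauge hG (smooth_sch hG) hU hy]
  simp only [tcurv, key]

end Coord

namespace Coord

open Matrix

variable {n : ℕ} {G P : EuclideanSpace ℝ (Fin n) → Matrix (Fin n) (Fin n) ℝ}
  {O : Set (EuclideanSpace ℝ (Fin n))} {y : EuclideanSpace ℝ (Fin n)}
  {U : EuclideanSpace ℝ (Fin n) → ℝ}

lemma differentiableAt_div {f h : EuclideanSpace ℝ (Fin n) → ℝ} (hf : DifferentiableAt ℝ f y)
    (hh : DifferentiableAt ℝ h y) (h0 : h y ≠ 0) : DifferentiableAt ℝ (fun z => f z / h z) y := by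
  simp only [div_eq_mul_inv]
  exact hf.fun_mul (hh.fun_inv h0)

/-! ### Algebra of curvature tensors vanishing on a null hyperplane -/

lemma exists_dual_vector {κ : Fin n → ℝ} (h : κ ≠ 0) : ∃ N : Fin n → ℝ, N ⬝ᵥ κ = 1 := by
  obtain ⟨i, hi⟩ := Function.ne_iff.1 h
  exact ⟨Pi.single i (κ i)⁻¹, by rw [single_dotProduct]; exact inv_mul_cancel₀ hi⟩

/-- A two-form that vanishes on the kernel of `κ` is of the form `κ ∧ r`. -/
lemma eq_wedge_of_vanish {T : Matrix (Fin n) (Fin n) ℝ} (hT : ∀ c d, T c d = -T d c)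
    {κ N : Fin n → ℝ} (hN : N ⬝ᵥ κ = 1)
    (h : ∀ X Y : Fin n → ℝ, X ⬝ᵥ κ = 0 → Y ⬝ᵥ κ = 0 → X ⬝ᵥ T *ᵥ Y = 0) (c d : Fin n) :
    T c d = κ c * (∑ e, N e * T e d) - κ d * ∑ e, N e * T e c := by
  have h1 := h (Pi.single c 1 - κ c • N) (Pi.single d 1 - κ d • N)
    (by rw [sub_dotProduct, smul_dotProduct, hN, single_dotProduct]; simp)
    (by rw [sub_dotProduct, smul_dotProduct, hN, single_dotProduct]; simp)
  have hTN : ∀ c, (T *ᵥ N) c = -∑ e, N e * T e c := fun c => by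
    simp only [mulVec, dotProduct, ← Finset.sum_neg_distrib]
    exact Finset.sum_congr rfl fun e _ => by rw [hT c e]; ring
  have hNN : N ⬝ᵥ T *ᵥ N = 0 := by
    have : N ⬝ᵥ T *ᵥ N = -(N ⬝ᵥ T *ᵥ N) := by
      conv_lhs => rw [dotProduct_mulVec, ← mulVec_transpose, dotProduct_comm]
      have : T.transpose = -T := by ext i j; exact hT j i
      rw [this, neg_mulVec, dotProduct_neg]
    linarith
  have hNd : N ⬝ᵥ T.col d = ∑ e, N e * T e d := rfl
  simp only [mulVec_sub, mulVec_smul, sub_dotProduct, dotProduct_sub, smul_dotProduct,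
    dotProduct_smul, single_dotProduct, hTN, hNN, hNd, smul_eq_mul, mulVec_single_one,
    Matrix.col_apply] at h1
  linarith

/-- The Riemann tensor in terms of the Weyl tensor and the Schouten tensor. -/
lemma mul_curvEnd_eq (hG : IsMetricOn G O) (hy : y ∈ O) (a b : Fin n) :
    G y * curvEnd G a b y = G y * weylEnd G P a b y
      + vecMulVec (G y a) (P y b) - vecMulVec (G y b) (P y a)
      + vecMulVec (P y a) (G y b) - vecMulVec (P y b) (G y a) := by
  ext c d
  simp only [Matrix.add_apply, Matrix.sub_apply, vecMulVec_apply, ← weyl_eq hG hy]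
  rw [weyl, riemann_eq]
  ring

/-! ### pp-waves in coordinates -/

/-- The tractor metric in coordinates. -/
def htr (G : EuclideanSpace ℝ (Fin n) → Matrix (Fin n) (Fin n) ℝ) (y : EuclideanSpace ℝ (Fin n))
    (v w : Tr n) : ℝ :=
  v.2.2 * w.1 + v.1 * w.2.2 + v.2.1 ⬝ᵥ G y *ᵥ w.2.1

/-- On `O`, the metric `G` is a pp-wave with parallel null vector field `K`. -/
structure IsPPOn (G : EuclideanSpace ℝ (Fin n) → Matrix (Fin n) (Fin n) ℝ)
    (K : EuclideanSpace ℝ (Fin n) → Fin n → ℝ) (O : Set (EuclideanSpace ℝ (Fin n))) : Prop where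
  metric : IsMetricOn G O
  smooth : ContDiffOn ℝ ∞ K O
  ne_zero : ∀ z ∈ O, K z ≠ 0
  null : ∀ z ∈ O, K z ⬝ᵥ G z *ᵥ K z = 0
  parallel : ∀ z ∈ O, ∀ a, cov G a K z = 0
  curv : ∀ z ∈ O, ∀ X Y : Fin n → ℝ, X ⬝ᵥ G z *ᵥ K z = 0 → Y ⬝ᵥ G z *ᵥ K z = 0 →
    ∀ c d, ∑ a, ∑ b, riemann G a b c d z * X a * Y b = 0

/-- The null plane spanned by `(0, K, 0)` and `(0, 0, 1)`. -/
def ppPlane (K : EuclideanSpace ℝ (Fin n) → Fin n → ℝ) (z : EuclideanSpace ℝ (Fin n)) :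
    Set (Tr n) := {v | v.1 = 0 ∧ ∃ c : ℝ, v.2.1 = c • K z}

lemma curvEnd_mulVec_of_parallel (hG : IsMetricOn G O) {K : EuclideanSpace ℝ (Fin n) → Fin n → ℝ}
    (hK : ContDiffOn ℝ ∞ K O) (hpar : ∀ z ∈ O, ∀ a, cov G a K z = 0) (hy : y ∈ O) (a b : Fin n) :
    curvEnd G a b y *ᵥ K y = 0 := by
  have hKd := differentiableAt_of_contDiffOn hG.isOpen hK hy
  have hpd : ∀ a, ∀ z ∈ O, (fun c => pd a (fun z => K z c) z) = -(gam G a z *ᵥ K z) := by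
    intro a z hz
    have := hpar z hz a
    rw [cov_eq] at this
    exact eq_neg_of_add_eq_zero_left this
  have h2 : ∀ a b c, pd a (pd b fun z => K z c) y =
      -((pdM a (gam G b) y *ᵥ K y) c - (gam G b y *ᵥ (gam G a y *ᵥ K y)) c) := by
    intro a b c
    have h : (pd b fun z => K z c) =ᶠ[𝓝 y] fun z => -(gam G b z *ᵥ K z) c := by
      filter_upwards [hG.isOpen.mem_nhds hy] with z hz
      exact congrFun (hpd b z hz) c
    rw [pd_congr h, pd_neg]
    congr 1
    simp only [mulVec, dotProduct]
    have hd : ∀ d, DifferentiableAt ℝ (fun z => gam G b z c d) y := fun d =>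
      hG.diff_christoffel hy c b d
    rw [pd_sum _ _ fun d _ => (hd d).fun_mul (differentiableAt_pi.1 hKd d),
      ← Finset.sum_sub_distrib]
    refine Finset.sum_congr rfl fun d _ => ?_
    rw [pd_mul a (hd d) (differentiableAt_pi.1 hKd d)]
    have h3 : pd a (fun z => K z d) y = -(gam G a y *ᵥ K y) d := congrFun (hpd a y hy) d
    rw [h3]
    simp only [pdM, of_apply, mulVec, dotProduct]
    ring
  funext c
  have h4 := pd_comm a b ((contDiffOn_pi.1 hK c).contDiffAt (hG.isOpen.mem_nhds hy))
  rw [h2, h2] at h4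
  rw [curvEnd_eq]
  simp only [add_mulVec, sub_mulVec, ← mulVec_mulVec, Pi.add_apply, Pi.sub_apply, Pi.zero_apply]
  linarith

namespace IsPPOn

variable {K : EuclideanSpace ℝ (Fin n) → Fin n → ℝ} (h : IsPPOn G K O)

include h

lemma form_ne_zero (hy : y ∈ O) : G y *ᵥ K y ≠ 0 := fun h0 => h.ne_zero y hy (by
  have := gradient_eq_of_mulVec h.metric hy h0
  rw [← this, mulVec_zero])

lemma riemann_mulVec (hy : y ∈ O) (a b c : Fin n) : ∑ d, riemann G a b c d y * K y d = 0 := by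
  have h1 := curvEnd_mulVec_of_parallel h.metric h.smooth h.parallel hy a b
  have h2 : (G y * curvEnd G a b y) *ᵥ K y = 0 := by rw [← mulVec_mulVec, h1, mulVec_zero]
  exact congrFun h2 c

lemma curv' (hy : y ∈ O) {X Y : Fin n → ℝ} (hX : X ⬝ᵥ G y *ᵥ K y = 0) (hY : Y ⬝ᵥ G y *ᵥ K y = 0)
    (a b : Fin n) : X ⬝ᵥ (G y * curvEnd G a b y) *ᵥ Y = 0 := by
  rw [← h.curv y hy X Y hX hY a b]
  simp only [mulVec, dotProduct, Finset.mul_sum]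
  refine Finset.sum_congr rfl fun c _ => Finset.sum_congr rfl fun d _ => ?_
  rw [← riemann_eq, h.metric.riemann_pair_symm hy]
  ring

/-- The Ricci tensor of a pp-wave is a multiple of `K ⊗ K`. -/
lemma exists_ricci_eq (hy : y ∈ O) :
    ∃ f : ℝ, ∀ b d, ricci G b d y = f * ((G y *ᵥ K y) b * (G y *ᵥ K y) d) := by
  obtain ⟨N, hN⟩ := exists_dual_vector (h.form_ne_zero hy)
  set κ := G y *ᵥ K y with hκ
  have hK : (G y)⁻¹ *ᵥ κ = K y := gradient_eq_of_mulVec h.metric hy rfl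
  have hR : ∀ a b c d, riemann G a b c d y =
      κ c * (∑ e, N e * riemann G a b e d y) - κ d * ∑ e, N e * riemann G a b e c y :=
    fun a b => eq_wedge_of_vanish (T := G y * curvEnd G a b y)
      (fun c d => h.metric.riemann_skew_right hy a b c d) hN
      fun X Y hX hY => h.curv' hy hX hY a b
  have h0 : ∀ b e d, ∑ a, K y a * riemann G a b e d y = 0 := by
    intro b e d
    rw [← neg_eq_zero, ← h.riemann_mulVec hy e d b, ← Finset.sum_neg_distrib]
    refine Finset.sum_congr rfl fun a _ => ?_
    rw [h.metric.riemann_pair_symm hy a b e d, h.metric.riemann_skew_right hy e d a b]; ring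
  let q : Fin n → ℝ := fun b => ∑ a, ∑ c, (G y)⁻¹ a c * ∑ e, N e * riemann G a b e c y
  have hric : ∀ b d, ricci G b d y = -(κ d * q b) := by
    intro b d
    have h1 : ∑ a, ∑ c, (G y)⁻¹ a c * (κ c * ∑ e, N e * riemann G a b e d y) = 0 := by
      have : ∀ a, ∑ c, (G y)⁻¹ a c * (κ c * ∑ e, N e * riemann G a b e d y) =
          K y a * ∑ e, N e * riemann G a b e d y := fun a => by
        rw [← congrFun hK a]
        simp only [mulVec, dotProduct, Finset.sum_mul, mul_assoc]
      rw [Finset.sum_congr rfl fun a _ => this a]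
      simp only [Finset.mul_sum]
      rw [Finset.sum_comm]
      refine Finset.sum_eq_zero fun e _ => ?_
      have h2 := h0 b e d
      rw [← mul_zero (N e), ← h2, Finset.mul_sum]
      exact Finset.sum_congr rfl fun a _ => by ring
    have h2 : ∑ a, ∑ c, (G y)⁻¹ a c * riemann G a b c d y =
        ∑ a, ∑ c, ((G y)⁻¹ a c * (κ c * ∑ e, N e * riemann G a b e d y) -
          κ d * ((G y)⁻¹ a c * ∑ e, N e * riemann G a b e c y)) :=
      Finset.sum_congr rfl fun a _ => Finset.sum_congr rfl fun c _ => by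
        rw [hR a b c d]; ring
    rw [h.metric.ricci_eq hy, h2]
    simp only [Finset.sum_sub_distrib]
    rw [h1, zero_sub]
    simp only [q, Finset.mul_sum]
  have hq : ∀ b, q b = κ b * (N ⬝ᵥ q) := by
    intro b
    have h1 : ∀ d, κ d * q b = κ b * q d := fun d => by
      have := h.metric.ricci_symm hy b d
      rw [hric, hric] at this
      linarith
    calc q b = (N ⬝ᵥ κ) * q b := by rw [hN, one_mul]
      _ = κ b * (N ⬝ᵥ q) := by
        simp only [dotProduct, Finset.sum_mul, Finset.mul_sum]
        exact Finset.sum_congr rfl fun d _ => by linear_combination N d * h1 d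
  refine ⟨-(N ⬝ᵥ q), fun b d => ?_⟩
  rw [hric, hq b]
  ring

lemma exists_schouten_eq (hy : y ∈ O) :
    ∃ f : ℝ, ∀ b d, schouten G b d y = f * ((G y *ᵥ K y) b * (G y *ᵥ K y) d) := by
  obtain ⟨f, hf⟩ := h.exists_ricci_eq hy
  have hK : (G y)⁻¹ *ᵥ (G y *ᵥ K y) = K y := gradient_eq_of_mulVec h.metric hy rfl
  have hs : scal G y = 0 := by
    have : scal G y = f * ((G y *ᵥ K y) ⬝ᵥ ((G y)⁻¹ *ᵥ (G y *ᵥ K y))) := by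
      simp only [scal, hf]
      generalize G y *ᵥ K y = κ
      simp only [dotProduct, mulVec, Finset.mul_sum]
      exact Finset.sum_congr rfl fun a _ => Finset.sum_congr rfl fun c _ => by ring
    rw [this, hK, dotProduct_comm, h.null y hy, mul_zero]
  refine ⟨1 / ((n : ℝ) - 2) * f, fun b d => ?_⟩
  rw [schouten, hs, hf]
  ring

lemma sch_row (hy : y ∈ O) : ∃ p : Fin n → ℝ, ∀ a, sch G y a = p a • (G y *ᵥ K y) := by
  obtain ⟨f, hf⟩ := h.exists_schouten_eq hy
  refine ⟨fun a => f * (G y *ᵥ K y) a, fun a => ?_⟩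
  funext d
  simp only [sch, of_apply, hf, Pi.smul_apply, smul_eq_mul]
  ring

lemma sch_dot (hy : y ∈ O) {X : Fin n → ℝ} (hX : X ⬝ᵥ G y *ᵥ K y = 0) (a : Fin n) :
    sch G y a ⬝ᵥ X = 0 := by
  obtain ⟨p, hp⟩ := h.sch_row hy
  rw [hp, smul_dotProduct, dotProduct_comm, hX, smul_zero]

/-- The plane `ppPlane K` is parallel for the tractor connection. -/
lemma tractorConn_mem (hy : y ∈ O) {V : EuclideanSpace ℝ (Fin n) → Tr n}
    (hV : DifferentiableAt ℝ V y) (hmem : ∀ᶠ z in 𝓝 y, V z ∈ ppPlane K z) (a : Fin n) :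
    tractorConn G a V y ∈ ppPlane K y := by
  rw [tractorConn_eq_tconn]
  obtain ⟨i, hi⟩ := Function.ne_iff.1 (h.ne_zero y hy)
  have hKd := differentiableAt_of_contDiffOn h.metric.isOpen h.smooth hy
  have hKi : DifferentiableAt ℝ (fun z => K z i) y := differentiableAt_pi.1 hKd i
  have hXi : DifferentiableAt ℝ (fun z => (V z).2.1 i) y := differentiableAt_pi.1 hV.snd.fst i
  have hc : DifferentiableAt ℝ (fun z => (V z).2.1 i / K z i) y := differentiableAt_div hXi hKi hi
  have hX : (fun z => (V z).2.1) =ᶠ[𝓝 y] fun z => ((V z).2.1 i / K z i) • K z := by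
    filter_upwards [hmem, hKi.continuousAt.eventually_ne hi] with z hz hz0
    obtain ⟨c, hc⟩ := hz.2
    rw [hc, Pi.smul_apply, smul_eq_mul, mul_div_cancel_right₀ _ hz0]
  have h1 : (fun z => (V z).1) =ᶠ[𝓝 y] fun _ => 0 := by
    filter_upwards [hmem] with z hz using hz.1
  obtain ⟨p, hp⟩ := h.sch_row hy
  refine ⟨?_, pd a (fun z => (V z).2.1 i / K z i) y + (V y).2.2 * p a, ?_⟩
  · simp only [tconn]
    rw [pd_congr h1, pd_const, zero_sub, neg_eq_zero]
    refine h.sch_dot hy ?_ a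
    rw [hX.eq_of_nhds, smul_dotProduct, h.null y hy, smul_zero]
  · simp only [tconn]
    rw [cov_congr hX, cov_smul hc hKd, h.parallel y hy, h1.eq_of_nhds, hp, mulVec_smul,
      gradient_eq_of_mulVec h.metric hy rfl]
    module

lemma exists_sch_row_smooth (hy : y ∈ O) : ∃ p : Fin n → EuclideanSpace ℝ (Fin n) → ℝ,
    (∀ a, DifferentiableAt ℝ (p a) y) ∧
      ∀ᶠ z in 𝓝 y, ∀ a, sch G z a = p a z • (G z *ᵥ K z) := by
  obtain ⟨i, hi⟩ := Function.ne_iff.1 (h.form_ne_zero hy)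
  have hKd := differentiableAt_of_contDiffOn h.metric.isOpen h.smooth hy
  have hκi : DifferentiableAt ℝ (fun z => (G z *ᵥ K z) i) y :=
    differentiableAt_pi.1 (h.metric.diff_mulVec hy hKd) i
  refine ⟨fun a z => sch G z a i / (G z *ᵥ K z) i, fun a => ?_, ?_⟩
  · exact differentiableAt_div
      (differentiableAt_of_contDiffOn h.metric.isOpen (smooth_sch h.metric a i) hy) hκi hi
  · filter_upwards [hκi.continuousAt.eventually_ne hi, h.metric.isOpen.mem_nhds hy] with z hz hzO a
    obtain ⟨p, hp⟩ := h.sch_row hzO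
    rw [hp, Pi.smul_apply, smul_eq_mul, mul_div_cancel_right₀ _ hz]

lemma covForm_zero (hy : y ∈ O) (a : Fin n) : covForm G a (fun z => G z *ᵥ K z) y = 0 := by
  rw [h.metric.covForm_mulVec hy (differentiableAt_of_contDiffOn h.metric.isOpen h.smooth hy),
    h.parallel y hy, mulVec_zero]

end IsPPOn

lemma tcurv_add (hG : IsMetricOn G O) (hP : SmoothMat P O) (hy : y ∈ O) (a b : Fin n)
    (v w : Tr n) : tcurv G P a b (v + w) y = tcurv G P a b v y + tcurv G P a b w y := by
  have key : ∀ a b, tconn G P a (tconn G P b fun _ => v + w) y =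
      tconn G P a (tconn G P b fun _ => v) y + tconn G P a (tconn G P b fun _ => w) y := by
    intro a b
    have h1 : (tconn G P b fun _ => v + w) =
        fun z => tconn G P b (fun _ => v) z + tconn G P b (fun _ => w) z := by
      funext z
      exact tconn_add (V := fun _ => v) (V' := fun _ => w) (differentiableAt_const v)
        (differentiableAt_const w) b
    rw [h1]
    exact tconn_add (differentiableAt_of_contDiffOn hG.isOpen
      (smooth_tconn hG hP contDiffOn_const b) hy)
      (differentiableAt_of_contDiffOn hG.isOpen (smooth_tconn hG hP contDiffOn_const b) hy) a
  simp only [tcurv, key]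
  abel

namespace IsPPOn

variable {K : EuclideanSpace ℝ (Fin n) → Fin n → ℝ} (h : IsPPOn G K O)

include h

/-- The tractor curvature of a pp-wave vanishes on the orthogonal complement of `ppPlane K`. -/
lemma tractorCurv_eq_zero (hy : y ∈ O) {X Y : Fin n → ℝ} (hX : X ⬝ᵥ G y *ᵥ K y = 0)
    (hY : Y ⬝ᵥ G y *ᵥ K y = 0) (s t : ℝ) (a b : Fin n) :
    htr G y (tractorCurv G a b (0, X, s) y) (0, Y, t) = 0 := by
  have hG := h.metric
  have hKd := differentiableAt_of_contDiffOn hG.isOpen h.smooth hy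
  have hκd := hG.diff_mulVec hy hKd
  obtain ⟨p, hpd, hp⟩ := h.exists_sch_row_smooth hy
  have hpy := hp.self_of_nhds
  -- the part of the curvature on `(0, X, 0)`
  have hX1 : (tcurv G (sch G) a b (0, X, 0) y).1 = 0 := by
    have key : ∀ a b, (tconn G (sch G) a (tconn G (sch G) b fun _ => (0, X, 0)) y).1 =
        -(p b y * ((G y *ᵥ K y) ⬝ᵥ gam G a y *ᵥ X)) - p a y * ((G y *ᵥ K y) ⬝ᵥ gam G b y *ᵥ X) := by
      intro a b
      rw [tconn_const]
      simp only [tconn, zero_smul, add_zero]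
      have h1 : (fun z => -(sch G z b ⬝ᵥ X)) =ᶠ[𝓝 y]
          fun z => -(p b z * ((G z *ᵥ K z) ⬝ᵥ X)) := by
        filter_upwards [hp] with z hz
        rw [hz, smul_dotProduct, smul_eq_mul]
      have hdX : DifferentiableAt ℝ (fun z => (G z *ᵥ K z) ⬝ᵥ X) y := by
        simp only [dotProduct]
        exact DifferentiableAt.fun_sum fun c _ => (differentiableAt_pi.1 hκd c).mul_const _
      have h2 : pd a (fun z => (G z *ᵥ K z) ⬝ᵥ X) y = (G y *ᵥ K y) ⬝ᵥ gam G a y *ᵥ X := by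
        have := pd_dot (G := G) hκd (differentiableAt_const X) a
        rw [this, h.covForm_zero hy, zero_dotProduct, zero_add, cov_const]
      rw [pd_congr h1, pd_neg, pd_mul a (hpd b) hdX, h2, hpy, smul_dotProduct,
        dotProduct_comm _ X, hX, smul_eq_mul]
      ring
    simp only [tcurv, Prod.fst_sub, key]
    ring
  have hX2 : Y ⬝ᵥ G y *ᵥ (tcurv G (sch G) a b (0, X, 0) y).2.1 = 0 := by
    rw [tcurv_mid hG hy, mulVec_mulVec]
    have h1 : G y * weylEnd G (sch G) a b y = G y * curvEnd G a b y
        - vecMulVec (G y a) (sch G y b) + vecMulVec (G y b) (sch G y a)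
        - vecMulVec (sch G y a) (G y b) + vecMulVec (sch G y b) (G y a) := by
      rw [mul_curvEnd_eq (P := sch G) hG hy]
      abel
    rw [h1]
    simp only [add_mulVec, sub_mulVec, vecMulVec_mulVec, dotProduct_add, dotProduct_sub,
      dotProduct_smul, h.sch_dot hy hX, dotProduct_comm Y (sch G y _), h.sch_dot hy hY,
      h.curv' hy hY hX]
    simp
  -- the part of the curvature on `(0, 0, s)`
  have hs : ∀ a b, (tconn G (sch G) a (tconn G (sch G) b fun _ => (0, 0, s)) y).1 = 0 ∧
      Y ⬝ᵥ G y *ᵥ (tconn G (sch G) a (tconn G (sch G) b fun _ => (0, 0, s)) y).2.1 = 0 := by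
    intro a b
    have h1 : (tconn G (sch G) b fun _ => (0, 0, s)) =ᶠ[𝓝 y] fun z => (0, (s * p b z) • K z, 0) := by
      filter_upwards [hp, hG.isOpen.mem_nhds hy] with z hz hzO
      have : (G z)⁻¹ *ᵥ (G z *ᵥ K z) = K z := gradient_eq_of_mulVec hG hzO rfl
      simp [tconn, pd_const, cov_const, hz, mulVec_smul, this, smul_smul]
    rw [tconn_congr h1]
    simp only [tconn, pd_const, zero_smul, add_zero]
    rw [cov_smul ((hpd b).const_mul s) hKd, h.parallel y hy]
    constructor
    · rw [dotProduct_smul, h.sch_dot hy (h.null y hy)]; simp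
    · simp [mulVec_smul, hY]
  have hsplit : ((0, X, s) : Tr n) = (0, X, 0) + (0, 0, s) := by simp
  rw [tractorCurv_eq_tcurv, hsplit, tcurv_add hG (smooth_sch hG) hy, htr]
  simp only [Prod.fst_add, Prod.snd_add, hX1, add_dotProduct, mul_zero, zero_add]
  rw [hG.dot_symm hy _ Y, hG.dot_symm hy _ Y, hX2, tcurv, Prod.fst_sub, Prod.snd_sub,
    Prod.fst_sub, (hs a b).1, (hs b a).1, mulVec_sub, dotProduct_sub, (hs a b).2, (hs b a).2]
  simp

end IsPPOn

end Coord

namespace Coord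

open Matrix

variable {n : ℕ} {G P : EuclideanSpace ℝ (Fin n) → Matrix (Fin n) (Fin n) ℝ}
  {O : Set (EuclideanSpace ℝ (Fin n))} {y : EuclideanSpace ℝ (Fin n)}
  {U : EuclideanSpace ℝ (Fin n) → ℝ}

/-! ### Symmetries of the Weyl tensor -/

section Weyl

variable (hP : ∀ a b, P y a b = P y b a)

lemma weyl_skew_left (a b c d : Fin n) : weyl G P a b c d y = -weyl G P b a c d y := by
  simp only [weyl, riemann_skew_left a b c d]; ring

lemma weyl_skew_right (hG : IsMetricOn G O) (hy : y ∈ O) (a b c d : Fin n) :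
    weyl G P a b c d y = -weyl G P a b d c y := by
  simp only [weyl, hG.riemann_skew_right hy a b c d]; ring

include hP in
lemma weyl_pair_symm (hG : IsMetricOn G O) (hy : y ∈ O) (a b c d : Fin n) :
    weyl G P a b c d y = weyl G P c d a b y := by
  simp only [weyl, hG.riemann_pair_symm hy a b c d, hG.symm y hy c a, hG.symm y hy c b,
    hG.symm y hy d a, hG.symm y hy d b, hP c a, hP c b, hP d a, hP d b]
  ring

include hP in
lemma weyl_bianchi (hG : IsMetricOn G O) (hy : y ∈ O) (a b c d : Fin n) :
    weyl G P a b c d y + weyl G P b d c a y + weyl G P d a c b y = 0 := by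
  have := hG.riemann_bianchi hy a b c d
  simp only [weyl, hG.symm y hy b a, hG.symm y hy d a, hG.symm y hy d b, hP b a, hP d a, hP d b]
  linarith

end Weyl

/-- If the Weyl tensor vanishes on the orthogonal complement of a null vector `K`, and `K` is an
eigenvector of all its endomorphisms, then the eigenvalues are zero. This is where trace-freeness
enters. -/
lemma weyl_eigenvalue_eq_zero (hn : 2 < n) (hG : IsMetricOn G O) (hy : y ∈ O) {K : Fin n → ℝ}
    (hK0 : K ≠ 0)
    (hvan : ∀ X Z : Fin n → ℝ, X ⬝ᵥ G y *ᵥ K = 0 → Z ⬝ᵥ G y *ᵥ K = 0 →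
      ∀ a b, X ⬝ᵥ (G y * weylEnd G (sch G) a b y) *ᵥ Z = 0)
    {lam : Fin n → Fin n → ℝ} (hlam : ∀ a b, weylEnd G (sch G) a b y *ᵥ K = lam a b • K)
    (a b : Fin n) : lam a b = 0 := by
  have hinv : (G y)⁻¹ *ᵥ (G y *ᵥ K) = K := gradient_eq_of_mulVec hG hy rfl
  have hκ0 : G y *ᵥ K ≠ 0 := fun h0 => hK0 (by rw [← hinv, h0, mulVec_zero])
  obtain ⟨N, hN⟩ := exists_dual_vector hκ0
  set κ := G y *ᵥ K with hκ
  set W : Fin n → Fin n → Fin n → Fin n → ℝ := fun a b c d => weyl G (sch G) a b c d y with hW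
  have hS : ∀ a b, sch G y a b = sch G y b a := fun a b => hG.schouten_symm hy a b
  have skl : ∀ a b c d, W a b c d = -W b a c d := fun a b c d => weyl_skew_left a b c d
  have skr : ∀ a b c d, W a b c d = -W a b d c := fun a b c d => weyl_skew_right hG hy a b c d
  have pair : ∀ a b c d, W a b c d = W c d a b := fun a b c d => weyl_pair_symm hS hG hy a b c d
  have bia : ∀ a b c d, W a b c d + W b d c a + W d a c b = 0 := fun a b c d =>
    weyl_bianchi hS hG hy a b c d
  have hWm : ∀ a b c d, W a b c d = (G y * weylEnd G (sch G) a b y) c d := fun a b c d =>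
    weyl_eq hG hy a b c d
  have wedge : ∀ a b c d, W a b c d =
      κ c * (∑ e, N e * W a b e d) - κ d * ∑ e, N e * W a b e c := by
    intro a b c d
    simp only [hWm]
    exact eq_wedge_of_vanish (fun c d => by rw [← hWm, ← hWm]; exact skr a b c d) hN
      (fun X Z hX hZ => hvan X Z hX hZ a b) c d
  have trace : ∀ b d, ∑ a, ∑ c, (G y)⁻¹ a c * W a b c d = 0 := by
    intro b d
    rw [← trace_weylEnd_sch hn hG hy b d]
    refine Finset.sum_congr rfl fun a _ => ?_
    simp only [hWm]
    rw [← Matrix.mul_apply, ← Matrix.mul_assoc, hG.inv_mul hy, Matrix.one_mul]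
  -- contracting `K` and a transversal `N` with the outer slots gives zero
  have hKN : ∀ b d, ∑ e, N e * ∑ a, K a * W a b e d = 0 := by
    intro b d
    have h1 := trace b d
    have h2 : ∑ a, ∑ c, (G y)⁻¹ a c * W a b c d =
        ∑ a, ∑ c, ((G y)⁻¹ a c * κ c * (∑ e, N e * W a b e d) -
          κ d * ((G y)⁻¹ a c * ∑ e, N e * W a b e c)) :=
      Finset.sum_congr rfl fun a _ => Finset.sum_congr rfl fun c _ => by
        rw [wedge a b c d]; ring
    have h3 : ∀ a, ∑ c, (G y)⁻¹ a c * κ c = K a := fun a => congrFun hinv a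
    have h4 : ∑ a, ∑ c, κ d * ((G y)⁻¹ a c * ∑ e, N e * W a b e c) = 0 := by
      have : ∀ a c, κ d * ((G y)⁻¹ a c * ∑ e, N e * W a b e c) =
          ∑ e, -(κ d * N e) * ((G y)⁻¹ a c * W a b c e) := fun a c => by
        rw [Finset.mul_sum, Finset.mul_sum]
        exact Finset.sum_congr rfl fun e _ => by rw [skr a b e c]; ring
      simp only [this]
      have hcomm : ∀ a, ∑ c, ∑ e, -(κ d * N e) * ((G y)⁻¹ a c * W a b c e) =
          ∑ e, ∑ c, -(κ d * N e) * ((G y)⁻¹ a c * W a b c e) := fun a => Finset.sum_comm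
      simp only [hcomm]
      rw [Finset.sum_comm]
      refine Finset.sum_eq_zero fun e _ => ?_
      simp only [← Finset.mul_sum]
      rw [trace b e, mul_zero]
    rw [h2] at h1
    simp only [Finset.sum_sub_distrib] at h1
    rw [h4, sub_zero] at h1
    simp only [← Finset.sum_mul, h3] at h1
    rw [← h1]
    simp only [Finset.mul_sum]
    rw [Finset.sum_comm]
    exact Finset.sum_congr rfl fun a _ => Finset.sum_congr rfl fun e _ => by ring
  have h5 : ∀ c, ∑ d, W a b c d * K d = lam a b * κ c := by
    intro c
    have : (G y * weylEnd G (sch G) a b y) *ᵥ K = lam a b • κ := by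
      rw [← mulVec_mulVec, hlam, mulVec_smul]
    have h6 := congrFun this c
    simp only [mulVec, dotProduct, ← hWm] at h6
    exact h6
  have h7 : lam a b = ∑ c, N c * ∑ d, W a b c d * K d := by
    simp only [h5]
    calc lam a b = lam a b * (N ⬝ᵥ κ) := by rw [hN, mul_one]
      _ = _ := by
        simp only [dotProduct, Finset.mul_sum]
        exact Finset.sum_congr rfl fun c _ => by ring
  have h8 : ∀ c d, W a b c d = W d b c a - W d a c b := by
    intro c d
    linarith [bia a b c d, skl b d c a]
  rw [h7]
  have h9 : ∑ c, N c * ∑ d, W a b c d * K d =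
      (∑ c, N c * ∑ d, K d * W d b c a) - ∑ c, N c * ∑ d, K d * W d a c b := by
    rw [← Finset.sum_sub_distrib]
    refine Finset.sum_congr rfl fun c _ => ?_
    rw [← mul_sub, ← Finset.sum_sub_distrib]
    congr 1
    exact Finset.sum_congr rfl fun d _ => by rw [h8 c d]; ring
  rw [h9, hKN, hKN, sub_zero]

/-! ### One-forms given by their components -/

/-- The one-form with components `f`. -/
def oneForm (f : Fin n → EuclideanSpace ℝ (Fin n) → ℝ) (z : EuclideanSpace ℝ (Fin n)) :
    EuclideanSpace ℝ (Fin n) →L[ℝ] ℝ :=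
  ∑ a, f a z • (EuclideanSpace.proj a : EuclideanSpace ℝ (Fin n) →L[ℝ] ℝ)

lemma oneForm_apply (f : Fin n → EuclideanSpace ℝ (Fin n) → ℝ) (z v : EuclideanSpace ℝ (Fin n)) :
    oneForm f z v = ∑ a, f a z * v a := by
  simp [oneForm]

lemma oneForm_single (f : Fin n → EuclideanSpace ℝ (Fin n) → ℝ) (z : EuclideanSpace ℝ (Fin n))
    (a : Fin n) : oneForm f z (EuclideanSpace.single a 1) = f a z := by
  simp [oneForm_apply]

lemma smooth_oneForm {f : Fin n → EuclideanSpace ℝ (Fin n) → ℝ}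
    (hf : ∀ a, ContDiffOn ℝ ∞ (f a) O) : ContDiffOn ℝ ∞ (oneForm f) O :=
  ContDiffOn.sum fun a _ => (hf a).smul contDiffOn_const

lemma fderiv_eq_sum_pd {f : EuclideanSpace ℝ (Fin n) → ℝ} (v : EuclideanSpace ℝ (Fin n)) :
    fderiv ℝ f y v = ∑ b, v b * pd b f y := by
  conv_lhs => rw [← (EuclideanSpace.basisFun (Fin n) ℝ).sum_repr v]
  simp [pd]

lemma fderiv_oneForm (hO : IsOpen O) {f : Fin n → EuclideanSpace ℝ (Fin n) → ℝ}
    (hf : ∀ a, ContDiffOn ℝ ∞ (f a) O) (hy : y ∈ O) (u v : EuclideanSpace ℝ (Fin n)) :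
    fderiv ℝ (oneForm f) y u v = ∑ a, ∑ b, u b * v a * pd b (f a) y := by
  have h : HasFDerivAt (oneForm f) (∑ a, (fderiv ℝ (f a) y).smulRight
      (EuclideanSpace.proj a : EuclideanSpace ℝ (Fin n) →L[ℝ] ℝ)) y :=
    HasFDerivAt.fun_sum fun a _ =>
      (differentiableAt_of_contDiffOn hO (hf a) hy).hasFDerivAt.smul_const
        (EuclideanSpace.proj a : EuclideanSpace ℝ (Fin n) →L[ℝ] ℝ)
  rw [h.fderiv]
  simp only [ContinuousLinearMap.smulRight_apply,
    _root_.sum_apply, _root_.smul_apply, smul_eq_mul, PiLp.proj_apply, fderiv_eq_sum_pd,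
    Finset.sum_mul]
  exact Finset.sum_congr rfl fun a _ => Finset.sum_congr rfl fun b _ => by ring

lemma fderiv_oneForm_sub (hO : IsOpen O) {f : Fin n → EuclideanSpace ℝ (Fin n) → ℝ}
    (hf : ∀ a, ContDiffOn ℝ ∞ (f a) O) (hy : y ∈ O) (u v : EuclideanSpace ℝ (Fin n)) :
    fderiv ℝ (oneForm f) y u v - fderiv ℝ (oneForm f) y v u =
      ∑ a, ∑ b, u b * v a * (pd b (f a) y - pd a (f b) y) := by
  rw [fderiv_oneForm hO hf hy, fderiv_oneForm hO hf hy]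
  conv_lhs => rw [Finset.sum_comm (f := fun a b => v b * u a * pd b (f a) y)]
  rw [← Finset.sum_sub_distrib]
  refine Finset.sum_congr rfl fun a _ => ?_
  rw [← Finset.sum_sub_distrib]
  exact Finset.sum_congr rfl fun b _ => by ring

/-- The Poincaré lemma for one-forms on a convex open set, in components. -/
lemma exists_potential (hO : IsOpen O) (hc : Convex ℝ O)
    {f : Fin n → EuclideanSpace ℝ (Fin n) → ℝ} (hf : ∀ a, ContDiffOn ℝ ∞ (f a) O)
    (hcl : ∀ z ∈ O, ∀ a b, pd a (f b) z = pd b (f a) z) :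
    ∃ ψ : EuclideanSpace ℝ (Fin n) → ℝ, ContDiffOn ℝ ∞ ψ O ∧ ∀ z ∈ O, ∀ a, pd a ψ z = f a z := by
  obtain ⟨ψ, hψ⟩ := hc.exists_forall_hasFDerivAt_of_fderiv_symmetric hO
    ((smooth_oneForm hf).differentiableOn (by simp)) (fun z hz u v => by
      rw [← sub_eq_zero, fderiv_oneForm_sub hO hf hz]
      refine Finset.sum_eq_zero fun a _ => Finset.sum_eq_zero fun b _ => ?_
      rw [hcl z hz a b, sub_self, mul_zero])
  refine ⟨ψ, ?_, fun z hz a => ?_⟩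
  · refine (contDiffOn_infty_iff_fderiv_of_isOpen hO).2
      ⟨fun z hz => (hψ z hz).differentiableAt.differentiableWithinAt, ?_⟩
    exact (smooth_oneForm hf).congr fun z hz => (hψ z hz).fderiv
  · rw [pd, (hψ z hz).fderiv, oneForm_single]

/-- The Frobenius theorem for hyperplane fields, in components. -/
lemma exists_integral_function (hO : IsOpen O) {κ θ : Fin n → EuclideanSpace ℝ (Fin n) → ℝ}
    (hκ : ∀ a, ContDiffOn ℝ ∞ (κ a) O) (hθ : ∀ a, ContDiffOn ℝ ∞ (θ a) O)
    (hint : ∀ z ∈ O, ∀ a b, pd a (κ b) z - pd b (κ a) z = θ a z * κ b z - θ b z * κ a z)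
    (hy : y ∈ O) (hne : ∃ a, κ a y ≠ 0) :
    ∃ V : Set (EuclideanSpace ℝ (Fin n)), IsOpen V ∧ y ∈ V ∧ V ⊆ O ∧
      ∃ u φ : EuclideanSpace ℝ (Fin n) → ℝ, ContDiffOn ℝ ∞ u V ∧ ContDiffOn ℝ ∞ φ V ∧
        ∀ z ∈ V, φ z ≠ 0 ∧ ∀ a, κ a z = φ z * pd a u z := by
  obtain ⟨a, ha⟩ := hne
  obtain ⟨V, hV, hyV, hVO, u, φ, hu, hφ, h⟩ := exists_eq_smul_fderiv_of_integrable hO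
    (smooth_oneForm hκ) (smooth_oneForm hθ).continuousOn (fun z hz u v => by
      rw [fderiv_oneForm_sub hO hκ hz]
      simp only [oneForm_apply, Finset.sum_mul_sum]
      conv_rhs => rw [Finset.sum_comm]
      rw [← Finset.sum_sub_distrib]
      refine Finset.sum_congr rfl fun a _ => ?_
      rw [← Finset.sum_sub_distrib]
      refine Finset.sum_congr rfl fun b _ => ?_
      rw [hint z hz b a]; ring) hy
    (fun h0 => ha (by rw [← oneForm_single κ y a, h0]; rfl))
  refine ⟨V, hV, hyV, hVO, u, φ, hu, hφ, fun z hz => ⟨(h z hz).1, fun b => ?_⟩⟩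
  rw [← oneForm_single κ z b, (h z hz).2]
  rfl

end Coord

namespace Coord

open Matrix

variable {n : ℕ} {G P : EuclideanSpace ℝ (Fin n) → Matrix (Fin n) (Fin n) ℝ}
  {O : Set (EuclideanSpace ℝ (Fin n))} {y : EuclideanSpace ℝ (Fin n)}
  {U : EuclideanSpace ℝ (Fin n) → ℝ}

/-! ### Frames of parallel null planes -/

lemma IsMetricOn.smooth_mulVec (hG : IsMetricOn G O) {X : EuclideanSpace ℝ (Fin n) → Fin n → ℝ}
    (hX : ContDiffOn ℝ ∞ X O) : ContDiffOn ℝ ∞ (fun z => G z *ᵥ X z) O := by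
  refine contDiffOn_pi.2 fun b => ?_
  simp only [mulVec, dotProduct]
  exact ContDiffOn.sum fun c _ => (hG.smooth b c).mul (contDiffOn_pi.1 hX c)

/-- A frame `(V, W)` of a parallel, totally null plane bundle of tractors, whose bottom components
are `0` and `1`, such that the tractor curvature vanishes on the orthogonal complement. The
functions `c a` are the coefficients of `V` in the covariant derivatives of `V`; the other
coefficient is forced by the bottom component. -/
structure IsPlaneFrame (G : EuclideanSpace ℝ (Fin n) → Matrix (Fin n) (Fin n) ℝ)
    (V W : EuclideanSpace ℝ (Fin n) → Tr n) (c : Fin n → EuclideanSpace ℝ (Fin n) → ℝ)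
    (O : Set (EuclideanSpace ℝ (Fin n))) : Prop where
  metric : IsMetricOn G O
  smooth_fst : ContDiffOn ℝ ∞ V O
  smooth_snd : ContDiffOn ℝ ∞ W O
  smooth_coeff : ∀ a, ContDiffOn ℝ ∞ (c a) O
  bot_fst : ∀ z ∈ O, (V z).2.2 = 0
  bot_snd : ∀ z ∈ O, (W z).2.2 = 1
  ne_zero : ∀ z ∈ O, (V z).2.1 ≠ 0
  null_fst : ∀ z ∈ O, htr G z (V z) (V z) = 0
  null_mix : ∀ z ∈ O, htr G z (V z) (W z) = 0
  null_snd : ∀ z ∈ O, htr G z (W z) (W z) = 0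
  conn_fst : ∀ z ∈ O, ∀ a, tractorConn G a V z = c a z • V z - (G z *ᵥ (V z).2.1) a • W z
  conn_snd : ∀ z ∈ O, ∀ a, ∃ d : ℝ,
    tractorConn G a W z = d • V z - (G z *ᵥ (W z).2.1) a • W z
  curv : ∀ z ∈ O, ∀ v w, htr G z v (V z) = 0 → htr G z v (W z) = 0 → htr G z w (V z) = 0 →
    htr G z w (W z) = 0 → ∀ a b, htr G z (tractorCurv G a b v z) w = 0

lemma bot_tractorConn (a : Fin n) (V : EuclideanSpace ℝ (Fin n) → Tr n) {r : ℝ}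
    (hr : (fun z => (V z).2.2) =ᶠ[𝓝 y] fun _ => r) :
    (tractorConn G a V y).2.2 = -(G y *ᵥ (V y).2.1) a := by
  rw [tractorConn_eq_tconn]
  simp only [tconn]
  rw [pd_congr hr, pd_const, zero_sub]

namespace IsPlaneFrame

variable {V W : EuclideanSpace ℝ (Fin n) → Tr n} {c : Fin n → EuclideanSpace ℝ (Fin n) → ℝ}
  (h : IsPlaneFrame G V W c O)

include h

lemma mono {O' : Set (EuclideanSpace ℝ (Fin n))} (hO' : IsOpen O') (hs : O' ⊆ O) :
    IsPlaneFrame G V W c O' where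
  metric := h.metric.mono hs hO'
  smooth_fst := h.smooth_fst.mono hs
  smooth_snd := h.smooth_snd.mono hs
  smooth_coeff a := (h.smooth_coeff a).mono hs
  bot_fst z hz := h.bot_fst z (hs hz)
  bot_snd z hz := h.bot_snd z (hs hz)
  ne_zero z hz := h.ne_zero z (hs hz)
  null_fst z hz := h.null_fst z (hs hz)
  null_mix z hz := h.null_mix z (hs hz)
  null_snd z hz := h.null_snd z (hs hz)
  conn_fst z hz := h.conn_fst z (hs hz)
  conn_snd z hz := h.conn_snd z (hs hz)
  curv z hz := h.curv z (hs hz)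

lemma diff_fst (hy : y ∈ O) : DifferentiableAt ℝ V y :=
  differentiableAt_of_contDiffOn h.metric.isOpen h.smooth_fst hy

lemma diff_snd (hy : y ∈ O) : DifferentiableAt ℝ W y :=
  differentiableAt_of_contDiffOn h.metric.isOpen h.smooth_snd hy

lemma null (hy : y ∈ O) : (V y).2.1 ⬝ᵥ G y *ᵥ (V y).2.1 = 0 := by
  have := h.null_fst y hy
  simpa [htr, h.bot_fst y hy] using this

lemma top_fst (hy : y ∈ O) : (V y).1 = -((V y).2.1 ⬝ᵥ G y *ᵥ (W y).2.1) := by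
  have := h.null_mix y hy
  simp only [htr, h.bot_fst y hy, h.bot_snd y hy] at this
  linarith

lemma top_snd (hy : y ∈ O) : (W y).1 = -((W y).2.1 ⬝ᵥ G y *ᵥ (W y).2.1) / 2 := by
  have := h.null_snd y hy
  simp only [htr, h.bot_snd y hy] at this
  linarith

lemma cov_fst (hy : y ∈ O) (a : Fin n) : cov G a (fun z => (V z).2.1) y =
    c a y • (V y).2.1 - (G y *ᵥ (V y).2.1) a • (W y).2.1 - (V y).1 • Pi.single a 1 := by
  have := congrArg (fun v : Tr n => v.2.1) (h.conn_fst y hy a)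
  rw [tractorConn_eq_tconn] at this
  simp only [tconn, h.bot_fst y hy, zero_smul, add_zero, Prod.snd_sub, Prod.fst_sub, Prod.smul_snd,
    Prod.smul_fst] at this
  rw [← this]; abel

lemma exists_cov_snd (hy : y ∈ O) (a : Fin n) : ∃ d : ℝ,
    tractorConn G a W y = d • V y - (G y *ᵥ (W y).2.1) a • W y ∧
    cov G a (fun z => (W z).2.1) y = d • (V y).2.1 - (G y *ᵥ (W y).2.1) a • (W y).2.1
      - (W y).1 • Pi.single a 1 - (G y)⁻¹ *ᵥ sch G y a := by
  obtain ⟨d, hd⟩ := h.conn_snd y hy a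
  refine ⟨d, hd, ?_⟩
  have := congrArg (fun v : Tr n => v.2.1) hd
  rw [tractorConn_eq_tconn] at this
  simp only [tconn, h.bot_snd y hy, one_smul, Prod.snd_sub, Prod.fst_sub, Prod.smul_snd,
    Prod.smul_fst] at this
  rw [← this]; abel

omit h in
/-- The exterior derivative of the one-form dual to `X`, in terms of the covariant derivative. -/
lemma _root_.Coord.ext_deriv_lower (hG : IsMetricOn G O) (hy : y ∈ O)
    {X : EuclideanSpace ℝ (Fin n) → Fin n → ℝ} (hX : DifferentiableAt ℝ X y) (a b : Fin n) :
    pd a (fun z => (G z *ᵥ X z) b) y - pd b (fun z => (G z *ᵥ X z) a) y =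
      (G y *ᵥ cov G a X y) b - (G y *ᵥ cov G b X y) a := by
  rw [← hG.covForm_mulVec hy hX, ← hG.covForm_mulVec hy hX]
  simp only [covForm, hG.christoffel_symm hy _ b a]
  ring

lemma ext_deriv_fst (hy : y ∈ O) (a b : Fin n) :
    pd a (fun z => (G z *ᵥ (V z).2.1) b) y - pd b (fun z => (G z *ᵥ (V z).2.1) a) y =
      (c a y + (G y *ᵥ (W y).2.1) a) * (G y *ᵥ (V y).2.1) b
        - (c b y + (G y *ᵥ (W y).2.1) b) * (G y *ᵥ (V y).2.1) a := by
  rw [ext_deriv_lower h.metric hy (h.diff_fst hy).snd.fst, h.cov_fst hy, h.cov_fst hy]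
  simp only [mulVec_sub, mulVec_smul, Pi.sub_apply, Pi.smul_apply, smul_eq_mul,
    mulVec_single_one, Matrix.col_apply, h.metric.symm y hy a b]
  ring

/-- The Weyl tensor vanishes on the orthogonal complement of the middle component of `V`. -/
lemma weyl_vanish (hy : y ∈ O) {X Z : Fin n → ℝ} (hX : X ⬝ᵥ G y *ᵥ (V y).2.1 = 0)
    (hZ : Z ⬝ᵥ G y *ᵥ (V y).2.1 = 0) (a b : Fin n) :
    X ⬝ᵥ (G y * weylEnd G (sch G) a b y) *ᵥ Z = 0 := by
  have hG := h.metric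
  have key : ∀ X : Fin n → ℝ, X ⬝ᵥ G y *ᵥ (V y).2.1 = 0 →
      htr G y (-(X ⬝ᵥ G y *ᵥ (W y).2.1), X, 0) (V y) = 0 ∧
      htr G y (-(X ⬝ᵥ G y *ᵥ (W y).2.1), X, 0) (W y) = 0 := fun X hX => by
    simp [htr, h.bot_fst y hy, h.bot_snd y hy, hX]
  have h1 := h.curv y hy _ _ (key Z hZ).1 (key Z hZ).2 (key X hX).1 (key X hX).2 a b
  rw [tractorCurv_eq_tcurv, htr, tcurv_bottom hG hy, tcurv_mid hG hy] at h1
  rw [← mulVec_mulVec, hG.dot_symm hy]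
  simpa using h1

/-- The two coefficients of the connection on the plane bundle satisfy `dc = dη` for the one-form
`η` dual to the middle component of `W`. This is where the curvature hypothesis enters. -/
lemma ext_deriv_coeff (hn : 2 < n) (hy : y ∈ O) (a b : Fin n) :
    pd a (c b) y - pd b (c a) y =
      pd a (fun z => (G z *ᵥ (W z).2.1) b) y - pd b (fun z => (G z *ᵥ (W z).2.1) a) y := by
  have hG := h.metric
  have hVd := h.diff_fst hy
  have hWd := h.diff_snd hy
  have hcd := fun a => differentiableAt_of_contDiffOn hG.isOpen (h.smooth_coeff a) hy
  have hκd := hG.diff_mulVec hy hVd.snd.fst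
  choose d hdW hdc using h.exists_cov_snd hy
  have hsecond : ∀ a b, tconn G (sch G) a (tconn G (sch G) b V) y =
      pd a (c b) y • V y + c b y • (c a y • V y - (G y *ᵥ (V y).2.1) a • W y)
      - (pd a (fun z => (G z *ᵥ (V z).2.1) b) y • W y
        + (G y *ᵥ (V y).2.1) b • (d a • V y - (G y *ᵥ (W y).2.1) a • W y)) := by
    intro a b
    have h1 : tconn G (sch G) b V =ᶠ[𝓝 y] fun z =>
        c b z • V z + (-(G z *ᵥ (V z).2.1) b) • W z := by
      filter_upwards [hG.isOpen.mem_nhds hy] with z hz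
      rw [← tractorConn_eq_tconn, h.conn_fst z hz b]; module
    have h2 : DifferentiableAt ℝ (fun z => -(G z *ᵥ (V z).2.1) b) y :=
      (differentiableAt_pi.1 hκd b).fun_neg
    rw [tconn_congr h1, tconn_add ((hcd b).fun_smul hVd) (h2.fun_smul hWd), tconn_smul (hcd b) hVd,
      tconn_smul h2 hWd, ← tractorConn_eq_tconn, h.conn_fst y hy, hdW, pd_neg]
    module
  -- the curvature endomorphisms have `V` as an eigenvector
  have heig : ∀ a b, tcurv G (sch G) a b (V y) y = (pd a (c b) y - pd b (c a) y
      - (pd a (fun z => (G z *ᵥ (W z).2.1) b) y - pd b (fun z => (G z *ᵥ (W z).2.1) a) y)) •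
        V y := by
    intro a b
    have h1 := h.ext_deriv_fst hy a b
    have h2 : pd a (fun z => (G z *ᵥ (W z).2.1) b) y - pd b (fun z => (G z *ᵥ (W z).2.1) a) y =
        d a * (G y *ᵥ (V y).2.1) b - d b * (G y *ᵥ (V y).2.1) a := by
      have hinv : ∀ v, G y *ᵥ ((G y)⁻¹ *ᵥ v) = v := fun v => by
        rw [mulVec_mulVec, hG.mul_inv hy, one_mulVec]
      rw [ext_deriv_lower hG hy hWd.snd.fst, hdc, hdc]
      simp only [mulVec_sub, mulVec_smul, Pi.sub_apply, Pi.smul_apply, smul_eq_mul,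
        mulVec_single_one, Matrix.col_apply, hG.symm y hy a b, hinv,
        show sch G y b a = sch G y a b from hG.schouten_symm hy b a]
      ring
    rw [← tconn_comm hG (smooth_sch hG) hy h.smooth_fst, hsecond, hsecond, h2]
    have h3 : pd a (fun z => (G z *ᵥ (V z).2.1) b) y = pd b (fun z => (G z *ᵥ (V z).2.1) a) y +
      ((c a y + (G y *ᵥ (W y).2.1) a) * (G y *ᵥ (V y).2.1) b
        - (c b y + (G y *ᵥ (W y).2.1) b) * (G y *ᵥ (V y).2.1) a) := by linarith
    rw [h3]
    module
  have hlam : ∀ a b, weylEnd G (sch G) a b y *ᵥ (V y).2.1 = (pd a (c b) y - pd b (c a) y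
      - (pd a (fun z => (G z *ᵥ (W z).2.1) b) y - pd b (fun z => (G z *ᵥ (W z).2.1) a) y)) •
        (V y).2.1 := by
    intro a b
    have hV : V y = ((V y).1, (V y).2.1, 0) := by
      rw [← h.bot_fst y hy]
    have h1 := congrArg (fun v : Tr n => v.2.1) (heig a b)
    simp only [Prod.smul_snd, Prod.smul_fst] at h1
    rw [← h1]
    conv_rhs => rw [hV]
    rw [tcurv_mid hG hy]
  have := weyl_eigenvalue_eq_zero hn hG hy (h.ne_zero y hy)
    (fun X Z hX hZ => h.weyl_vanish hy hX hZ) hlam a b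
  linarith

/-- A conformal factor whose gradient is `-Y + m K`, where `K` and `Y` are the middle components of
`V` and `W`, turns the metric into a pp-wave. -/
lemma isPPOn (hn : 2 < n) {ψ m : EuclideanSpace ℝ (Fin n) → ℝ} (hU : ContDiffOn ℝ ∞ U O)
    (hψ : ContDiffOn ℝ ∞ ψ O) (hm : ContDiffOn ℝ ∞ m O)
    (hdU : ∀ z ∈ O, diffl U z = m z • (G z *ᵥ (V z).2.1) - G z *ᵥ (W z).2.1)
    (hdψ : ∀ z ∈ O, ∀ a, pd a ψ z = c a z - (G z *ᵥ (W z).2.1) a) :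
    IsPPOn (fun z => Real.exp (2 * U z) • G z) (fun z => Real.exp (-ψ z) • (V z).2.1) O := by
  have hG := h.metric
  have hĜ := hG.conformal hU
  have hgrad : ∀ z ∈ O, gradient G U z = m z • (V z).2.1 - (W z).2.1 := fun z hz =>
    gradient_eq_of_mulVec hG hz (by rw [hdU z hz, mulVec_sub, mulVec_smul])
  have hdK : ∀ z ∈ O, diffl U z ⬝ᵥ (V z).2.1 = (V z).1 := fun z hz => by
    rw [hdU z hz, h.top_fst hz, sub_dotProduct, smul_dotProduct, dotProduct_comm,
      h.null hz, dotProduct_comm (G z *ᵥ (W z).2.1)]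
    simp
  have hcovK : ∀ z ∈ O, ∀ a, cov (fun z => Real.exp (2 * U z) • G z) a (fun z => (V z).2.1) z =
      pd a ψ z • (V z).2.1 := by
    intro z hz a
    have h1 : pd a U z = m z * (G z *ᵥ (V z).2.1) a - (G z *ᵥ (W z).2.1) a := by
      have := congrFun (hdU z hz) a
      simpa [diffl] using this
    rw [hG.conformal_cov hz hU, h.cov_fst hz, hgrad z hz, hdK z hz, h1, hdψ z hz]
    module
  have hKd : ∀ z ∈ O, DifferentiableAt ℝ (fun z => (V z).2.1) z := fun z hz =>
    (h.diff_fst hz).snd.fst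
  have hψd : ∀ z ∈ O, DifferentiableAt ℝ (fun z => Real.exp (-ψ z)) z := fun z hz =>
    (differentiableAt_of_contDiffOn hG.isOpen hψ hz).fun_neg.exp
  -- in the gauge of `U` the second section of the frame is `exp(-U) (0, m K, exp (2 U))`
  have hgW : ∀ z ∈ O, gauge G U z (W z) =
      (0, (Real.exp (-U z) * m z) • (V z).2.1, Real.exp (U z)) := by
    intro z hz
    refine Prod.ext ?_ (Prod.ext ?_ ?_)
    · simp only [gauge, h.bot_snd z hz, hgrad z hz, dotProduct_sub, dotProduct_smul, hdK z hz]
      rw [hdU z hz, h.top_snd hz, h.top_fst hz]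
      simp only [sub_dotProduct, smul_dotProduct, dotProduct_comm (G z *ᵥ _) (W z).2.1,
        smul_eq_mul]
      rw [hG.dot_symm hz (W z).2.1 (V z).2.1]
      ring
    · simp only [gauge, h.bot_snd z hz, hgrad z hz]
      module
    · simp only [gauge, h.bot_snd z hz, mul_one]
  -- the middle component of its covariant derivative shows that every row of the Schouten tensor of
  -- the new metric is a multiple of the form dual to `K`
  have hrow : ∀ z ∈ O, ∀ a, ∃ p : ℝ, sch (fun z => Real.exp (2 * U z) • G z) z a =
      p • ((Real.exp (2 * U z) • G z) *ᵥ (V z).2.1) := by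
    intro z hz a
    obtain ⟨d, hd⟩ := h.conn_snd z hz a
    have h1 := tractorConn_gauge hn hG hU hz (h.diff_snd hz) a
    have h2 : (fun z => gauge G U z (W z)) =ᶠ[𝓝 z] fun z =>
        (0, (Real.exp (-U z) * m z) • (V z).2.1, Real.exp (U z)) := by
      filter_upwards [hG.isOpen.mem_nhds hz] with x hx using hgW x hx
    have hf : DifferentiableAt ℝ (fun z => Real.exp (-U z) * m z) z :=
      (differentiableAt_of_contDiffOn hG.isOpen hU hz).fun_neg.exp.fun_mul
        (differentiableAt_of_contDiffOn hG.isOpen hm hz)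
    rw [tractorConn_eq_tconn, tconn_congr h2, hd] at h1
    have h3 := congrArg (fun v : Tr n => v.2.1) h1
    simp only [tconn, gauge, zero_smul, add_zero, Prod.snd_sub, Prod.fst_sub, Prod.smul_snd,
      Prod.smul_fst, h.bot_fst z hz, h.bot_snd z hz, hgrad z hz] at h3
    rw [cov_smul hf (hKd z hz), hcovK z hz] at h3
    have h4 : Real.exp (U z) • ((Real.exp (2 * U z) • G z)⁻¹ *ᵥ
        sch (fun z => Real.exp (2 * U z) • G z) z a) =
        (Real.exp (-U z) * (d - (G z *ᵥ (W z).2.1) a * m z) -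
          pd a (fun z => Real.exp (-U z) * m z) z -
          Real.exp (-U z) * m z * pd a ψ z) • (V z).2.1 := by
      rw [← eq_sub_iff_add_eq'] at h3
      rw [h3]
      simp only [smul_eq_mul]
      module
    refine ⟨Real.exp (-U z) * (Real.exp (-U z) * (d - (G z *ᵥ (W z).2.1) a * m z) -
          pd a (fun z => Real.exp (-U z) * m z) z -
          Real.exp (-U z) * m z * pd a ψ z), ?_⟩
    rw [← smul_smul, ← mulVec_smul, ← mulVec_smul, ← h4, smul_smul, ← Real.exp_add, neg_add_cancel,
      Real.exp_zero, one_smul, mulVec_mulVec, hĜ.mul_inv hz, one_mulVec]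
  refine ⟨hĜ, hψ.neg.exp.smul h.smooth_fst.snd.fst, fun z hz => smul_ne_zero (Real.exp_ne_zero _)
    (h.ne_zero z hz), fun z hz => ?_, fun z hz a => ?_, fun z hz X Z hX hZ e f => ?_⟩
  · simp [mulVec_smul, smul_mulVec, h.null hz]
  · rw [cov_smul (hψd z hz) (hKd z hz), hcovK z hz,
      pd_exp a (differentiableAt_of_contDiffOn hG.isOpen hψ hz).fun_neg, pd_neg]
    module
  · have hX' : X ⬝ᵥ G z *ᵥ (V z).2.1 = 0 := by
      simpa [mulVec_smul, smul_mulVec, Real.exp_ne_zero] using hX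
    have hZ' : Z ⬝ᵥ G z *ᵥ (V z).2.1 = 0 := by
      simpa [mulVec_smul, smul_mulVec, Real.exp_ne_zero] using hZ
    have hsch : ∀ e, X ⬝ᵥ sch (fun z => Real.exp (2 * U z) • G z) z e = 0 ∧
        sch (fun z => Real.exp (2 * U z) • G z) z e ⬝ᵥ Z = 0 := fun e => by
      obtain ⟨p, hp⟩ := hrow z hz e
      rw [hp, smul_mulVec]
      simp [hX', hZ', dotProduct_comm _ Z]
    -- the Riemann tensor is the Weyl tensor plus Schouten terms, both of which vanish on `X`, `Z`
    have hW : weylEnd (fun z => Real.exp (2 * U z) • G z)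
        (sch fun z => Real.exp (2 * U z) • G z) e f z = weylEnd G (sch G) e f z := by
      rw [← weylEnd_conformal hG (smooth_sch hG) hU hz e f]
      simp only [weylEnd, confP_sch hn hG hU hz]
    have h1 : X ⬝ᵥ ((Real.exp (2 * U z) • G z) *
        curvEnd (fun z => Real.exp (2 * U z) • G z) e f z) *ᵥ Z = 0 := by
      rw [mul_curvEnd_eq (G := fun z => Real.exp (2 * U z) • G z)
        (P := sch fun z => Real.exp (2 * U z) • G z) hĜ hz e f, hW, smul_mul_assoc]
      simp only [add_mulVec, sub_mulVec, vecMulVec_mulVec, dotProduct_add, dotProduct_sub,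
        dotProduct_smul, smul_mulVec, h.weyl_vanish hz hX' hZ', (hsch _).1, (hsch _).2]
      simp
    rw [← h1]
    simp only [mulVec, dotProduct, Finset.mul_sum]
    refine Finset.sum_congr rfl fun a _ => Finset.sum_congr rfl fun b _ => ?_
    rw [hĜ.riemann_pair_symm hz]
    rw [← riemann_eq (G := fun z => Real.exp (2 * U z) • G z)]
    ring

/-- Around every point there are a conformal factor and a rescaling of the null vector field that
produce a pp-wave. -/
lemma exists_isPPOn (hn : 2 < n) (hy : y ∈ O) :
    ∃ (O' : Set (EuclideanSpace ℝ (Fin n))) (U ψ : EuclideanSpace ℝ (Fin n) → ℝ),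
      IsOpen O' ∧ y ∈ O' ∧ O' ⊆ O ∧ ContDiffOn ℝ ∞ U O' ∧
      IsPPOn (fun z => Real.exp (2 * U z) • G z) (fun z => Real.exp (-ψ z) • (V z).2.1) O' := by
  have hG := h.metric
  obtain ⟨ε, hε, hball⟩ := Metric.isOpen_iff.1 hG.isOpen y hy
  have hη : ContDiffOn ℝ ∞ (fun z => G z *ᵥ (W z).2.1) O := hG.smooth_mulVec h.smooth_snd.snd.fst
  have hκ : ContDiffOn ℝ ∞ (fun z => G z *ᵥ (V z).2.1) O := hG.smooth_mulVec h.smooth_fst.snd.fst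
  have hη' := contDiffOn_pi.1 hη
  have hκ' := contDiffOn_pi.1 hκ
  have hκ0 : ∃ a, (G y *ᵥ (V y).2.1) a ≠ 0 := by
    refine Function.ne_iff.1 fun h0 => h.ne_zero y hy ?_
    rw [← gradient_eq_of_mulVec hG hy h0]
    exact mulVec_zero _
  -- a potential of the closed form `c - η`
  obtain ⟨ψ, hψ, hdψ⟩ := exists_potential (f := fun a z => c a z - (G z *ᵥ (W z).2.1) a)
    Metric.isOpen_ball (convex_ball y ε)
    (fun a => ((h.smooth_coeff a).sub (hη' a)).mono hball) (fun z hz a b => by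
      have hz' := hball hz
      have hd := fun a => differentiableAt_of_contDiffOn hG.isOpen (h.smooth_coeff a) hz'
      have hd' := fun a => differentiableAt_of_contDiffOn hG.isOpen (hη' a) hz'
      rw [pd_sub a (hd b) (hd' b), pd_sub b (hd a) (hd' a)]
      linarith [h.ext_deriv_coeff hn hz' a b])
  -- an integrating factor of the form `κ` dual to `V`
  obtain ⟨O₁, hO₁, hyO₁, hO₁s, u, φ, hu, hφ, hκu⟩ := exists_integral_function Metric.isOpen_ball
    (κ := fun a z => (G z *ᵥ (V z).2.1) a) (θ := fun a z => c a z + (G z *ᵥ (W z).2.1) a)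
    (fun a => (hκ' a).mono hball) (fun a => ((h.smooth_coeff a).add (hη' a)).mono hball)
    (fun z hz a b => h.ext_deriv_fst (hball hz) a b) (Metric.mem_ball_self hε) hκ0
  obtain ⟨j, hj⟩ := hκ0
  have hO₁O : O₁ ⊆ O := hO₁s.trans hball
  have hO₂ : IsOpen (O₁ ∩ {z | (G z *ᵥ (V z).2.1) j ≠ 0}) :=
    ((hκ' j).continuousOn.mono hO₁O).isOpen_inter_preimage hO₁ isOpen_ne
  set O₂ := O₁ ∩ {z | (G z *ᵥ (V z).2.1) j ≠ 0} with hO₂d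
  have hO₂₁ : O₂ ⊆ O₁ := Set.inter_subset_left
  -- `φ` may be negative; `Real.log (φ z)` is `log |φ z|`, which is the function needed here
  have hlog : ContDiffOn ℝ ∞ (fun z => Real.log (φ z)) O₂ :=
    (hφ.mono hO₂₁).log fun z hz => (hκu z hz.1).1
  set m : EuclideanSpace ℝ (Fin n) → ℝ := fun z =>
    (c j z + (G z *ᵥ (W z).2.1) j - pd j (fun z => Real.log (φ z)) z) / (G z *ᵥ (V z).2.1) j
    with hm
  have hms : ContDiffOn ℝ ∞ m O₂ :=
    (((h.smooth_coeff j).mono (hO₂₁.trans hO₁O)).add ((hη' j).mono (hO₂₁.trans hO₁O)) |>.sub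
      (contDiffOn_pd hO₂ hlog j)).div ((hκ' j).mono (hO₂₁.trans hO₁O)) fun z hz => hz.2
  -- `d(φ du) = (c + η) ∧ φ du` says that `c + η - d log |φ|` is proportional to `κ`
  have hξ : ∀ z ∈ O₂, ∀ a, c a z + (G z *ᵥ (W z).2.1) a - pd a (fun z => Real.log (φ z)) z =
      m z * (G z *ᵥ (V z).2.1) a := by
    intro z hz a
    have hzO := hO₁O hz.1
    have hφz := differentiableAt_of_contDiffOn hO₁ hφ hz.1
    have hφ0 := (hκu z hz.1).1
    have hpdlog : ∀ a, pd a (fun z => Real.log (φ z)) z = (φ z)⁻¹ * pd a φ z := fun a => by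
      simp only [pd]
      rw [fderiv.log hφz hφ0]
      rfl
    have hud : ∀ a, DifferentiableAt ℝ (pd a u) z := fun a =>
      differentiableAt_of_contDiffOn hO₁ (contDiffOn_pd hO₁ hu a) hz.1
    have hd : ∀ a b, pd a (fun z => (G z *ᵥ (V z).2.1) b) z =
        pd a φ z * pd b u z + φ z * pd a (pd b u) z := by
      intro a b
      have : (fun z => (G z *ᵥ (V z).2.1) b) =ᶠ[𝓝 z] fun z => φ z * pd b u z := by
        filter_upwards [hO₁.mem_nhds hz.1] with x hx using (hκu x hx).2 b
      rw [pd_congr this, pd_mul a hφz (hud b)]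
    have h1 := h.ext_deriv_fst hzO a j
    rw [hd, hd, pd_comm a j (hu.contDiffAt (hO₁.mem_nhds hz.1)), (hκu z hz.1).2 a,
      (hκu z hz.1).2 j] at h1
    have hj0 : (G z *ᵥ (V z).2.1) j ≠ 0 := hz.2
    rw [hm]
    simp only
    rw [hpdlog, hpdlog, div_mul_eq_mul_div, eq_div_iff hj0, (hκu z hz.1).2 a, (hκu z hz.1).2 j]
    field_simp
    linarith
  refine ⟨O₂, fun z => (ψ z - Real.log (φ z)) / 2, ψ, hO₂, ⟨hyO₁, hj⟩, hO₂₁.trans hO₁O,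
    ((hψ.mono (hO₂₁.trans hO₁s)).sub hlog).div_const 2, ?_⟩
  refine (h.mono hO₂ (hO₂₁.trans hO₁O)).isPPOn (m := fun z => m z / 2) hn
    (((hψ.mono (hO₂₁.trans hO₁s)).sub hlog).div_const 2) (hψ.mono (hO₂₁.trans hO₁s))
    (hms.div_const 2) (fun z hz => ?_) (fun z hz a => hdψ z (hO₁s hz.1) a)
  funext a
  have hψd := differentiableAt_of_contDiffOn Metric.isOpen_ball hψ (hO₁s hz.1)
  have hld := differentiableAt_of_contDiffOn hO₂ hlog hz
  have h1 : diffl (fun z => (ψ z - Real.log (φ z)) / 2) z a =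
      (pd a ψ z - pd a (fun z => Real.log (φ z)) z) / 2 := by
    simp only [diffl, div_eq_inv_mul]
    rw [pd_const_mul a _ (hψd.fun_sub hld), pd_sub a hψd hld]
  rw [h1, hdψ z (hO₁s hz.1)]
  simp only [Pi.sub_apply, Pi.smul_apply, smul_eq_mul]
  linarith [hξ z hz a]

end IsPlaneFrame

/-- A frame of a parallel null plane bundle is a plane frame near every point. -/
lemma exists_isPlaneFrame (hG : IsMetricOn G O) {V W : EuclideanSpace ℝ (Fin n) → Tr n}
    (hV : ContDiffOn ℝ ∞ V O) (hW : ContDiffOn ℝ ∞ W O) (hV0 : ∀ z ∈ O, (V z).2.2 = 0)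
    (hW1 : ∀ z ∈ O, (W z).2.2 = 1) (hne : ∀ z ∈ O, (V z).2.1 ≠ 0)
    (hVV : ∀ z ∈ O, htr G z (V z) (V z) = 0) (hVW : ∀ z ∈ O, htr G z (V z) (W z) = 0)
    (hWW : ∀ z ∈ O, htr G z (W z) (W z) = 0)
    (hDV : ∀ z ∈ O, ∀ a, tractorConn G a V z ∈ Submodule.span ℝ {V z, W z})
    (hDW : ∀ z ∈ O, ∀ a, tractorConn G a W z ∈ Submodule.span ℝ {V z, W z})
    (hcurv : ∀ z ∈ O, ∀ v w, htr G z v (V z) = 0 → htr G z v (W z) = 0 → htr G z w (V z) = 0 →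
      htr G z w (W z) = 0 → ∀ a b, htr G z (tractorCurv G a b v z) w = 0) (hy : y ∈ O) :
    ∃ (O' : Set (EuclideanSpace ℝ (Fin n))) (c : Fin n → EuclideanSpace ℝ (Fin n) → ℝ),
      IsOpen O' ∧ y ∈ O' ∧ O' ⊆ O ∧ IsPlaneFrame G V W c O' := by
  obtain ⟨i, hi⟩ := Function.ne_iff.1 (hne y hy)
  have hVi : ContDiffOn ℝ ∞ (fun z => (V z).2.1 i) O := contDiffOn_pi.1 hV.snd.fst i
  have hWi : ContDiffOn ℝ ∞ (fun z => (W z).2.1 i) O := contDiffOn_pi.1 hW.snd.fst i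
  have hO' : IsOpen (O ∩ {z | (V z).2.1 i ≠ 0}) :=
    hVi.continuousOn.isOpen_inter_preimage hG.isOpen isOpen_ne
  set O' := O ∩ {z | (V z).2.1 i ≠ 0} with hO'd
  have hs : O' ⊆ O := Set.inter_subset_left
  -- the bottom component determines the coefficient of `W`
  have key : ∀ (X : EuclideanSpace ℝ (Fin n) → Tr n) (r : ℝ), (∀ z ∈ O, (X z).2.2 = r) →
      (∀ z ∈ O, ∀ a, tractorConn G a X z ∈ Submodule.span ℝ {V z, W z}) → ∀ z ∈ O, ∀ a,
      ∃ c : ℝ, tractorConn G a X z = c • V z - (G z *ᵥ (X z).2.1) a • W z := by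
    intro X r hX hD z hz a
    obtain ⟨p, q, hpq⟩ := Submodule.mem_span_pair.1 (hD z hz a)
    have h1 := bot_tractorConn (G := G) (y := z) a X (r := r)
      (by filter_upwards [hG.isOpen.mem_nhds hz] with x hx using hX x hx)
    rw [← hpq] at h1
    simp only [Prod.snd_add, Prod.smul_snd, hV0 z hz, hW1 z hz, smul_eq_mul] at h1
    refine ⟨p, ?_⟩
    rw [← hpq, show q = -(G z *ᵥ (X z).2.1) a by linarith]
    module
  have hκ := contDiffOn_pi.1 (hG.smooth_mulVec hV.snd.fst)
  refine ⟨O', fun a z => ((tractorConn G a V z).2.1 i + (G z *ᵥ (V z).2.1) a * (W z).2.1 i) /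
    (V z).2.1 i, hO', ⟨hy, hi⟩, hs, ?_⟩
  refine ⟨hG.mono hs hO', hV.mono hs, hW.mono hs, fun a => ?_, fun z hz => hV0 z hz.1,
    fun z hz => hW1 z hz.1, fun z hz => hne z hz.1, fun z hz => hVV z hz.1,
    fun z hz => hVW z hz.1, fun z hz => hWW z hz.1, fun z hz a => ?_,
    fun z hz a => key W 1 hW1 hDW z hz.1 a, fun z hz => hcurv z hz.1⟩
  · have h1 : ContDiffOn ℝ ∞ (tractorConn G a V) O := by
      rw [tractorConn_eq_tconn]; exact smooth_tconn hG (smooth_sch hG) hV a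
    exact (((contDiffOn_pi.1 h1.snd.fst i).add ((hκ a).mul hWi)).mono hs).div (hVi.mono hs)
      fun z hz => hz.2
  · obtain ⟨c, hc⟩ := key V 0 hV0 hDV z hz.1 a
    have hz2 : (V z).2.1 i ≠ 0 := hz.2
    have : c = ((tractorConn G a V z).2.1 i + (G z *ᵥ (V z).2.1) a * (W z).2.1 i) /
        (V z).2.1 i := by
      rw [eq_div_iff hz2, hc]
      simp
    rw [← this, hc]

end Coord

/-! ### Coordinate expressions of fields -/

section Charts

variable {n : ℕ} {M : Type*} [TopologicalSpace M] [ChartedSpace (EuclideanSpace ℝ (Fin n)) M]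
  {φ : OpenPartialHomeomorph M (EuclideanSpace ℝ (Fin n))}
  (hφ : φ ∈ IsManifold.maximalAtlas (𝓡 n) ∞ M) {y : EuclideanSpace ℝ (Fin n)}

include hφ

lemma chart_mdifferentiable : φ.MDifferentiable (𝓡 n) (𝓡 n) :=
  ⟨(contMDiffOn_of_mem_maximalAtlas hφ).mdifferentiableOn (by simp),
    (contMDiffOn_symm_of_mem_maximalAtlas hφ).mdifferentiableOn (by simp)⟩

lemma mfderiv_chart_comp_symm (hy : y ∈ φ.target) (v : EuclideanSpace ℝ (Fin n)) :
    mfderiv (𝓡 n) (𝓡 n) φ (φ.symm y) (mfderiv (𝓡 n) (𝓡 n) φ.symm y v) = v :=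
  DFunLike.congr_fun ((chart_mdifferentiable hφ).comp_symm_deriv hy) v

lemma mfderiv_symm_comp_chart (hy : y ∈ φ.target) (v : TangentSpace (𝓡 n) (φ.symm y)) :
    mfderiv (𝓡 n) (𝓡 n) φ.symm y
      (mfderiv (𝓡 n) 𝓘(ℝ, EuclideanSpace ℝ (Fin n)) φ (φ.symm y) v) = v := by
  have h := DFunLike.congr_fun ((chart_mdifferentiable hφ).symm_comp_deriv (φ.map_target hy)) v
  rw [φ.right_inv hy] at h
  exact h

omit hφ in
lemma sum_smul_coordBasis (v : Fin n → ℝ) :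
    ∑ i, v i • coordBasis φ y i = mfderiv 𝓘(ℝ, EuclideanSpace ℝ (Fin n)) (𝓡 n) φ.symm y
      (WithLp.toLp 2 v : EuclideanSpace ℝ (Fin n)) := by
  have h : (WithLp.toLp 2 v : EuclideanSpace ℝ (Fin n)) =
      ∑ i, v i • (EuclideanSpace.single i (1 : ℝ) : EuclideanSpace ℝ (Fin n)) := by
    ext j
    simp [Pi.single_apply]
  rw [h]
  simp only [coordBasis]
  exact ((map_sum (mfderiv 𝓘(ℝ, EuclideanSpace ℝ (Fin n)) (𝓡 n) φ.symm y) _ _).trans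
    (Finset.sum_congr rfl fun i _ => map_smul _ _ _)).symm

lemma sum_coordVec (hy : y ∈ φ.target) (X : ∀ x : M, TangentSpace (𝓡 n) x) :
    ∑ i, coordVec X φ y i • coordBasis φ y i = X (φ.symm y) := by
  rw [sum_smul_coordBasis]
  exact mfderiv_symm_comp_chart hφ hy _

lemma sum_smul_coordBasis_injective (hy : y ∈ φ.target) {v w : Fin n → ℝ}
    (h : ∑ i, v i • coordBasis φ y i = ∑ i, w i • coordBasis φ y i) : v = w := by
  rw [sum_smul_coordBasis, sum_smul_coordBasis] at h
  have h1 := mfderiv_chart_comp_symm hφ hy (WithLp.toLp 2 v : EuclideanSpace ℝ (Fin n))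
  have h2 := mfderiv_chart_comp_symm hφ hy (WithLp.toLp 2 w : EuclideanSpace ℝ (Fin n))
  erw [h] at h1
  exact (WithLp.toLp_injective 2) (h1.symm.trans h2)

lemma coordVec_eq_of_sum (hy : y ∈ φ.target) {X : ∀ x : M, TangentSpace (𝓡 n) x} {v : Fin n → ℝ}
    (h : ∑ i, v i • coordBasis φ y i = X (φ.symm y)) : coordVec X φ y = v :=
  sum_smul_coordBasis_injective hφ hy (by rw [sum_coordVec hφ hy, h])

/-- Smoothness of functions in a chart. -/
lemma contDiffOn_comp_symm {f : M → ℝ} {U : Set M} (hf : ContMDiffOn (𝓡 n) 𝓘(ℝ, ℝ) ∞ f U) :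
    ContDiffOn ℝ ∞ (fun y => f (φ.symm y)) (φ.target ∩ φ.symm ⁻¹' U) :=
  (hf.comp ((contMDiffOn_symm_of_mem_maximalAtlas hφ).mono Set.inter_subset_left)
    fun _ hy => hy.2).contDiffOn

lemma contMDiffOn_comp_chart {f : EuclideanSpace ℝ (Fin n) → ℝ}
    {O : Set (EuclideanSpace ℝ (Fin n))} (hf : ContDiffOn ℝ ∞ f O) :
    ContMDiffOn (𝓡 n) 𝓘(ℝ, ℝ) ∞ (fun x => f (φ x)) (φ.source ∩ φ ⁻¹' O) :=
  hf.contMDiffOn.comp ((contMDiffOn_of_mem_maximalAtlas hφ).mono Set.inter_subset_left)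
    fun _ hx => hx.2

variable [IsManifold (𝓡 n) ∞ M]

/-- The components of a smooth vector field are smooth. -/
lemma contDiffOn_coordVec {X : ∀ x : M, TangentSpace (𝓡 n) x} {U : Set M}
    (hX : SmoothVecOn X U) : ContDiffOn ℝ ∞ (coordVec X φ) (φ.target ∩ φ.symm ⁻¹' U) := by
  have h1 := (contMDiffOn_of_mem_maximalAtlas hφ).contMDiffOn_tangentMapWithin
    (m := ∞) (by simp) φ.open_source.uniqueMDiffOn
  have h2 : ContMDiffOn (𝓡 n) (𝓡 n).tangent ∞
      (fun y => (⟨φ.symm y, X (φ.symm y)⟩ : TangentBundle (𝓡 n) M)) (φ.target ∩ φ.symm ⁻¹' U) :=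
    hX.comp ((contMDiffOn_symm_of_mem_maximalAtlas hφ).mono Set.inter_subset_left) fun _ hy => hy.2
  have h3 := (contMDiff_snd_tangentBundle_modelSpace (EuclideanSpace ℝ (Fin n)) (𝓡 n)
    (n := ∞)).comp_contMDiffOn (h1.comp h2 fun y hy => φ.map_target hy.1)
  have h4 := (EuclideanSpace.equiv (Fin n) ℝ).contDiff.comp_contDiffOn h3.contDiffOn
  refine h4.congr fun y hy => ?_
  simp only [Function.comp, tangentMapWithin]
  rw [mfderivWithin_of_isOpen φ.open_source (φ.map_target hy.1)]
  rfl

/-- A vector field with smooth components is smooth. -/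
lemma smoothVecOn_of_coordVec {X : ∀ x : M, TangentSpace (𝓡 n) x}
    {O : Set (EuclideanSpace ℝ (Fin n))} {v : EuclideanSpace ℝ (Fin n) → Fin n → ℝ}
    (hv : ContDiffOn ℝ ∞ v O) (h : ∀ y ∈ O, y ∈ φ.target →
      ∑ i, v y i • coordBasis φ y i = X (φ.symm y)) :
    SmoothVecOn X (φ.source ∩ φ ⁻¹' O) := by
  have h1 := (contMDiffOn_symm_of_mem_maximalAtlas hφ).contMDiffOn_tangentMapWithin
    (m := ∞) (by simp) φ.open_target.uniqueMDiffOn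
  have hφs := (contMDiffOn_of_mem_maximalAtlas hφ).mono
    (Set.inter_subset_left : φ.source ∩ φ ⁻¹' O ⊆ φ.source)
  have h2 : ContMDiffOn (𝓡 n) (𝓡 n).tangent ∞
      (fun z => (⟨z, (WithLp.toLp 2 (v z) : EuclideanSpace ℝ (Fin n))⟩ :
        TangentBundle (𝓡 n) (EuclideanSpace ℝ (Fin n)))) O :=
    contMDiffOn_vectorSpace_iff_contDiffOn.2
      ((EuclideanSpace.equiv (Fin n) ℝ).symm.contDiff.comp_contDiffOn hv)
  refine (h1.comp (h2.comp hφs fun _ hx => hx.2) fun x hx => φ.map_source hx.1).congr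
    fun x hx => ?_
  have hy := φ.map_source hx.1
  obtain ⟨z, hz, rfl⟩ : ∃ z ∈ φ.target, φ.symm z = x := ⟨φ x, hy, φ.left_inv hx.1⟩
  have hzO : z ∈ O := by have := hx.2; rwa [Set.mem_preimage, φ.right_inv hz] at this
  simp only [Function.comp, tangentMapWithin]
  rw [φ.right_inv hz, mfderivWithin_of_isOpen φ.open_target hz, ← h z hzO hz, sum_smul_coordBasis]
  rfl

end Charts

section Charts

open Matrix

variable {n : ℕ} {M : Type*} [TopologicalSpace M] [ChartedSpace (EuclideanSpace ℝ (Fin n)) M]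
  {φ : OpenPartialHomeomorph M (EuclideanSpace ℝ (Fin n))} {y : EuclideanSpace ℝ (Fin n)}
  {g : BilinField n M}

/-! ### The metric and tractors in coordinates -/

lemma metric_sum_sum (v w : Fin n → ℝ) :
    g (φ.symm y) (∑ i, v i • coordBasis φ y i) (∑ i, w i • coordBasis φ y i) =
      v ⬝ᵥ coordMetric g φ y *ᵥ w := by
  simp only [map_sum, map_smul, _root_.sum_apply, _root_.smul_apply, smul_eq_mul, coordMetric,
    mulVec, dotProduct, Matrix.of_apply, Finset.mul_sum]
  rw [Finset.sum_comm]
  exact Finset.sum_congr rfl fun i _ => Finset.sum_congr rfl fun j _ => by ring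

lemma coordMetric_smul (f : M → ℝ) :
    coordMetric (fun x => f x • g x) φ y = f (φ.symm y) • coordMetric g φ y := rfl

/-- `tractorOfCoord` as a linear map. -/
def tractorOfCoordL (φ : OpenPartialHomeomorph M (EuclideanSpace ℝ (Fin n)))
    (y : EuclideanSpace ℝ (Fin n)) : Coord.Tr n →ₗ[ℝ] Tractor n (φ.symm y) where
  toFun := tractorOfCoord φ y
  map_add' v w := by
    refine Prod.ext rfl (Prod.ext ?_ rfl)
    simp [tractorOfCoord, add_smul, Finset.sum_add_distrib]
  map_smul' c v := by
    refine Prod.ext rfl (Prod.ext ?_ rfl)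
    simp [tractorOfCoord, mul_smul, Finset.smul_sum]

lemma tractorOfCoordL_apply (v : Coord.Tr n) : tractorOfCoordL φ y v = tractorOfCoord φ y v := rfl

lemma tractorMetric_tractorOfCoord (v w : Coord.Tr n) :
    tractorMetric g (φ.symm y) (tractorOfCoord φ y v) (tractorOfCoord φ y w) =
      Coord.htr (coordMetric g φ) y v w := by
  simp only [tractorMetric, tractorOfCoord, metric_sum_sum, Coord.htr]

section
variable (hφ : φ ∈ IsManifold.maximalAtlas (𝓡 n) ∞ M)

include hφ

lemma tractorOfCoordL_injective (hy : y ∈ φ.target) :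
    Function.Injective (tractorOfCoordL φ y) := by
  intro v w h
  refine Prod.ext (congrArg (fun t : Tractor n (φ.symm y) => t.1) h) (Prod.ext ?_ ?_)
  · exact sum_smul_coordBasis_injective hφ hy (congrArg (fun t : Tractor n (φ.symm y) => t.2.1) h)
  · exact congrArg (fun t : Tractor n (φ.symm y) => t.2.2) h

lemma tractorOfCoord_coordTractor (hy : y ∈ φ.target) (s : ∀ x : M, Tractor n x) :
    tractorOfCoord φ y (coordTractor s φ y) = s (φ.symm y) := by
  refine Prod.ext rfl (Prod.ext ?_ rfl)
  exact sum_coordVec hφ hy fun x => (s x).2.1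

variable [IsManifold (𝓡 n) ∞ M]

lemma contDiffOn_coordTractor {s : ∀ x : M, Tractor n x} {U : Set M} (hs : SmoothTractorOn s U) :
    ContDiffOn ℝ ∞ (coordTractor s φ) (φ.target ∩ φ.symm ⁻¹' U) :=
  (contDiffOn_comp_symm hφ hs.1).prodMk
    ((contDiffOn_coordVec hφ hs.2.1).prodMk (contDiffOn_comp_symm hφ hs.2.2))

/-- The coordinate expression of a pseudo-Riemannian metric. -/
lemma isMetricOn_coordMetric (hg : IsPseudoRiemannian g) :
    Coord.IsMetricOn (coordMetric g φ) φ.target where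
  isOpen := φ.open_target
  smooth i j := by
    have h1 := (contMDiffOn_symm_of_mem_maximalAtlas hφ).contMDiffOn_tangentMapWithin
      (m := ∞) (by simp) φ.open_target.uniqueMDiffOn
    have hb : ∀ i, ContMDiffOn (𝓡 n) (𝓡 n).tangent ∞ (fun y => Bundle.TotalSpace.mk'
        (EuclideanSpace ℝ (Fin n)) (E := (TangentSpace (𝓡 n) : M → Type _)) (φ.symm y)
          (coordBasis φ y i)) φ.target := by
      intro i
      have h2 : ContMDiffOn (𝓡 n) (𝓡 n).tangent ∞
          (fun z => (⟨z, (EuclideanSpace.single i 1 : EuclideanSpace ℝ (Fin n))⟩ :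
            TangentBundle (𝓡 n) (EuclideanSpace ℝ (Fin n)))) φ.target :=
        contMDiffOn_vectorSpace_iff_contDiffOn.2 contDiffOn_const
      refine (h1.comp h2 fun x hx => hx).congr fun x hx => ?_
      simp only [Function.comp, tangentMapWithin]
      rw [mfderivWithin_of_isOpen φ.open_target hx]
      rfl
    have hgs := hg.smooth.comp_contMDiffOn (contMDiffOn_symm_of_mem_maximalAtlas hφ)
    have h3 := ContMDiffOn.clm_bundle_apply₂ (E₃ := fun _ : M => ℝ) (F₃ := ℝ) hgs (hb i) (hb j)
    intro x hx
    exact (Bundle.contMDiffWithinAt_totalSpace.1 (h3 x hx)).2.contDiffWithinAt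
  symm y _ i j := hg.symm _ _ _
  det_ne y hy h0 := by
    obtain ⟨v, hv0, hv⟩ := exists_mulVec_eq_zero_iff.2 h0
    refine hv0 (sum_smul_coordBasis_injective hφ hy ?_)
    simp only [Pi.zero_apply, zero_smul, Finset.sum_const_zero]
    refine hg.nondeg _ _ fun w => ?_
    obtain ⟨u, rfl⟩ : ∃ u : Fin n → ℝ, ∑ i, u i • coordBasis φ y i = w :=
      ⟨_, (sum_smul_coordBasis _).trans (mfderiv_symm_comp_chart hφ hy w)⟩
    rw [hg.symm, metric_sum_sum, hv, dotProduct_zero]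

end

end Charts

namespace Coord

open Matrix

variable {n : ℕ} {G : EuclideanSpace ℝ (Fin n) → Matrix (Fin n) (Fin n) ℝ}
  {O : Set (EuclideanSpace ℝ (Fin n))} {y : EuclideanSpace ℝ (Fin n)}
  {U : EuclideanSpace ℝ (Fin n) → ℝ}

/-! ### The tractor plane of a pp-wave, in an arbitrary splitting -/

/-- The change of splitting is an isometry of the tractor metrics. -/
lemma htr_gauge (hG : IsMetricOn G O) (hy : y ∈ O) (v w : Tr n) :
    htr (fun z => Real.exp (2 * U z) • G z) y (gauge G U y v) (gauge G U y w) = htr G y v w := by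
  have h1 : Real.exp (U y) * Real.exp (-U y) = 1 := by rw [← Real.exp_add]; simp
  have h2 : Real.exp (-U y) * (Real.exp (2 * U y) * Real.exp (-U y)) = 1 := by
    rw [← Real.exp_add, ← Real.exp_add]; ring_nf; simp
  have h3 : ∀ X : Fin n → ℝ, gradient G U y ⬝ᵥ G y *ᵥ X = diffl U y ⬝ᵥ X := fun X => by
    rw [hG.dot_symm hy, hG.mulVec_gradient hy, dotProduct_comm]
  simp only [htr, gauge, smul_mulVec, mulVec_smul, mulVec_add, dotProduct_smul, smul_dotProduct,
    dotProduct_add, add_dotProduct, smul_eq_mul, h3, hG.mulVec_gradient hy,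
    dotProduct_comm v.2.1 (diffl U y), dotProduct_comm (gradient G U y) (diffl U y)]
  linear_combination (v.2.2 * (w.1 - diffl U y ⬝ᵥ w.2.1
      - diffl U y ⬝ᵥ gradient G U y / 2 * w.2.2)
    + w.2.2 * (v.1 - diffl U y ⬝ᵥ v.2.1 - diffl U y ⬝ᵥ gradient G U y / 2 * v.2.2)) * h1
    + (v.2.1 ⬝ᵥ G y *ᵥ w.2.1 + w.2.2 * (diffl U y ⬝ᵥ v.2.1)
      + v.2.2 * (diffl U y ⬝ᵥ w.2.1 + w.2.2 * (diffl U y ⬝ᵥ gradient G U y))) * h2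

lemma gauge_mem_ppPlane_iff {K : EuclideanSpace ℝ (Fin n) → Fin n → ℝ} (v : Tr n) :
    gauge G U y v ∈ ppPlane K y ↔ ∃ c e : ℝ, c • ((diffl U y ⬝ᵥ K y, K y, 0) : Tr n) +
      e • ((-(diffl U y ⬝ᵥ gradient G U y) / 2, -gradient G U y, 1) : Tr n) = v := by
  have hE : Real.exp (-U y) ≠ 0 := Real.exp_ne_zero _
  constructor
  · rintro ⟨h1, c, hc⟩
    have h2 : v.2.1 = (Real.exp (U y) * c) • K y - v.2.2 • gradient G U y := by
      have : Real.exp (U y) • Real.exp (-U y) • (v.2.1 + v.2.2 • gradient G U y) =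
          Real.exp (U y) • c • K y := congrArg _ hc
      rw [smul_smul, ← Real.exp_add, add_neg_cancel, Real.exp_zero, one_smul, smul_smul] at this
      rw [← this]; abel
    have h3 : v.1 - diffl U y ⬝ᵥ v.2.1 - diffl U y ⬝ᵥ gradient G U y / 2 * v.2.2 = 0 :=
      (mul_eq_zero.1 h1).resolve_left hE
    refine ⟨Real.exp (U y) * c, v.2.2, Prod.ext ?_ (Prod.ext ?_ ?_)⟩
    · simp only [Prod.fst_add, Prod.smul_fst, smul_eq_mul]
      rw [h2, dotProduct_sub, dotProduct_smul, dotProduct_smul, smul_eq_mul, smul_eq_mul] at h3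
      linarith
    · simp only [Prod.fst_add, Prod.snd_add, Prod.smul_fst, Prod.smul_snd]
      rw [h2]; module
    · simp
  · rintro ⟨c, e, rfl⟩
    refine ⟨?_, Real.exp (-U y) * c, ?_⟩
    · simp only [gauge, Prod.fst_add, Prod.snd_add, Prod.smul_fst, Prod.smul_snd, smul_eq_mul,
        dotProduct_add, dotProduct_smul, dotProduct_neg]
      ring
    · simp only [gauge, Prod.fst_add, Prod.snd_add, Prod.smul_fst, Prod.smul_snd, smul_eq_mul]
      module

namespace IsPPOn

variable {K : EuclideanSpace ℝ (Fin n) → Fin n → ℝ}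
  (h : IsPPOn (fun z => Real.exp (2 * U z) • G z) K O)

include h

lemma gauge_tractorConn_mem (hn : 2 < n) (hG : IsMetricOn G O) (hU : ContDiffOn ℝ ∞ U O)
    {O' : Set (EuclideanSpace ℝ (Fin n))} (hO' : IsOpen O') (hs : O' ⊆ O) (hy : y ∈ O')
    {V : EuclideanSpace ℝ (Fin n) → Tr n} (hV : ContDiffOn ℝ ∞ V O')
    (hmem : ∀ z ∈ O', gauge G U z (V z) ∈ ppPlane K z) (a : Fin n) :
    gauge G U y (tractorConn G a V y) ∈ ppPlane K y := by
  rw [← tractorConn_gauge hn hG hU (hs hy) (differentiableAt_of_contDiffOn hO' hV hy)]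
  refine h.tractorConn_mem (hs hy) (differentiableAt_of_contDiffOn hO'
    (smooth_gauge (hG.mono hs hO') (hU.mono hs) hV) hy) ?_ a
  filter_upwards [hO'.mem_nhds hy] with z hz using hmem z hz

lemma htr_tractorCurv_eq_zero (hn : 2 < n) (hG : IsMetricOn G O) (hU : ContDiffOn ℝ ∞ U O)
    (hy : y ∈ O) {v w : Tr n} (hv : ∀ u, gauge G U y u ∈ ppPlane K y → htr G y v u = 0)
    (hw : ∀ u, gauge G U y u ∈ ppPlane K y → htr G y w u = 0) (a b : Fin n) :
    htr G y (tractorCurv G a b v y) w = 0 := by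
  have key : ∀ v : Tr n, (∀ u, gauge G U y u ∈ ppPlane K y → htr G y v u = 0) →
      ∃ (X : Fin n → ℝ) (s : ℝ), gauge G U y v = (0, X, s) ∧
        X ⬝ᵥ (Real.exp (2 * U y) • G y) *ᵥ K y = 0 := by
    intro v hv
    have hK := hv _ ((gauge_mem_ppPlane_iff (K := K) _).2 ⟨1, 0, rfl⟩)
    have hT := hv _ ((gauge_mem_ppPlane_iff (K := K) _).2 ⟨0, 1, rfl⟩)
    rw [← htr_gauge (U := U) hG hy] at hK hT
    have h0 : (gauge G U y v).1 = 0 := by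
      have : gauge G U y ((0 : ℝ) • ((diffl U y ⬝ᵥ K y, K y, 0) : Tr n) +
          (1 : ℝ) • ((-(diffl U y ⬝ᵥ gradient G U y) / 2, -gradient G U y, 1) : Tr n)) =
          (0, 0, Real.exp (U y)) := by
        refine Prod.ext ?_ (Prod.ext ?_ ?_)
        · simp [gauge]; ring
        · simp [gauge]
        · simp [gauge]
      rw [this] at hT
      simpa [htr, Real.exp_ne_zero] using hT
    refine ⟨(gauge G U y v).2.1, (gauge G U y v).2.2, Prod.ext h0 rfl, ?_⟩
    have : gauge G U y ((1 : ℝ) • ((diffl U y ⬝ᵥ K y, K y, 0) : Tr n) +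
        (0 : ℝ) • ((-(diffl U y ⬝ᵥ gradient G U y) / 2, -gradient G U y, 1) : Tr n)) =
        (0, Real.exp (-U y) • K y, 0) := by
      simp [gauge]
    rw [this] at hK
    simpa [htr, Real.exp_ne_zero, mulVec_smul] using hK
  obtain ⟨X, s, hX, hXK⟩ := key v hv
  obtain ⟨Y, t, hY, hYK⟩ := key w hw
  rw [← htr_gauge (U := U) hG hy, ← tractorCurv_gauge hn hG hU hy, hX, hY]
  exact h.tractorCurv_eq_zero hy hXK hYK s t a b

end IsPPOn

end Coord

section Charts

open Matrix

variable {n : ℕ} {M : Type*} [TopologicalSpace M] [ChartedSpace (EuclideanSpace ℝ (Fin n)) M]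
  {φ : OpenPartialHomeomorph M (EuclideanSpace ℝ (Fin n))} {y : EuclideanSpace ℝ (Fin n)}
  {g : BilinField n M} {Υ : M → ℝ} {U : Set M}

/-- The differential of a function as a field of covectors. -/
def dfun (Υ : M → ℝ) (x : M) : TangentSpace (𝓡 n) x →L[ℝ] ℝ := mfderiv (𝓡 n) 𝓘(ℝ, ℝ) Υ x

section
variable (hφ : φ ∈ IsManifold.maximalAtlas (𝓡 n) ∞ M)

include hφ

lemma dfun_sum (hU : IsOpen U) (hΥ : ContMDiffOn (𝓡 n) 𝓘(ℝ, ℝ) ∞ Υ U) (hy : y ∈ φ.target)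
    (hyU : φ.symm y ∈ U) (v : Fin n → ℝ) :
    dfun Υ (φ.symm y) (∑ i, v i • coordBasis φ y i) =
      Coord.diffl (fun y => Υ (φ.symm y)) y ⬝ᵥ v := by
  have h1 : MDifferentiableAt (𝓡 n) 𝓘(ℝ, ℝ) Υ (φ.symm y) :=
    ((hΥ _ hyU).contMDiffAt (hU.mem_nhds hyU)).mdifferentiableAt (by simp)
  have h2 := mfderiv_comp y h1 ((chart_mdifferentiable hφ).mdifferentiableAt_symm hy)
  rw [sum_smul_coordBasis, dotProduct_comm]
  have h3 := DFunLike.congr_fun h2 (WithLp.toLp 2 v : EuclideanSpace ℝ (Fin n))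
  rw [mfderiv_eq_fderiv] at h3
  exact h3.symm.trans (Coord.fderiv_eq_sum_pd _)

variable [IsManifold (𝓡 n) ∞ M]

/-- A section of the tractor bundle with smooth components is smooth. -/
lemma smoothTractorOn_of_coord {s : ∀ x : M, Tractor n x}
    {O : Set (EuclideanSpace ℝ (Fin n))} {V : EuclideanSpace ℝ (Fin n) → Coord.Tr n}
    (hV : ContDiffOn ℝ ∞ V O)
    (h : ∀ y ∈ O, y ∈ φ.target → tractorOfCoord φ y (V y) = s (φ.symm y)) :
    SmoothTractorOn s (φ.source ∩ φ ⁻¹' O) := by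
  refine ⟨(contMDiffOn_comp_chart hφ hV.fst).congr fun x hx => ?_,
    smoothVecOn_of_coordVec hφ hV.snd.fst fun y hy hyt =>
      congrArg (fun t : Tractor n (φ.symm y) => t.2.1) (h y hy hyt),
    (contMDiffOn_comp_chart hφ hV.snd.snd).congr fun x hx => ?_⟩
  · have := congrArg (fun t : Tractor n (φ.symm (φ x)) => t.1) (h _ hx.2 (φ.map_source hx.1))
    simp only [tractorOfCoord] at this
    rw [this, φ.left_inv hx.1]
  · have := congrArg (fun t : Tractor n (φ.symm (φ x)) => t.2.2) (h _ hx.2 (φ.map_source hx.1))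
    simp only [tractorOfCoord] at this
    rw [this, φ.left_inv hx.1]

end

variable [IsManifold (𝓡 n) ∞ M]

/-- Gradients with respect to a pseudo-Riemannian metric exist. -/
lemma exists_gradient (hg : IsPseudoRiemannian g) (hU : IsOpen U)
    (hΥ : ContMDiffOn (𝓡 n) 𝓘(ℝ, ℝ) ∞ Υ U) :
    ∃ grad : ∀ x : M, TangentSpace (𝓡 n) x, ∀ x ∈ U, ∀ w, g x (grad x) w = dfun Υ x w := by
  have key : ∀ x : M, ∃ v : TangentSpace (𝓡 n) x, x ∈ U → ∀ w, g x v w = dfun Υ x w := by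
    intro x
    by_cases hx : x ∈ U
    swap
    · exact ⟨0, fun h => absurd h hx⟩
    have hφ := IsManifold.chart_mem_maximalAtlas (I := 𝓡 n) (n := ∞) x
    obtain ⟨y, hy, hyx⟩ : ∃ y ∈ (chartAt (EuclideanSpace ℝ (Fin n)) x).target,
        (chartAt (EuclideanSpace ℝ (Fin n)) x).symm y = x :=
      ⟨_, mem_chart_target _ x, (chartAt _ x).left_inv (mem_chart_source _ x)⟩
    generalize chartAt (EuclideanSpace ℝ (Fin n)) x = φ at hφ hy hyx
    subst hyx
    have hG := isMetricOn_coordMetric hφ hg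
    refine ⟨∑ i, Coord.gradient (coordMetric g φ) (fun y => Υ (φ.symm y)) y i • coordBasis φ y i,
      fun _ w => ?_⟩
    obtain ⟨u, rfl⟩ : ∃ u : Fin n → ℝ, ∑ i, u i • coordBasis φ y i = w :=
      ⟨_, (sum_smul_coordBasis _).trans (mfderiv_symm_comp_chart hφ hy w)⟩
    rw [metric_sum_sum, dfun_sum hφ hU hΥ hy hx, hG.dot_symm hy, hG.mulVec_gradient hy,
      dotProduct_comm]
  choose grad h using key
  exact ⟨grad, fun x hx => h x hx⟩

lemma coordVec_gradient (hφ : φ ∈ IsManifold.maximalAtlas (𝓡 n) ∞ M) (hg : IsPseudoRiemannian g)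
    (hU : IsOpen U) (hΥ : ContMDiffOn (𝓡 n) 𝓘(ℝ, ℝ) ∞ Υ U)
    {grad : ∀ x : M, TangentSpace (𝓡 n) x} (hgrad : ∀ x ∈ U, ∀ w, g x (grad x) w = dfun Υ x w)
    (hy : y ∈ φ.target) (hyU : φ.symm y ∈ U) :
    coordVec grad φ y = Coord.gradient (coordMetric g φ) (fun y => Υ (φ.symm y)) y := by
  have hG := isMetricOn_coordMetric hφ hg
  refine (Coord.gradient_eq_of_mulVec hG hy ?_).symm
  refine dotProduct_eq _ _ fun u => ?_
  rw [dotProduct_comm, hG.dot_symm hy, ← metric_sum_sum, sum_coordVec hφ hy, hgrad _ hyU,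
    dfun_sum hφ hU hΥ hy hyU]

end Charts

/-! ### From pp-waves to parallel tractor planes -/

section Charts

open Matrix

variable {n : ℕ} {M : Type*} [TopologicalSpace M] [ChartedSpace (EuclideanSpace ℝ (Fin n)) M]
  {φ : OpenPartialHomeomorph M (EuclideanSpace ℝ (Fin n))} {y : EuclideanSpace ℝ (Fin n)}
  {g : BilinField n M} {Υ : M → ℝ} {U : Set M} {K grad : ∀ x : M, TangentSpace (𝓡 n) x}

lemma metric_sum_field (hφ : φ ∈ IsManifold.maximalAtlas (𝓡 n) ∞ M) (hy : y ∈ φ.target)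
    (X : Fin n → ℝ) (K : ∀ x : M, TangentSpace (𝓡 n) x) :
    g (φ.symm y) (∑ i, X i • coordBasis φ y i) (K (φ.symm y)) =
      X ⬝ᵥ coordMetric g φ y *ᵥ coordVec K φ y := by
  rw [← metric_sum_sum, sum_coordVec hφ hy]

lemma metric_field_field (hφ : φ ∈ IsManifold.maximalAtlas (𝓡 n) ∞ M) (hy : y ∈ φ.target)
    (K : ∀ x : M, TangentSpace (𝓡 n) x) :
    g (φ.symm y) (K (φ.symm y)) (K (φ.symm y)) =
      coordVec K φ y ⬝ᵥ coordMetric g φ y *ᵥ coordVec K φ y := by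
  rw [← metric_sum_field hφ hy, sum_coordVec hφ hy]

/-- The tractor plane, in the splitting of `g`, of a pp-wave `e^{2Υ} g` with parallel null vector
field `K`. In the splitting of `e^{2Υ} g` it is spanned by `(0, K, 0)` and `(0, 0, 1)`. -/
def ppTractorPlane (Υ : M → ℝ) (grad K : ∀ x : M, TangentSpace (𝓡 n) x) (x : M) :
    Submodule ℝ (Tractor n x) :=
  Submodule.span ℝ {((dfun Υ x (K x), K x, 0) : Tractor n x),
    ((-(dfun Υ x (grad x)) / 2, -grad x, 1) : Tractor n x)}

variable [IsManifold (𝓡 n) ∞ M]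

lemma isPPOn_of_chart (hφ : φ ∈ IsManifold.maximalAtlas (𝓡 n) ∞ M) (hg : IsPseudoRiemannian g)
    (hU : IsOpen U) (hΥ : ContMDiffOn (𝓡 n) 𝓘(ℝ, ℝ) ∞ Υ U) (hK : SmoothVecOn K U)
    (hK0 : ∀ x ∈ U, K x ≠ 0)
    (hKK : ∀ x ∈ U, (fun x => Real.exp (2 * Υ x) • g x) x (K x) (K x) = 0)
    (hpar : ∀ y ∈ φ.target, φ.symm y ∈ U → ∀ a b,
      Coord.covVec (coordMetric (fun x => Real.exp (2 * Υ x) • g x) φ) (coordVec K φ) a b y = 0)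
    (hcurv : ∀ y ∈ φ.target, φ.symm y ∈ U → ∀ X Y : Fin n → ℝ,
      (fun x => Real.exp (2 * Υ x) • g x) (φ.symm y) (∑ i, X i • coordBasis φ y i)
        (K (φ.symm y)) = 0 →
      (fun x => Real.exp (2 * Υ x) • g x) (φ.symm y) (∑ i, Y i • coordBasis φ y i)
        (K (φ.symm y)) = 0 →
      ∀ c d, ∑ a, ∑ b, Coord.riemann (coordMetric (fun x => Real.exp (2 * Υ x) • g x) φ)
        a b c d y * X a * Y b = 0) :
    Coord.IsPPOn (fun z => Real.exp (2 * Υ (φ.symm z)) • coordMetric g φ z) (coordVec K φ)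
      (φ.target ∩ φ.symm ⁻¹' U) where
  metric := ((isMetricOn_coordMetric hφ hg).mono Set.inter_subset_left
    (φ.isOpen_inter_preimage_symm hU)).conformal (contDiffOn_comp_symm hφ hΥ)
  smooth := contDiffOn_coordVec hφ hK
  ne_zero z hz h0 := hK0 _ hz.2 (by rw [← sum_coordVec hφ hz.1 K, h0]; simp)
  null z hz := by
    exact (metric_field_field (g := fun x => Real.exp (2 * Υ x) • g x) hφ hz.1 K).symm.trans
      (hKK _ hz.2)
  parallel z hz a := funext fun b => hpar z hz.1 hz.2 a b
  curv z hz X Y hX hY := by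
    refine hcurv z hz.1 hz.2 X Y ?_ ?_
    · exact (metric_sum_field (g := fun x => Real.exp (2 * Υ x) • g x) hφ hz.1 X K).trans hX
    · exact (metric_sum_field (g := fun x => Real.exp (2 * Υ x) • g x) hφ hz.1 Y K).trans hY

lemma tractorOfCoord_mem_ppTractorPlane (hφ : φ ∈ IsManifold.maximalAtlas (𝓡 n) ∞ M)
    (hg : IsPseudoRiemannian g) (hU : IsOpen U) (hΥ : ContMDiffOn (𝓡 n) 𝓘(ℝ, ℝ) ∞ Υ U)
    (hgrad : ∀ x ∈ U, ∀ w, g x (grad x) w = dfun Υ x w) (hy : y ∈ φ.target)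
    (hyU : φ.symm y ∈ U) :
    tractorOfCoord φ y (Coord.diffl (fun y => Υ (φ.symm y)) y ⬝ᵥ coordVec K φ y,
        coordVec K φ y, 0) = (dfun Υ (φ.symm y) (K (φ.symm y)), K (φ.symm y), 0) ∧
    tractorOfCoord φ y (-(Coord.diffl (fun y => Υ (φ.symm y)) y ⬝ᵥ
        Coord.gradient (coordMetric g φ) (fun y => Υ (φ.symm y)) y) / 2,
        -Coord.gradient (coordMetric g φ) (fun y => Υ (φ.symm y)) y, 1) =
      (-(dfun Υ (φ.symm y) (grad (φ.symm y))) / 2, -grad (φ.symm y), 1) := by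
  rw [← coordVec_gradient hφ hg hU hΥ hgrad hy hyU, ← dfun_sum hφ hU hΥ hy hyU,
    ← dfun_sum hφ hU hΥ hy hyU, sum_coordVec hφ hy, sum_coordVec hφ hy]
  refine ⟨Prod.ext rfl (Prod.ext (sum_coordVec hφ hy K) rfl), Prod.ext rfl (Prod.ext ?_ rfl)⟩
  simp only [tractorOfCoord, Pi.neg_apply, neg_smul, Finset.sum_neg_distrib]
  rw [sum_coordVec hφ hy grad]

lemma mem_ppTractorPlane_iff (hφ : φ ∈ IsManifold.maximalAtlas (𝓡 n) ∞ M)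
    (hg : IsPseudoRiemannian g) (hU : IsOpen U) (hΥ : ContMDiffOn (𝓡 n) 𝓘(ℝ, ℝ) ∞ Υ U)
    (hgrad : ∀ x ∈ U, ∀ w, g x (grad x) w = dfun Υ x w) (hy : y ∈ φ.target)
    (hyU : φ.symm y ∈ U) (v : Coord.Tr n) :
    tractorOfCoord φ y v ∈ ppTractorPlane Υ grad K (φ.symm y) ↔
      Coord.gauge (coordMetric g φ) (fun y => Υ (φ.symm y)) y v ∈
        Coord.ppPlane (coordVec K φ) y := by
  obtain ⟨h1, h2⟩ := tractorOfCoord_mem_ppTractorPlane (K := K) hφ hg hU hΥ hgrad hy hyU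
  rw [Coord.gauge_mem_ppPlane_iff, ppTractorPlane, Submodule.mem_span_pair, ← h1, ← h2]
  simp only [← tractorOfCoordL_apply, ← map_smul, ← map_add]
  constructor
  · rintro ⟨c, e, h⟩
    exact ⟨c, e, tractorOfCoordL_injective hφ hy h⟩
  · rintro ⟨c, e, h⟩
    exact ⟨c, e, congrArg _ h⟩

/-- The tractor plane of a pp-wave is a totally null subbundle. -/
lemma isNullPlaneBundleOn_ppTractorPlane (hg : IsPseudoRiemannian g) (hU : IsOpen U)
    (hΥ : ContMDiffOn (𝓡 n) 𝓘(ℝ, ℝ) ∞ Υ U)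
    (hgrad : ∀ x ∈ U, ∀ w, g x (grad x) w = dfun Υ x w) (hK : SmoothVecOn K U)
    (hK0 : ∀ x ∈ U, K x ≠ 0) (hKK : ∀ x ∈ U, g x (K x) (K x) = 0) :
    IsNullPlaneBundleOn g U (ppTractorPlane Υ grad K) where
  rank_two x hx := by
    have h : LinearIndependent ℝ ![((dfun Υ x (K x), K x, 0) : Tractor n x),
        ((-(dfun Υ x (grad x)) / 2, -grad x, 1) : Tractor n x)] := by
      refine LinearIndependent.pair_iff.2 fun c e h => ?_
      have he : e = 0 := by
        have := congrArg (fun t : Tractor n x => t.2.2) h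
        simpa using this
      subst he
      refine ⟨?_, rfl⟩
      have := congrArg (fun t : Tractor n x => t.2.1) h
      simpa [hK0 x hx] using this
    have h2 := finrank_span_eq_card h
    rw [Matrix.range_cons_cons_empty] at h2
    exact h2
  smooth x hx := by
    have hφ := IsManifold.chart_mem_maximalAtlas (I := 𝓡 n) (n := ∞) x
    have hxs := mem_chart_source (EuclideanSpace ℝ (Fin n)) x
    generalize chartAt (EuclideanSpace ℝ (Fin n)) x = φ at hφ hxs
    have hO := φ.isOpen_inter_preimage_symm hU
    have hG := (isMetricOn_coordMetric hφ hg).mono Set.inter_subset_left hO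
    have hΥs := contDiffOn_comp_symm hφ hΥ
    have hKs := contDiffOn_coordVec hφ hK
    refine ⟨φ.source ∩ φ ⁻¹' (φ.target ∩ φ.symm ⁻¹' U), φ.isOpen_inter_preimage hO,
      ⟨hxs, φ.map_source hxs, ?_⟩, ?_, fun x => (dfun Υ x (K x), K x, 0),
      fun x => (-(dfun Υ x (grad x)) / 2, -grad x, 1), ?_, ?_, fun z _ => rfl⟩
    · rw [Set.mem_preimage, φ.left_inv hxs]; exact hx
    · intro z hz
      have := hz.2.2
      rwa [Set.mem_preimage, φ.left_inv hz.1] at this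
    · exact smoothTractorOn_of_coord hφ
        ((Coord.smooth_dot (hG.smooth_diffl hΥs) hKs).prodMk (hKs.prodMk contDiffOn_const))
        fun y hy hyt =>
          (tractorOfCoord_mem_ppTractorPlane hφ hg hU hΥ hgrad hyt hy.2).1
    · exact smoothTractorOn_of_coord hφ
        (((Coord.smooth_dot (hG.smooth_diffl hΥs) (hG.smooth_gradient hΥs)).neg.div_const 2).prodMk
          ((hG.smooth_gradient hΥs).neg.prodMk contDiffOn_const))
        fun y hy hyt =>
          (tractorOfCoord_mem_ppTractorPlane (K := K) hφ hg hU hΥ hgrad hyt hy.2).2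
  totally_null x hx v hv w hw := by
    obtain ⟨c, e, rfl⟩ := Submodule.mem_span_pair.1 hv
    obtain ⟨c', e', rfl⟩ := Submodule.mem_span_pair.1 hw
    have h1 : g x (K x) (grad x) = dfun Υ x (K x) := by rw [hg.symm, hgrad x hx]
    simp only [tractorMetric, Prod.fst_add, Prod.snd_add, Prod.smul_fst, Prod.smul_snd, map_add,
      map_smul, map_neg, _root_.add_apply, _root_.smul_apply, _root_.neg_apply, smul_eq_mul,
      hKK x hx, h1, hgrad x hx]
    ring

/-- The plane is `ppTractorPlane`: in the splitting of the pp-wave it is spanned by the parallel null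
field and the tractor `(0, 0, 1)`. -/
theorem ClassContainsPPWaveOn.admitsPPTractorPlaneOn (hn : 2 < n) (hg : IsPseudoRiemannian g)
    (hU : IsOpen U) (h : ClassContainsPPWaveOn g U) : AdmitsPPTractorPlaneOn g U := by
  obtain ⟨Υ, hΥ, K, hK, hK0, hKK, hcharts⟩ := h
  obtain ⟨grad, hgrad⟩ := exists_gradient hg hU hΥ
  refine ⟨ppTractorPlane Υ grad K, isNullPlaneBundleOn_ppTractorPlane hg hU hΥ hgrad hK hK0
    fun x hx => ?_, fun x hx => ?_⟩
  · have := hKK x hx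
    simpa [Real.exp_ne_zero] using this
  obtain ⟨φ, hφ, hxφ, hP⟩ := hcharts x hx
  refine ⟨φ, hφ, hxφ, fun y hy hyU => ?_⟩
  have hpp := isPPOn_of_chart hφ hg hU hΥ hK hK0 hKK (fun y hy hyU => (hP y hy hyU).1)
    fun y hy hyU => (hP y hy hyU).2
  have hO := φ.isOpen_inter_preimage_symm hU
  have hG := (isMetricOn_coordMetric hφ hg).mono Set.inter_subset_left hO
  have hΥs := contDiffOn_comp_symm hφ hΥ
  have hmem : ∀ z ∈ φ.target ∩ φ.symm ⁻¹' U, ∀ v, _ := fun z hz =>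
    mem_ppTractorPlane_iff (K := K) hφ hg hU hΥ hgrad hz.1 hz.2
  constructor
  · intro W hW hWU hyW s hs hsH a
    rw [hmem y ⟨hy, hyU⟩]
    refine hpp.gauge_tractorConn_mem hn hG hΥs (φ.isOpen_inter_preimage_symm hW)
      (Set.inter_subset_inter_right _ (Set.preimage_mono hWU)) ⟨hy, hyW⟩
      (contDiffOn_coordTractor hφ hs) (fun z hz => ?_) a
    rw [← hmem z ⟨hz.1, hWU hz.2⟩, tractorOfCoord_coordTractor hφ hz.1]
    exact hsH _ hz.2
  · intro X Y hX hY a b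
    rw [tractorMetric_tractorOfCoord]
    refine hpp.htr_tractorCurv_eq_zero hn hG hΥs ⟨hy, hyU⟩ (fun u hu => ?_) (fun u hu => ?_) a b
    · rw [← tractorMetric_tractorOfCoord]
      exact hX _ ((hmem y ⟨hy, hyU⟩ u).2 hu)
    · rw [← tractorMetric_tractorOfCoord]
      exact hY _ ((hmem y ⟨hy, hyU⟩ u).2 hu)

end Charts

/-! ### Locality -/

namespace Coord

variable {n : ℕ} {G G' : EuclideanSpace ℝ (Fin n) → Matrix (Fin n) (Fin n) ℝ}
  {y : EuclideanSpace ℝ (Fin n)}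

lemma christoffel_congr (h : G =ᶠ[𝓝 y] G') (c a b : Fin n) :
    christoffel G c a b y = christoffel G' c a b y := by
  have h1 : ∀ i j k, pd i (fun z => G z j k) y = pd i (fun z => G' z j k) y := fun i j k =>
    pd_congr (by filter_upwards [h] with z hz; rw [hz]) i
  simp only [christoffel, h1, h.eq_of_nhds]

lemma covVec_congr (h : G =ᶠ[𝓝 y] G') {X X' : EuclideanSpace ℝ (Fin n) → Fin n → ℝ}
    (hX : X =ᶠ[𝓝 y] X') (a b : Fin n) : covVec G X a b y = covVec G' X' a b y := by
  have h1 : pd a (fun z => X z b) y = pd a (fun z => X' z b) y :=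
    pd_congr (by filter_upwards [hX] with z hz; rw [hz]) a
  simp only [covVec, h1, hX.eq_of_nhds, christoffel_congr h]

lemma riemann_congr (h : G =ᶠ[𝓝 y] G') (a b c d : Fin n) :
    riemann G a b c d y = riemann G' a b c d y := by
  have h1 : ∀ i c a b, pd i (christoffel G c a b) y = pd i (christoffel G' c a b) y :=
    fun i c a b => pd_congr (by
      filter_upwards [h.eventually_nhds] with z hz using christoffel_congr hz c a b) i
  simp only [riemann, riemannUp, h1, h.eq_of_nhds, christoffel_congr h]

lemma htr_add_right (v w w' : Tr n) : htr G y v (w + w') = htr G y v w + htr G y v w' := by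
  simp only [htr, Prod.fst_add, Prod.snd_add, Matrix.mulVec_add, dotProduct_add]
  ring

lemma htr_smul_right (c : ℝ) (v w : Tr n) : htr G y v (c • w) = c * htr G y v w := by
  simp only [htr, Prod.smul_fst, Prod.smul_snd, Matrix.mulVec_smul, dotProduct_smul, smul_eq_mul]
  ring

end Coord

/-! ### From parallel tractor planes to pp-waves -/

section Charts

open Matrix

variable {n : ℕ} {M : Type*} [TopologicalSpace M] [ChartedSpace (EuclideanSpace ℝ (Fin n)) M]
  {φ : OpenPartialHomeomorph M (EuclideanSpace ℝ (Fin n))} {y : EuclideanSpace ℝ (Fin n)}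
  {g : BilinField n M} {Υ : M → ℝ} {U : Set M}

variable [IsManifold (𝓡 n) ∞ M]

/-- A conformally related pp-wave in a coordinate domain. -/
lemma classContainsPPWaveOn_of_isPPOn (hφ : φ ∈ IsManifold.maximalAtlas (𝓡 n) ∞ M)
    {O : Set (EuclideanSpace ℝ (Fin n))} (hO : O ⊆ φ.target) {u : EuclideanSpace ℝ (Fin n) → ℝ}
    (hu : ContDiffOn ℝ ∞ u O) {k : EuclideanSpace ℝ (Fin n) → Fin n → ℝ}
    (h : Coord.IsPPOn (fun z => Real.exp (2 * u z) • coordMetric g φ z) k O) :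
    ClassContainsPPWaveOn g (φ.source ∩ φ ⁻¹' O) := by
  let F : EuclideanSpace ℝ (Fin n) → EuclideanSpace ℝ (Fin n) := fun z =>
    (∑ i, k z i • coordBasis φ z i : TangentSpace (𝓡 n) (φ.symm z))
  let K : ∀ x : M, TangentSpace (𝓡 n) x := fun x => F (φ x)
  have hK : ∀ z ∈ φ.target, ∑ i, k z i • coordBasis φ z i = K (φ.symm z) := fun z hz =>
    congrArg F (φ.right_inv hz).symm
  have hkK : ∀ z ∈ φ.target, coordVec K φ z = k z := fun z hz =>
    coordVec_eq_of_sum hφ hz (hK z hz)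
  have hm : ∀ z ∈ φ.target, coordMetric (fun x => Real.exp (2 * u (φ x)) • g x) φ z =
      Real.exp (2 * u z) • coordMetric g φ z := fun z hz => by
    rw [coordMetric_smul, φ.right_inv hz]
  have hpt : ∀ x ∈ φ.source ∩ φ ⁻¹' O, ∃ z ∈ O, φ.symm z = x := fun x hx =>
    ⟨φ x, hx.2, φ.left_inv hx.1⟩
  refine ⟨fun x => u (φ x), contMDiffOn_comp_chart hφ hu, K,
    smoothVecOn_of_coordVec hφ h.smooth fun y _ hyt => hK y hyt, fun x hx => ?_, fun x hx => ?_,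
    fun x hx => ⟨φ, hφ, hx.1, fun y hy hyO => ?_⟩⟩
  · obtain ⟨z, hz, rfl⟩ := hpt x hx
    intro h0
    refine h.ne_zero z hz ?_
    rw [← hkK z (hO hz)]
    refine coordVec_eq_of_sum hφ (hO hz) ?_
    rw [h0]; simp
  · obtain ⟨z, hz, rfl⟩ := hpt x hx
    refine (metric_field_field (g := fun x => Real.exp (2 * u (φ x)) • g x) hφ (hO hz) K).trans ?_
    rw [hkK z (hO hz), hm z (hO hz)]
    exact h.null z hz
  · have hyO' : y ∈ O := by have := hyO.2; rwa [Set.mem_preimage, φ.right_inv hy] at this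
    have hm' : coordMetric (fun x => Real.exp (2 * u (φ x)) • g x) φ =ᶠ[𝓝 y]
        fun z => Real.exp (2 * u z) • coordMetric g φ z := by
      filter_upwards [φ.open_target.mem_nhds hy] with z hz using hm z hz
    have hk' : coordVec K φ =ᶠ[𝓝 y] k := by
      filter_upwards [φ.open_target.mem_nhds hy] with z hz using hkK z hz
    refine ⟨fun a b => ?_, fun X Y hX hY c d => ?_⟩
    · rw [Coord.covVec_congr hm' hk']
      exact congrFun (h.parallel y hyO' a) b
    · simp only [Coord.riemann_congr hm']
      have key : ∀ X : Fin n → ℝ, (fun x => Real.exp (2 * u (φ x)) • g x) (φ.symm y)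
          (∑ i, X i • coordBasis φ y i) (K (φ.symm y)) = 0 →
          X ⬝ᵥ (Real.exp (2 * u y) • coordMetric g φ y) *ᵥ k y = 0 := fun X hX => by
        rw [← hm y hy, ← hkK y hy]
        exact (metric_sum_field (g := fun x => Real.exp (2 * u (φ x)) • g x) hφ hy X K).symm.trans
          hX
      exact h.curv y hyO' X Y (key X hX) (key Y hY) c d

lemma ClassContainsPPWaveOn.mono {V : Set M} (h : ClassContainsPPWaveOn g U) (hVU : V ⊆ U) :
    ClassContainsPPWaveOn g V := by
  obtain ⟨Υ, hΥ, K, hK, hK0, hKK, hP⟩ := h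
  refine ⟨Υ, hΥ.mono hVU, K, hK.mono hVU, fun x hx => hK0 x (hVU hx), fun x hx => hKK x (hVU hx),
    fun x hx => ?_⟩
  obtain ⟨φ, hφ, hxφ, h⟩ := hP x (hVU hx)
  exact ⟨φ, hφ, hxφ, fun y hy hyV => h y hy (hVU hyV)⟩

/-- Conformally related pp-waves on disjoint open sets can be put together. -/
lemma ClassContainsPPWaveOn.sUnion {𝓕 : Set (Set M)} (hopen : ∀ N ∈ 𝓕, IsOpen N)
    (hdisj : 𝓕.PairwiseDisjoint id) (h : ∀ N ∈ 𝓕, ClassContainsPPWaveOn g N) :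
    ClassContainsPPWaveOn g (⋃₀ 𝓕) := by
  classical
  choose! Υ hΥ K hK hK0 hKK hP using h
  have hidx : ∀ x : M, ∃ N : Set M, ∀ N' ∈ 𝓕, x ∈ N' → N = N' := by
    intro x
    by_cases hx : ∃ N ∈ 𝓕, x ∈ N
    · obtain ⟨N, hN, hxN⟩ := hx
      exact ⟨N, fun N' hN' hxN' => hdisj.elim hN hN' (Set.not_disjoint_iff.2 ⟨x, hxN, hxN'⟩)⟩
    · exact ⟨∅, fun N' hN' hxN' => absurd ⟨N', hN', hxN'⟩ hx⟩
  choose idx hidx using hidx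
  have hloc : ∀ N ∈ 𝓕, ∀ x ∈ N, ∀ᶠ z in 𝓝 x, idx z = N := fun N hN x hx => by
    filter_upwards [(hopen N hN).mem_nhds hx] with z hz using hidx z N hN hz
  refine ⟨fun x => Υ (idx x) x, ?_, fun x => K (idx x) x, ?_, ?_, ?_, ?_⟩
  · rintro x ⟨N, hN, hx⟩
    refine (((hΥ N hN).contMDiffAt ((hopen N hN).mem_nhds hx)).congr_of_eventuallyEq
      ?_).contMDiffWithinAt
    filter_upwards [hloc N hN x hx] with z hz
    rw [hz]
  · rintro x ⟨N, hN, hx⟩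
    refine (((hK N hN).contMDiffAt ((hopen N hN).mem_nhds hx)).congr_of_eventuallyEq
      ?_).contMDiffWithinAt
    filter_upwards [hloc N hN x hx] with z hz
    rw [hz]
  · rintro x ⟨N, hN, hx⟩
    simp only [hidx x N hN hx]
    exact hK0 N hN x hx
  · rintro x ⟨N, hN, hx⟩
    have := hKK N hN x hx
    simp only [hidx x N hN hx]
    exact this
  · rintro x ⟨N, hN, hx⟩
    obtain ⟨φ, hφ, hxφ, h⟩ := hP N hN x hx
    have hNo := hopen N hN
    refine ⟨φ.restr N, restr_mem_maximalAtlas _ hφ hNo, ?_, fun y hy _ => ?_⟩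
    · rw [φ.restr_source' _ hNo]; exact ⟨hxφ, hx⟩
    rw [OpenPartialHomeomorph.restr_target, hNo.interior_eq] at hy
    have hyN : φ.symm y ∈ N := hy.2
    have hev : ∀ᶠ z in 𝓝 y, idx (φ.symm z) = N :=
      (φ.continuousAt_symm hy.1).eventually (hloc N hN _ hyN)
    have hm : coordMetric (fun x => Real.exp (2 * Υ (idx x) x) • g x) φ =ᶠ[𝓝 y]
        coordMetric (fun x => Real.exp (2 * Υ N x) • g x) φ := by
      filter_upwards [hev] with z hz
      rw [coordMetric_smul, coordMetric_smul, hz]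
    have hk : coordVec (fun x => K (idx x) x) φ =ᶠ[𝓝 y] coordVec (K N) φ := by
      filter_upwards [hev] with z hz
      funext i
      simp only [coordVec, hz]
    obtain ⟨h1, h2⟩ := h y hy.1 hyN
    have hyi := hev.self_of_nhds
    refine ⟨fun a b => ?_, fun X Y hX hY c d => ?_⟩
    · exact (Coord.covVec_congr hm hk a b).trans (h1 a b)
    · refine Eq.trans ?_ (h2 X Y ?_ ?_ c d)
      · exact Finset.sum_congr rfl fun a _ => Finset.sum_congr rfl fun b _ =>
          congrArg (fun r => r * X a * Y b) (Coord.riemann_congr hm a b c d)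
      · have : (fun x => Real.exp (2 * Υ (idx x) x) • g x) (φ.symm y)
          (∑ i, X i • coordBasis φ y i) (K (idx (φ.symm y)) (φ.symm y)) = 0 := hX
        simpa only [hyi] using this
      · have : (fun x => Real.exp (2 * Υ (idx x) x) • g x) (φ.symm y)
          (∑ i, Y i • coordBasis φ y i) (K (idx (φ.symm y)) (φ.symm y)) = 0 := hY
        simpa only [hyi] using this

end Charts

section Charts

open Matrix

variable {n : ℕ} {M : Type*} [TopologicalSpace M] [ChartedSpace (EuclideanSpace ℝ (Fin n)) M]
  {φ : OpenPartialHomeomorph M (EuclideanSpace ℝ (Fin n))} {y : EuclideanSpace ℝ (Fin n)}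
  {g : BilinField n M} {U : Set M}

lemma span_pair_sub_smul {E : Type*} [AddCommGroup E] [Module ℝ E] (s t : E) (r : ℝ) {q : ℝ}
    (hq : q ≠ 0) : Submodule.span ℝ {s - r • t, q • t} = Submodule.span ℝ {s, t} := by
  refine le_antisymm (Submodule.span_le.2 ?_) (Submodule.span_le.2 ?_)
  · rintro _ (rfl | rfl)
    · exact Submodule.mem_span_pair.2 ⟨1, -r, by module⟩
    · exact Submodule.mem_span_pair.2 ⟨0, q, by module⟩
  · rintro _ (rfl | rfl)
    · exact Submodule.mem_span_pair.2 ⟨1, r * q⁻¹, by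
        rw [smul_smul, mul_assoc, inv_mul_cancel₀ hq]; module⟩
    · exact Submodule.mem_span_pair.2 ⟨0, q⁻¹, by rw [smul_smul, inv_mul_cancel₀ hq]; module⟩

lemma tractorOfCoord_mem_span_iff (hφ : φ ∈ IsManifold.maximalAtlas (𝓡 n) ∞ M) (hy : y ∈ φ.target)
    (u v w : Coord.Tr n) :
    tractorOfCoord φ y u ∈ Submodule.span ℝ {tractorOfCoord φ y v, tractorOfCoord φ y w} ↔
      u ∈ Submodule.span ℝ {v, w} := by
  simp only [Submodule.mem_span_pair, ← tractorOfCoordL_apply, ← map_smul, ← map_add]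
  exact ⟨fun ⟨c, e, h⟩ => ⟨c, e, tractorOfCoordL_injective hφ hy h⟩,
    fun ⟨c, e, h⟩ => ⟨c, e, congrArg _ h⟩⟩

variable [IsManifold (𝓡 n) ∞ M]

/-- A parallel tractor plane of rank two contains tractors with nonzero bottom component over a
dense set: where the bottom components vanish identically, the bottom components of the
derivatives force the middle components to vanish. -/
lemma exists_bottom_ne_zero (hg : IsPseudoRiemannian g) {H : ∀ x : M, Submodule ℝ (Tractor n x)}
    (hH : IsNullPlaneBundleOn g U H) (hpar : InCharts U fun φ y => IsParallelAt g U H φ y)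
    {O : Set M} (hO : IsOpen O) (hOU : O ⊆ U) (hne : O.Nonempty) :
    ∃ x ∈ O, ∃ v ∈ H x, v.2.2 ≠ 0 := by
  by_contra! hcon
  obtain ⟨x, hx⟩ := hne
  obtain ⟨W, hW, hxW, hWU, s, t, hs, ht, hst⟩ := hH.smooth x (hOU hx)
  obtain ⟨φ, hφ, hxφ, hP⟩ := hpar x (hOU hx)
  obtain ⟨y, hy, rfl⟩ : ∃ y ∈ φ.target, φ.symm y = x := ⟨φ x, φ.map_source hxφ, φ.left_inv hxφ⟩
  have hG := isMetricOn_coordMetric hφ hg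
  have key : ∀ s : ∀ x : M, Tractor n x, SmoothTractorOn s W → (∀ z ∈ W, s z ∈ H z) →
      s (φ.symm y) ∈ Submodule.span ℝ {((1, 0, 0) : Tractor n (φ.symm y))} := by
    intro s hs hsH
    have h1 := hP y hy (hOU hx) (W ∩ O) (hW.inter hO) (Set.inter_subset_left.trans hWU) ⟨hxW, hx⟩ s
      ⟨hs.1.mono Set.inter_subset_left, hs.2.1.mono Set.inter_subset_left,
        hs.2.2.mono Set.inter_subset_left⟩ fun z hz => hsH z hz.1
    have h2 : (fun z => (coordTractor s φ z).2.2) =ᶠ[𝓝 y] fun _ => 0 := by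
      filter_upwards [(φ.isOpen_inter_preimage_symm (hW.inter hO)).mem_nhds ⟨hy, hxW, hx⟩] with z hz
      exact hcon _ hz.2.2 _ (hsH _ hz.2.1)
    have h3 : coordMetric g φ y *ᵥ (coordTractor s φ y).2.1 = 0 := by
      funext a
      have h4 : (Coord.tractorConn (coordMetric g φ) a (coordTractor s φ) y).2.2 = 0 :=
        hcon _ hx _ (h1 a)
      rw [Coord.bot_tractorConn a _ h2] at h4
      exact neg_eq_zero.1 h4
    have h5 : (coordTractor s φ y).2.1 = 0 := by
      rw [← Coord.gradient_eq_of_mulVec hG hy h3]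
      exact mulVec_zero _
    have h6 : (s (φ.symm y)).2.1 = 0 := by
      refine (sum_coordVec hφ hy fun x => (s x).2.1).symm.trans ?_
      have : coordVec (fun x => (s x).2.1) φ y = 0 := h5
      rw [this]; simp
    have h7 : (s (φ.symm y)).2.2 = 0 := hcon _ hx _ (hsH _ hxW)
    refine Submodule.mem_span_singleton.2 ⟨(s (φ.symm y)).1, ?_⟩
    refine Prod.ext ?_ (Prod.ext ?_ ?_)
    · simp
    · simp [h6]
    · simp [h7]
  have hle : H (φ.symm y) ≤ Submodule.span ℝ {((1, 0, 0) : Tractor n (φ.symm y))} := by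
    rw [hst _ hxW]
    refine Submodule.span_le.2 ?_
    rintro _ (rfl | rfl)
    · exact key s hs fun z hz => by
        rw [hst z hz]; exact Submodule.subset_span (Set.mem_insert _ _)
    · exact key t ht fun z hz => by
        rw [hst z hz]; exact Submodule.subset_span (Set.mem_insert_of_mem _ rfl)
  have h8 := Submodule.finrank_mono hle
  rw [hH.rank_two _ (hOU hx), finrank_span_singleton] at h8
  · omega
  · intro h0
    have := congrArg Prod.fst h0
    simp at this

/-- Near a point where the tractor plane contains tractors with nonzero bottom component, the
conformal class contains a pp-wave. -/
lemma exists_pp_nhd_of_frame (hn : 2 < n) (hg : IsPseudoRiemannian g)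
    {H : ∀ x : M, Submodule ℝ (Tractor n x)} (hH : IsNullPlaneBundleOn g U H)
    (hcharts : InCharts U fun φ y => IsParallelAt g U H φ y ∧ TractorCurvatureVanishesAt g H φ y)
    {x : M} {W : Set M} (hW : IsOpen W) (hxW : x ∈ W) (hWU : W ⊆ U) {s t : ∀ x : M, Tractor n x}
    (hs : SmoothTractorOn s W) (ht : SmoothTractorOn t W)
    (hst : ∀ z ∈ W, H z = Submodule.span ℝ {s z, t z}) (ht0 : (t x).2.2 ≠ 0) :
    ∃ N : Set M, IsOpen N ∧ x ∈ N ∧ N ⊆ U ∧ ClassContainsPPWaveOn g N := by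
  obtain ⟨φ, hφ, hxφ, hP⟩ := hcharts x (hWU hxW)
  have hW' : IsOpen (W ∩ {z | (t z).2.2 ≠ 0}) :=
    ht.2.2.continuousOn.isOpen_inter_preimage hW isOpen_ne
  have hO := φ.isOpen_inter_preimage_symm hW'
  set O := φ.target ∩ φ.symm ⁻¹' (W ∩ {z | (t z).2.2 ≠ 0}) with hOd
  have hG := (isMetricOn_coordMetric hφ hg).mono Set.inter_subset_left hO
  have hsub : O ⊆ φ.target ∩ φ.symm ⁻¹' W := Set.inter_subset_inter_right _
    (Set.preimage_mono Set.inter_subset_left)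
  have hS : ContDiffOn ℝ ∞ (coordTractor s φ) O := (contDiffOn_coordTractor hφ hs).mono hsub
  have hT : ContDiffOn ℝ ∞ (coordTractor t φ) O := (contDiffOn_coordTractor hφ ht).mono hsub
  have hT0 : ∀ z ∈ O, (coordTractor t φ z).2.2 ≠ 0 := fun z hz => hz.2.2
  -- the frame normalized to have bottom components `0` and `1`
  let V : EuclideanSpace ℝ (Fin n) → Coord.Tr n := fun z => coordTractor s φ z -
    ((coordTractor s φ z).2.2 / (coordTractor t φ z).2.2) • coordTractor t φ z
  let V' : EuclideanSpace ℝ (Fin n) → Coord.Tr n := fun z =>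
    (coordTractor t φ z).2.2⁻¹ • coordTractor t φ z
  have hV : ContDiffOn ℝ ∞ V O := hS.sub ((hS.snd.snd.div hT.snd.snd hT0).smul hT)
  have hV' : ContDiffOn ℝ ∞ V' O := (hT.snd.snd.inv hT0).smul hT
  have hV0 : ∀ z ∈ O, (V z).2.2 = 0 := fun z hz => by
    simp only [V, Prod.snd_sub, Prod.smul_snd, smul_eq_mul]
    rw [div_mul_cancel₀ _ (hT0 z hz), sub_self]
  have hV1 : ∀ z ∈ O, (V' z).2.2 = 1 := fun z hz => inv_mul_cancel₀ (hT0 z hz)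
  have hspan : ∀ z ∈ O, H (φ.symm z) =
      Submodule.span ℝ {tractorOfCoord φ z (V z), tractorOfCoord φ z (V' z)} := by
    intro z hz
    rw [hst _ hz.2.1, ← span_pair_sub_smul (s (φ.symm z)) (t (φ.symm z))
      ((coordTractor s φ z).2.2 / (coordTractor t φ z).2.2) (inv_ne_zero (hT0 z hz)),
      ← tractorOfCoord_coordTractor hφ hz.1 s, ← tractorOfCoord_coordTractor hφ hz.1 t]
    simp only [← tractorOfCoordL_apply, ← map_smul, ← map_sub, V, V']
  have hmem : ∀ z ∈ O, ∀ v, tractorOfCoord φ z v ∈ H (φ.symm z) ↔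
      v ∈ Submodule.span ℝ {V z, V' z} := fun z hz v => by
    rw [hspan z hz, tractorOfCoord_mem_span_iff hφ hz.1]
  have hVm : ∀ z ∈ O, V z ∈ Submodule.span ℝ {V z, V' z} := fun z _ =>
    Submodule.subset_span (Set.mem_insert _ _)
  have hV'm : ∀ z ∈ O, V' z ∈ Submodule.span ℝ {V z, V' z} := fun z _ =>
    Submodule.subset_span (Set.mem_insert_of_mem _ rfl)
  have hU' : ∀ z ∈ O, φ.symm z ∈ U := fun z hz => hWU hz.2.1
  have hnull : ∀ z ∈ O, ∀ v ∈ Submodule.span ℝ {V z, V' z}, ∀ w ∈ Submodule.span ℝ {V z, V' z},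
      Coord.htr (coordMetric g φ) z v w = 0 := fun z hz v hv w hw => by
    rw [← tractorMetric_tractorOfCoord]
    exact hH.totally_null _ (hU' z hz) _ ((hmem z hz v).2 hv) _ ((hmem z hz w).2 hw)
  have hVne : ∀ z ∈ O, (V z).2.1 ≠ 0 := by
    intro z hz h0
    have h1 := hnull z hz _ (hVm z hz) _ (hV'm z hz)
    simp only [Coord.htr, hV0 z hz, hV1 z hz, h0, zero_dotProduct] at h1
    have h2 : V z = 0 := Prod.ext (by simpa using h1) (Prod.ext h0 (hV0 z hz))
    have h3 := hH.rank_two _ (hU' z hz)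
    rw [hspan z hz, h2, ← tractorOfCoordL_apply, map_zero, Submodule.span_insert_zero] at h3
    have h4 := finrank_span_le_card (R := ℝ) ({tractorOfCoord φ z (V' z)} : Set (Tractor n (φ.symm z)))
    rw [h3] at h4
    simp at h4
  -- sections of the plane with prescribed coordinate expressions
  have hconn : ∀ X : EuclideanSpace ℝ (Fin n) → Coord.Tr n, ContDiffOn ℝ ∞ X O →
      (∀ z ∈ O, X z ∈ Submodule.span ℝ {V z, V' z}) → ∀ z ∈ O, ∀ a,
        Coord.tractorConn (coordMetric g φ) a X z ∈ Submodule.span ℝ {V z, V' z} := by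
    intro X hX hXm z hz a
    let F : EuclideanSpace ℝ (Fin n) → ℝ × EuclideanSpace ℝ (Fin n) × ℝ := fun z =>
      (tractorOfCoord φ z (X z) : Tractor n (φ.symm z))
    let σ : ∀ x : M, Tractor n x := fun x => F (φ x)
    have hσ : ∀ z ∈ φ.target, tractorOfCoord φ z (X z) = σ (φ.symm z) := fun z hz =>
      congrArg F (φ.right_inv hz).symm
    have hσX : ∀ z ∈ φ.target, coordTractor σ φ z = X z := fun z hz =>
      tractorOfCoordL_injective hφ hz
        ((tractorOfCoord_coordTractor hφ hz σ).trans (hσ z hz).symm)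
    have hpt : ∀ x ∈ φ.source ∩ φ ⁻¹' O, ∃ z ∈ O, φ.symm z = x := fun x hx =>
      ⟨φ x, hx.2, φ.left_inv hx.1⟩
    have h1 := (hP z hz.1 (hU' z hz)).1 (φ.source ∩ φ ⁻¹' O) (φ.isOpen_inter_preimage hO)
      (fun x hx => by obtain ⟨z, hz, rfl⟩ := hpt x hx; exact hU' z hz)
      ⟨φ.map_target hz.1, by rw [Set.mem_preimage, φ.right_inv hz.1]; exact hz⟩ σ
      (smoothTractorOn_of_coord hφ hX fun z _ hz => hσ z hz)
      (fun x hx => by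
        obtain ⟨z, hz, rfl⟩ := hpt x hx
        rw [← hσ z hz.1]
        exact (hmem z hz _).2 (hXm z hz)) a
    rw [hmem z hz] at h1
    have h2 : coordTractor σ φ =ᶠ[𝓝 z] X := by
      filter_upwards [φ.open_target.mem_nhds hz.1] with w hw using hσX w hw
    rw [Coord.tractorConn_eq_tconn, Coord.tconn_congr h2, ← Coord.tractorConn_eq_tconn] at h1
    exact h1
  have hcurv : ∀ z ∈ O, ∀ v w, Coord.htr (coordMetric g φ) z v (V z) = 0 →
      Coord.htr (coordMetric g φ) z v (V' z) = 0 → Coord.htr (coordMetric g φ) z w (V z) = 0 →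
      Coord.htr (coordMetric g φ) z w (V' z) = 0 → ∀ a b,
      Coord.htr (coordMetric g φ) z (Coord.tractorCurv (coordMetric g φ) a b v z) w = 0 := by
    intro z hz v w hv hv' hw hw' a b
    have key : ∀ v, Coord.htr (coordMetric g φ) z v (V z) = 0 →
        Coord.htr (coordMetric g φ) z v (V' z) = 0 → ∀ u ∈ H (φ.symm z),
        tractorMetric g (φ.symm z) (tractorOfCoord φ z v) u = 0 := by
      intro v hv hv' u hu
      rw [hspan z hz, Submodule.mem_span_pair] at hu
      obtain ⟨c, e, rfl⟩ := hu
      rw [← tractorOfCoordL_apply (V z), ← tractorOfCoordL_apply (V' z), ← map_smul, ← map_smul,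
        ← map_add, tractorOfCoordL_apply, tractorMetric_tractorOfCoord, Coord.htr_add_right,
        Coord.htr_smul_right, Coord.htr_smul_right, hv, hv']
      ring
    rw [← tractorMetric_tractorOfCoord]
    exact (hP z hz.1 (hU' z hz)).2 v w (key v hv hv') (key w hw hw') a b
  have hx : φ x ∈ O := ⟨φ.map_source hxφ, by
    rw [Set.mem_preimage, φ.left_inv hxφ]; exact ⟨hxW, ht0⟩⟩
  obtain ⟨O₁, c, hO₁, hxO₁, hO₁O, hframe⟩ := Coord.exists_isPlaneFrame hG hV hV' hV0 hV1 hVne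
    (fun z hz => hnull z hz _ (hVm z hz) _ (hVm z hz))
    (fun z hz => hnull z hz _ (hVm z hz) _ (hV'm z hz))
    (fun z hz => hnull z hz _ (hV'm z hz) _ (hV'm z hz)) (hconn V hV hVm) (hconn V' hV' hV'm)
    hcurv hx
  obtain ⟨O₂, u, ψ, hO₂, hxO₂, hO₂O₁, hu, hpp⟩ := hframe.exists_isPPOn hn hxO₁
  have hO₂t : O₂ ⊆ φ.target := fun z hz => (hO₁O (hO₂O₁ hz)).1
  refine ⟨φ.source ∩ φ ⁻¹' O₂, φ.isOpen_inter_preimage hO₂, ⟨hxφ, hxO₂⟩, fun x hx => ?_,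
    classContainsPPWaveOn_of_isPPOn hφ hO₂t hu hpp⟩
  have := hU' _ (hO₁O (hO₂O₁ hx.2))
  rwa [φ.left_inv hx.1] at this

/-- Near a dense set of points the plane has a frame with bottom components `0` and `1`, which yields
a local pp-wave; disjointness of the domains allows gluing without compatibility. -/
theorem AdmitsPPTractorPlaneOn.exists_classContainsPPWaveOn (hn : 2 < n)
    (hg : IsPseudoRiemannian g) (hU : IsOpen U) (h : AdmitsPPTractorPlaneOn g U) :
    ∃ V : Set M, IsOpen V ∧ V ⊆ U ∧ U ⊆ closure V ∧ ClassContainsPPWaveOn g V := by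
  obtain ⟨H, hH, hcharts⟩ := h
  have hlocal : ∀ O : Set M, IsOpen O → O ⊆ U → O.Nonempty →
      ∃ N : Set M, IsOpen N ∧ N ⊆ O ∧ N.Nonempty ∧ ClassContainsPPWaveOn g N := by
    intro O hO hOU hne
    obtain ⟨x, hx, v, hv, hv0⟩ := exists_bottom_ne_zero hg hH
      (fun x hx => (hcharts x hx).imp fun φ h => ⟨h.1, h.2.1, fun y hy hyU => (h.2.2 y hy hyU).1⟩)
      hO hOU hne
    obtain ⟨W, hW, hxW, hWU, s, t, hs, ht, hst⟩ := hH.smooth x (hOU hx)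
    have hN : ∃ N : Set M, IsOpen N ∧ x ∈ N ∧ N ⊆ U ∧ ClassContainsPPWaveOn g N := by
      by_cases ht0 : (t x).2.2 = 0
      · have hs0 : (s x).2.2 ≠ 0 := by
          rw [hst x hxW, Submodule.mem_span_pair] at hv
          obtain ⟨c, e, rfl⟩ := hv
          intro hs0
          exact hv0 (by simp [hs0, ht0])
        exact exists_pp_nhd_of_frame hn hg hH hcharts hW hxW hWU ht hs
          (fun z hz => by rw [hst z hz, Set.pair_comm]) hs0
      · exact exists_pp_nhd_of_frame hn hg hH hcharts hW hxW hWU hs ht hst ht0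
    obtain ⟨N, hNo, hxN, -, hN⟩ := hN
    exact ⟨N ∩ O, hNo.inter hO, Set.inter_subset_right, ⟨x, hxN, hx⟩,
      hN.mono Set.inter_subset_left⟩
  -- a maximal disjoint family of open sets over which the class contains a pp-wave
  obtain ⟨𝓕, h𝓕⟩ := zorn_subset {𝓕 : Set (Set M) | (∀ N ∈ 𝓕, IsOpen N ∧ N ⊆ U ∧
      ClassContainsPPWaveOn g N) ∧ 𝓕.PairwiseDisjoint id} (by
    intro c hc hchain
    refine ⟨⋃₀ c, ⟨?_, ?_⟩, fun s hs => Set.subset_sUnion_of_mem hs⟩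
    · rintro N ⟨𝓖, h𝓖, hN⟩
      exact (hc h𝓖).1 N hN
    · exact (Set.pairwiseDisjoint_sUnion hchain.directedOn).2 fun 𝓖 h𝓖 => (hc h𝓖).2)
  obtain ⟨hF, hdisj⟩ := h𝓕.prop
  refine ⟨⋃₀ 𝓕, isOpen_sUnion fun N hN => (hF N hN).1, Set.sUnion_subset fun N hN => (hF N hN).2.1,
    fun x hx => ?_, ClassContainsPPWaveOn.sUnion (fun N hN => (hF N hN).1) hdisj
      fun N hN => (hF N hN).2.2⟩
  by_contra hxc
  obtain ⟨N, hNo, hNs, hNne, hN⟩ := hlocal (U ∩ (closure (⋃₀ 𝓕))ᶜ)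
    (hU.inter isClosed_closure.isOpen_compl) Set.inter_subset_left ⟨x, hx, hxc⟩
  have hNF : N ∉ 𝓕 := fun h => by
    obtain ⟨z, hz⟩ := hNne
    exact (hNs hz).2 (subset_closure ⟨N, h, hz⟩)
  refine hNF (h𝓕.le_of_ge (y := insert N 𝓕) ⟨?_, ?_⟩ (Set.subset_insert _ _) (Set.mem_insert _ _))
  · rintro N' (rfl | hN')
    · exact ⟨hNo, hNs.trans Set.inter_subset_left, hN⟩
    · exact hF N' hN'
  · refine hdisj.insert fun N' hN' _ => Set.disjoint_left.2 fun z hz hz' => ?_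
    exact (hNs hz).2 (subset_closure ⟨N', hN', hz'⟩)

end Charts

end

theorem corollary2 {n : ℕ} (hn : 2 < n) {M : Type*} [TopologicalSpace M] [T2Space M]
    [SecondCountableTopology M] [ChartedSpace (EuclideanSpace ℝ (Fin n)) M]
    [IsManifold (𝓡 n) ∞ M] (g : BilinField n M) (hg : IsPseudoRiemannian g) :
    ((∃ U : Set M, IsOpen U ∧ Dense U ∧ ClassContainsPPWaveOn g U) ↔
      (∃ U : Set M, IsOpen U ∧ Dense U ∧ AdmitsPPTractorPlaneOn g U)) ∧
    (∀ U : Set M, IsOpen U → ClassContainsPPWaveOn g U → AdmitsPPTractorPlaneOn g U) ∧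
    (∀ U : Set M, IsOpen U → AdmitsPPTractorPlaneOn g U →
      ∃ V : Set M, IsOpen V ∧ V ⊆ U ∧ U ⊆ closure V ∧ ClassContainsPPWaveOn g V) := by
  have hab : ∀ U : Set M, IsOpen U → ClassContainsPPWaveOn g U → AdmitsPPTractorPlaneOn g U :=
    fun U hU h => h.admitsPPTractorPlaneOn hn hg hU
  have hba : ∀ U : Set M, IsOpen U → AdmitsPPTractorPlaneOn g U →
      ∃ V : Set M, IsOpen V ∧ V ⊆ U ∧ U ⊆ closure V ∧ ClassContainsPPWaveOn g V :=
    fun U hU h => h.exists_classContainsPPWaveOn hn hg hU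
  refine ⟨⟨fun ⟨U, hU, hd, h⟩ => ⟨U, hU, hd, hab U hU h⟩, fun ⟨U, hU, hd, h⟩ => ?_⟩, hab, hba⟩
  obtain ⟨V, hV, -, hUV, hpp⟩ := hba U hU h
  exact ⟨V, hV, dense_closure.1 (hd.mono hUV), hpp⟩
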